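/- Let $d\ge 1$, $\mathbb{T}^d=\mathbb{R}^d/2\pi\mathbb{Z}^d$ with the Lebesgue measure $dx$ (total mass $(2\pi)^d$), let $\mathbb{S}^{d-1}\subset\mathbb{R}^d$ be the unit sphere with its surface measure $d\mathrm{Vol}$, and let $S\mathbb{T}^d=\mathbb{T}^d\times\mathbb{S}^{d-1}$ with the Liouville measure $dL=dx\otimes d\mathrm{Vol}(\theta)$. Let $e^{tV}:(x,\theta)\mapsto(x+t\theta,\theta)$ be the geodesic flow, and for $\varphi,\psi\in C^\infty(S\mathbb{T}^d)$ (complex valued) put $$\mathrm{Cor}_{\varphi,\psi}(t)=\int_{S\mathbb{T}^d}\varphi(x+t\theta,\theta)\,\overline{\psi(x,\theta)}\,dL .$$ Write $f(x,\theta)=\sum_{\xi\in\mathbb{Z}^d}\hat f_\xi(\theta)e^{i\xi\cdot x}$, i.e. $\hat f_\xi(\theta)=(2\pi)^{-d}\int_{\mathbb{T}^d} f(x,\theta)e^{-i\xi\cdot x}dx$, and $$(P_0f)(\theta)=\frac1{(2\pi)^d}\int_{\mathbb{T}^d}f(x,\theta)\,dx,\qquad (\Pi_0^\pm f)(x)=\sum_{\xi\ne0}\hat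 f_\xi\Big(\pm\frac{\xi}{|\xi|}\Big)e^{i\xi\cdot x}.$$ Let $\Delta=\sum_{j=1}^d\partial_{x_j}^2$; functions of $\sqrt{-\Delta}$ act on functions $g=\sum_\xi \hat g_\xi e^{i\xi\cdot x}$ on $\mathbb{T}^d$ by $m(\sqrt{-\Delta})g=\sum_{\xi\neq0}m(|\xi|)\hat g_\xi e^{i\xi\cdot x}$. (1) For all $\varphi,\psi\in C^\infty(S\mathbb{T}^d)$, as $t\to+\infty$, $$\mathrm{Cor}_{\varphi,\psi}(t)=(2\pi)^d\,(P_0\varphi,P_0\psi)_{L^2(\mathbb{S}^{d-1})}+\Big(\frac{2\pi}{t}\Big)^{\frac{d-1}2}\sum_{\pm}e^{\mp i\frac\pi4(d-1)}\Big(\frac{e^{\pm it\sqrt{-\Delta}}}{\sqrt{-\Delta}^{\,\frac{d-1}2}}\Pi_0^\pm\varphi,\Pi_0^\pm\psi\Big)_{L^2(\mathbb{T}^d)}+\mathcal{O}_{\varphi,\psi}\Big(\frac1{t^{\frac{d-1}2+1}}\Big).$$ The first term is $(P_0\varphi,P_0\psi)_{L^2(S\mathbb{T}^d)}$, $P_0\varphi$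 and $P_0\psi$ being regarded as $x$-invariant functions on $S\mathbb{T}^d$. (2) For every $\psi\in C^\infty(S\mathbb{T}^d)$, as $t\to+\infty$, $$t^{\frac{d-1}2}\Big(\psi\circ e^{-tV}(x,\theta)-\frac1{(2\pi)^d}\int_{\mathbb{T}^d}\psi(y,\theta)\,dy\Big)=(2\pi)^{\frac{d-1}2}\sum_\pm\mathbf{P}_\pm^\dagger\,\frac{e^{\pm i(t\sqrt{-\Delta}-\frac\pi4(d-1))}}{(-\Delta)^{\frac{d-1}4}}\,\mathbf{P}_\pm\psi+\mathcal{O}_{\mathcal{D}'(S\mathbb{T}^d)}(t^{-1}),$$ where functions on $S\mathbb{T}^d$ are regarded as distributions through $dL$, and $$\mathbf{P}_\pm\psi(x)=\sum_{\xi\neq0}\frac1{(2\pi)^d}\int_{\mathbb{T}^d}\psi\Big(y,\pm\frac\xi{|\xi|}\Big)e^{i(y-x)\cdot\xi}dy,\qquad \mathbf{P}_\pm^\dagger f=\sum_{\xi\neq0}\frac1{(2\pi)^d}\Big(\int_{\mathbb{T}^d}f(y)e^{i(y-x)\cdot\xi}dy\Big)\delta_0\Big(\theta\mp\frac\xi{|\xi|}\Big).$$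 The remainder $R_t$ in (2) is bounded by $t^{-1}$ in $\mathcal{D}'$: there are $N$ and $C$, depending on $\psi$ and $d$ only, such that $|\langle R_t,\varphi\rangle|\le C\,t^{-1}\|\varphi\|_{C^N}$ for all $\varphi\in C^\infty(S\mathbb{T}^d)$ and all large $t$. Here $\Pi_0^\pm$ and $\mathbf{P}_\pm$ map $C^\infty(S\mathbb{T}^d)$ to $C^\infty(\mathbb{T}^d)$, the above functions of $\sqrt{-\Delta}$ map $C^\infty(\mathbb{T}^d)$ to itself, $\mathbf{P}_\pm^\dagger$ maps $C^\infty(\mathbb{T}^d)$ to $\mathcal{D}'(S\mathbb{T}^d)$, and the series defining them converge absolutely (for $\mathbf{P}_\pm^\dagger f$: after pairing with any test function). -/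

import Mathlib

open MeasureTheory Set Filter Asymptotics
open scoped ContDiff Manifold Real ComplexConjugate Laplacian

noncomputable section

namespace TorusFlow

/-! ### The torus, the sphere, the unit tangent bundle and its geodesic flow -/

instance twoPiPos : Fact (0 < 2 * π) := ⟨Real.two_pi_pos⟩

instance finrankFact (d : ℕ) [NeZero d] :
    Fact (Module.finrank ℝ (EuclideanSpace ℝ (Fin d)) = (d - 1) + 1) :=
  ⟨by simp [Nat.sub_add_cancel (NeZero.one_le (n := d))]⟩

/-- Euclidean space `ℝ^d`. -/
abbrev E (d : ℕ) : Type := EuclideanSpace ℝ (Fin d)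

/-- The torus `𝕋^d = ℝ^d / 2πℤ^d`; its `volume` is the Lebesgue measure `dx`, of total mass
`(2π)^d`. -/
abbrev Torus (d : ℕ) : Type := Fin d → AddCircle (2 * π)

/-- The unit sphere `S^{d-1}` of `ℝ^d`. -/
abbrev Sph (d : ℕ) : Type := Metric.sphere (0 : E d) 1

/-- The unit tangent bundle `S𝕋^d = 𝕋^d × S^{d-1}`. -/
abbrev ST (d : ℕ) : Type := Torus d × Sph d

variable {d : ℕ}

/-- The canonical projection `ℝ^d → 𝕋^d`. -/
def proj (x : E d) : Torus d := fun i => (x i : AddCircle (2 * π))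

/-- The surface measure `dVol` on `S^{d-1}`. -/
def sphVol (d : ℕ) : Measure (Sph d) := (volume : Measure (E d)).toSphere

/-- The Liouville measure `dx ⊗ dVol(θ)` on `S𝕋^d`. -/
def liouville (d : ℕ) : Measure (ST d) := (volume : Measure (Torus d)).prod (sphVol d)

/-- The geodesic flow `e^{tV} : (x, θ) ↦ (x + tθ, θ)` of the vector field `V = θ · ∂_x`. -/
def flow (t : ℝ) (p : ST d) : ST d := (p.1 + proj (t • (p.2 : E d)), p.2)

/-! ### Smooth functions -/

/-- `C^∞(S𝕋^d)`: complex functions on `𝕋^d × S^{d-1}` whose lift to `ℝ^d × S^{d-1}` is smooth. -/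
def smoothST (d : ℕ) [NeZero d] : Submodule ℂ (ST d → ℂ) where
  carrier := {f | ContMDiff (𝓘(ℝ, E d).prod (𝓡 (d - 1))) 𝓘(ℝ, ℂ) ∞
    (fun p : E d × Sph d => f (proj p.1, p.2))}
  add_mem' := fun hf hg => ContMDiff.add hf hg
  zero_mem' := contMDiff_const
  smul_mem' := fun c _ hf => (contDiff_const_smul (𝕜 := ℝ) (n := ∞) c).contMDiff.comp hf

/-- `C^∞(𝕋^d)`: complex functions on `𝕋^d` whose lift to `ℝ^d` is smooth. -/
def smoothT (d : ℕ) : Submodule ℂ (Torus d → ℂ) where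
  carrier := {f | ContDiff ℝ ∞ (fun x : E d => f (proj x))}
  add_mem' := fun {f g} hf hg => by
    simp only [mem_ofPred_eq] at hf hg ⊢
    exact hf.add hg
  zero_mem' := by
    simp only [mem_ofPred_eq, Pi.zero_apply]
    exact contDiff_const
  smul_mem' := fun c f hf => by
    simp only [mem_ofPred_eq, Pi.smul_apply] at hf ⊢
    exact hf.const_smul c

theorem mem_smoothST [NeZero d] {f : ST d → ℂ} :
    f ∈ smoothST d ↔ ContMDiff (𝓘(ℝ, E d).prod (𝓡 (d - 1))) 𝓘(ℝ, ℂ) ∞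
      (fun p : E d × Sph d => f (proj p.1, p.2)) := Iff.rfl

theorem mem_smoothT {f : Torus d → ℂ} :
    f ∈ smoothT d ↔ ContDiff ℝ ∞ (fun x : E d => f (proj x)) := Iff.rfl

instance sphVolFinite (d : ℕ) : IsFiniteMeasure (sphVol d) :=
  inferInstanceAs (IsFiniteMeasure (volume : Measure (E d)).toSphere)

/-! ### Fourier series on the torus -/

/-- A frequency `ξ ∈ ℤ^d`, as a vector of `ℝ^d`. -/
def freq (ξ : Fin d → ℤ) : E d := WithLp.toLp 2 (fun i => (ξ i : ℝ))

/-- The nonzero frequencies. -/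
abbrev Freq (d : ℕ) : Type := {ξ : Fin d → ℤ // ξ ≠ 0}

theorem freq_ne_zero (ξ : Freq d) : freq ξ.1 ≠ 0 := by
  intro h
  refine ξ.2 (funext fun i => ?_)
  have := congrArg (fun v : E d => v i) h
  simpa [freq] using this

/-- The unit vector `ε ξ/|ξ|`, where `ε = ±1`. -/
def dir (ε : ℤˣ) (ξ : Freq d) : Sph d :=
  ⟨((ε : ℤ) : ℝ) • (‖freq ξ.1‖⁻¹ • freq ξ.1), by
    have h : ‖freq ξ.1‖ ≠ 0 := norm_ne_zero_iff.2 (freq_ne_zero ξ)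
    rcases Int.units_eq_one_or ε with rfl | rfl <;> simp [norm_smul, h]⟩

/-- The character `x ↦ e^{i ξ·x}` of the torus. -/
def chr (ξ : Fin d → ℤ) (x : Torus d) : ℂ := ∏ i, fourier (ξ i) (x i)

/-- The Fourier coefficient `f̂_ξ = (2π)^{-d} ∫ f(x) e^{-iξ·x} dx` of a function on the torus,
so that `f = ∑_ξ f̂_ξ e^{iξ·x}`. -/
def coef (f : Torus d → ℂ) (ξ : Fin d → ℤ) : ℂ :=
  ((2 * π : ℝ) ^ d : ℝ)⁻¹ * ∫ x, f x * conj (chr ξ x)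

/-- The partial Fourier coefficient `f̂_ξ(θ)` in the variable `x`. -/
def pcoef (f : ST d → ℂ) (ξ : Fin d → ℤ) (θ : Sph d) : ℂ := coef (fun x => f (x, θ)) ξ

/-- The function `m(√-Δ) f = ∑_{ξ ≠ 0} m(|ξ|) f̂_ξ e^{iξ·x}`: functional calculus of `√-Δ` on the
orthogonal complement of the constants. -/
def sqrtLapFun (m : ℝ → ℂ) (f : Torus d → ℂ) (x : Torus d) : ℂ :=
  ∑' ξ : Freq d, m ‖freq ξ.1‖ * coef f ξ.1 * chr ξ.1 x

theorem chr_proj (ξ : Fin d → ℤ) (x : E d) :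
    chr ξ (proj x) = Complex.exp (Complex.I * (inner ℝ (freq ξ) x : ℝ)) := by
  have : (inner ℝ (freq ξ) x : ℝ) = ∑ i, (ξ i : ℝ) * x i := by
    simp [freq, PiLp.inner_apply, mul_comm]
  rw [this, chr]
  push_cast
  rw [Finset.mul_sum, Complex.exp_sum]
  refine Finset.prod_congr rfl fun i _ => ?_
  rw [proj, fourier_coe_apply]
  congr 1
  have hp : (π : ℂ) ≠ 0 := by exact_mod_cast Real.pi_ne_zero
  push_cast
  field_simp

/-- The characters are the eigenfunctions of the Laplacian: `-Δ e^{iξ·x} = |ξ|² e^{iξ·x}`. -/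
theorem neg_laplacian_chr (ξ : Fin d → ℤ) (x : E d) :
    -(Δ (fun y : E d => chr ξ (proj y))) x = (‖freq ξ‖ ^ 2 : ℝ) * chr ξ (proj x) := by
  have key : ∀ (y v : E d), HasFDerivAt (fun y : E d => chr ξ (proj y))
      ((chr ξ (proj y) * Complex.I) • (Complex.ofRealCLM.comp (innerSL ℝ (freq ξ)))) y := by
    intro y v
    have h1 : HasFDerivAt (fun y : E d => Complex.I * ((inner ℝ (freq ξ) y : ℝ) : ℂ))
        (Complex.I • (Complex.ofRealCLM.comp (innerSL ℝ (freq ξ)))) y :=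
      (Complex.ofRealCLM.comp (innerSL ℝ (freq ξ))).hasFDerivAt.const_mul _
    have h2 := h1.cexp
    simp only [chr_proj]
    rwa [smul_smul] at h2
  have hf : fderiv ℝ (fun y : E d => chr ξ (proj y)) = fun y =>
      ((chr ξ (proj y) * Complex.I) • (Complex.ofRealCLM.comp (innerSL ℝ (freq ξ)))) :=
    funext fun y => (key y 0).fderiv
  rw [InnerProductSpace.laplacian_eq_iteratedFDeriv_orthonormalBasis _
    (EuclideanSpace.basisFun (Fin d) ℝ)]
  simp only [iteratedFDeriv_two_apply, hf]
  have h3 := (((key x 0).mul_const Complex.I).smul_const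
    (Complex.ofRealCLM.comp (innerSL ℝ (freq ξ)))).fderiv
  rw [h3]
  simp [EuclideanSpace.norm_sq_eq, freq]
  rw [← Finset.sum_neg_distrib, Finset.sum_mul]
  refine Finset.sum_congr rfl fun i _ => ?_
  have hi : (inner ℝ (WithLp.toLp 2 fun i => (ξ i : ℝ)) (EuclideanSpace.single i (1 : ℝ)) : ℝ)
      = ξ i := by simp [EuclideanSpace.inner_single_right]
  rw [hi]
  linear_combination (-(ξ i : ℂ) ^ 2 * chr ξ (proj x)) * Complex.I_sq

/-! ### Scalar products, correlation function and the operators of the expansion -/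

/-- The scalar product of `L²(𝕋^d, dx)`. -/
def innerT (f g : Torus d → ℂ) : ℂ := ∫ x, f x * conj (g x)

/-- The scalar product of `L²(S^{d-1}, dVol)`. -/
def innerS (f g : Sph d → ℂ) : ℂ := ∫ θ, f θ * conj (g θ) ∂(sphVol d)

/-- The correlation function `⟨e^{tV}φ, ψ⟩` in `L²(S𝕋^d)` for the Liouville measure, where
`e^{tV}φ = φ ∘ e^{tV}`. -/
def cor (φ ψ : ST d → ℂ) (t : ℝ) : ℂ := ∫ p, φ (flow t p) * conj (ψ p) ∂(liouville d)

/-- `(P₀ f)(θ) = (2π)^{-d} ∫ f(x, θ) dx`. -/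
def P0 (f : ST d → ℂ) (θ : Sph d) : ℂ := ((2 * π : ℝ) ^ d : ℝ)⁻¹ * ∫ x, f (x, θ)

/-- `(Π₀^± f)(x) = ∑_{ξ ≠ 0} f̂_ξ(± ξ/|ξ|) e^{iξ·x}`. -/
def Pi0 (ε : ℤˣ) (f : ST d → ℂ) (x : Torus d) : ℂ :=
  ∑' ξ : Freq d, pcoef f ξ.1 (dir ε ξ) * chr ξ.1 x

/-- The function `r ↦ e^{± i t r} / r^{(d-1)/2}`. -/
def halfWave (d : ℕ) (ε : ℤˣ) (t r : ℝ) : ℂ :=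
  Complex.exp (((ε : ℤ) : ℂ) * Complex.I * t * r) / ((r ^ (((d : ℝ) - 1) / 2) : ℝ) : ℂ)

/-- The function `r ↦ e^{± i (t r - π(d-1)/4)} / (r²)^{(d-1)/4}`. -/
def shiftedHalfWave (d : ℕ) (ε : ℤˣ) (t r : ℝ) : ℂ :=
  Complex.exp (((ε : ℤ) : ℂ) * Complex.I * (t * r - π / 4 * ((d : ℂ) - 1))) /
    (((r ^ 2) ^ (((d : ℝ) - 1) / 4) : ℝ) : ℂ)

/-- `(𝐏_± ψ)(x) = ∑_{ξ ≠ 0} (2π)^{-d} ∫ ψ(y, ± ξ/|ξ|) e^{i(y-x)·ξ} dy`. -/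
def Pop (ε : ℤˣ) (ψ : ST d → ℂ) (x : Torus d) : ℂ :=
  ∑' ξ : Freq d, ((2 * π : ℝ) ^ d : ℝ)⁻¹ * ∫ y, ψ (y, dir ε ξ) * chr ξ.1 (y - x)

/-- The general term of the series defining the pairing of `𝐏_±† f` with a test function `φ`: the
pairing with `φ` of the distribution
`(2π)^{-d} (∫ f(y) e^{i(y-x)·ξ} dy) δ₀(θ ∓ ξ/|ξ|)` in the variables `(x, θ)`. -/
def PdagTerm (ε : ℤˣ) (f : Torus d → ℂ) (φ : ST d → ℂ) (ξ : Freq d) : ℂ :=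
  ∫ x, (((2 * π : ℝ) ^ d : ℝ)⁻¹ * ∫ y, f y * chr ξ.1 (y - x)) * φ (x, dir ε ξ)

/-- The distribution `𝐏_±† f`, as a functional on test functions. -/
def Pdag [NeZero d] (ε : ℤˣ) (f : Torus d → ℂ) (φ : smoothST d) : ℂ :=
  ∑' ξ : Freq d, PdagTerm ε f φ ξ

/-! ### Distributions on `S𝕋^d` -/

/-- The extension of a function on `𝕋^d × S^{d-1}` to `ℝ^d × (ℝ^d ∖ 0)`, periodic in the first
variable and homogeneous of degree `0` in the second one (and `0` where the second variable is `0`,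
which is never used). -/
def homExt (φ : ST d → ℂ) (p : E d × E d) : ℂ :=
  open Classical in
  if h : p.2 ≠ 0 then φ (proj p.1, ⟨‖p.2‖⁻¹ • p.2, by simp [norm_smul, h]⟩) else 0

/-- The `C^N` norm of a smooth function on `S𝕋^d` (the sum of the norms of the derivatives of order
at most `N` of its homogeneous extension is maximized over `ℝ^d × S^{d-1}`). These norms define the
usual topology of `C^∞(S𝕋^d)`. -/
def cNorm (N : ℕ) (φ : ST d → ℂ) : ℝ :=
  ⨆ p : E d × Sph d,
    ∑ k ∈ Finset.range (N + 1), ‖iteratedFDeriv ℝ k (homExt φ) (p.1, (p.2 : E d))‖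

/-- A functional on `C^∞(S𝕋^d)` is a distribution, an element of `𝓓'(S𝕋^d)`, if it is linear and
bounded by one of the `C^N` norms. -/
def IsDistribution [NeZero d] (u : smoothST d → ℂ) : Prop :=
  IsLinearMap ℂ u ∧ ∃ (N : ℕ) (C : ℝ), ∀ φ : smoothST d, ‖u φ‖ ≤ C * cNorm N φ.1

/-- `R t = O(g t)` in `𝓓'(S𝕋^d)` as `t → +∞`: bounds by `g` that are uniform over test functions
in a ball of some `C^N` norm. -/
def IsBigODistribution [NeZero d] (R : ℝ → smoothST d → ℂ) (g : ℝ → ℝ) : Prop :=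
  (∀ᶠ t in atTop, IsDistribution (R t)) ∧
  ∃ (N : ℕ) (C : ℝ), ∀ᶠ t in atTop, ∀ φ : smoothST d, ‖R t φ‖ ≤ C * cNorm N φ.1 * |g t|

/-- The distribution on `S𝕋^d` defined by a function, through the Liouville measure. -/
def ofFun [NeZero d] (u : ST d → ℂ) (φ : smoothST d) : ℂ := ∫ p, u p * φ.1 p ∂(liouville d)

end TorusFlow

end

noncomputable section

namespace TorusFlow

variable {d : ℕ}

/-! ### The Fourier transform of the surface measure -/

/-! In a Fourier series in `x`, the flow multiplies the mode `ξ` by `e^{itξ·θ}`. The correlation is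
therefore a sum over `ξ` of oscillatory integrals on the sphere with phase `tξ·θ`. The mode `ξ = 0`
does not oscillate and gives the constant term. For `ξ ≠ 0` the phase is critical at the two poles
`±ξ/|ξ|`. Each pole contributes the amplitude there times `(2π/(t|ξ|))^((d-1)/2) e^{±i(t|ξ| -
π(d-1)/4)}`, and the error is smaller by a factor `1/t`. Two points need care: the exact constant
with its error, and the summation over `ξ` with explicit dependence on both functions.

Amplitudes are removed by Fourier analysis in `θ` as well. A smooth function on `S𝕋^d` is extended
homogeneously off the sphere, cut off and periodized, so it becomes a smooth function on a torus of
dimension `2d`. It thus has a rapidly convergent expansion `∑ c(ξ, η) e^{iξ·x} e^{iη·θ}`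
(`hasSum_fcoef`). Every oscillatory integral becomes a series of values `sphFT (tξ + η + η')` of the
Fourier transform of the bare surface measure (`hasSum_corrMode`). What remains is the asymptotics
of this one function, with error polynomial in `η + η'` (`sphFT_shift`). The leading terms resum to
the values of the coefficients at the poles (`corrMode_asymptotics`).

The function `sphFT` is found from its power series: the moments of the sphere come from Gaussian
integrals and satisfy a two-term recursion, which also characterizes the moments of `(1 - s²)^(m-1)`
with `m = (d-1)/2`. For `d ≥ 2` this makes `sphFT` a Bessel-type integral, and for `d = 1` it is a
cosine. The Bessel integral times `r^m` solves `w'' + w = m(m-1)w/r²`, hence equals `Re(L e^{ir}) +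
O(1/r)` for some `L` (`ode_asymptotics`). The constant `L` is read off from the Abel limit of `ε ∫
w(r) e^{-(ε+i)r} dr`, computed once from the asymptotics (`abel_limit`) and once by Fubini
(`integral_besselInt_cexp`, `tendsto_gegWeight_cpow`).

All bounds are in a weighted `ℓ¹` norm `wnorm` of the coefficients, itself bounded by a `C^N` norm
(`exists_wnorm_le`). The single bilinear estimate `corr_asymptotics` then gives both statements: the
first with `ψ` conjugated, the second with `φ` as test function after reversing time (`corr_neg`).
-/

/-- The Fourier transform `v ↦ ∫ e^{i v·θ} dVol(θ)` of the surface measure of the sphere. -/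
def sphFT (v : E d) : ℂ :=
  ∫ θ : Sph d, Complex.exp (Complex.I * (inner ℝ v (θ : E d) : ℝ)) ∂(sphVol d)

theorem radial_gaussian_moment (k : ℕ) :
    ∫ r in Ioi (0 : ℝ), r ^ k * Real.exp (-r ^ 2) = Real.Gamma ((k + 1) / 2) / 2 := by
  have h := integral_rpow_mul_exp_neg_rpow (p := 2) (q := k) two_pos
    (by linarith [(Nat.cast_nonneg k : (0 : ℝ) ≤ k)])
  rw [show Real.Gamma ((k + 1) / 2) / 2 = 1 / 2 * Real.Gamma ((k + 1) / 2) by ring, ← h]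
  exact setIntegral_congr_fun measurableSet_Ioi fun r _ => by simp

theorem gaussian_moment_odd {n : ℕ} (hn : Odd n) :
    ∫ s : ℝ, s ^ n * Real.exp (-s ^ 2) = 0 := by
  have h := integral_neg_eq_self (fun s : ℝ => s ^ n * Real.exp (-s ^ 2)) volume
  simp only [hn.neg_pow, neg_mul, integral_neg, even_two.neg_pow] at h
  linarith

theorem gaussian_moment_even {n : ℕ} (hn : Even n) :
    ∫ s : ℝ, s ^ n * Real.exp (-s ^ 2) = Real.Gamma ((n + 1) / 2) := by
  have h := integral_comp_abs (f := fun s : ℝ => s ^ n * Real.exp (-s ^ 2))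
  simp only [hn.pow_abs, sq_abs, radial_gaussian_moment] at h
  rw [h]; ring

theorem gaussian_moment_succ_succ (n : ℕ) :
    ∫ s : ℝ, s ^ (n + 2) * Real.exp (-s ^ 2) =
      (n + 1) / 2 * ∫ s : ℝ, s ^ n * Real.exp (-s ^ 2) := by
  rcases Nat.even_or_odd n with hn | hn
  · rw [gaussian_moment_even hn, gaussian_moment_even (hn.add even_two),
      ← Real.Gamma_add_one (by positivity)]
    congr 1; push_cast; ring
  · rw [gaussian_moment_odd hn, gaussian_moment_odd (hn.add_even even_two), mul_zero]

/-- Integration in polar coordinates, for products. -/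
theorem integral_polar_mul (d : ℕ) [NeZero d] (g : Sph d → ℝ) (h : ℝ → ℝ) (F : E d → ℝ)
    (hF : ∀ θ : Sph d, ∀ r : ℝ, 0 < r → F (r • (θ : E d)) = g θ * h r) :
    ∫ x, F x = (∫ θ, g θ ∂(sphVol d)) * ∫ r in Ioi (0 : ℝ), r ^ (d - 1) * h r := by
  have hd : Module.finrank ℝ (E d) = d := by simp
  have : Nontrivial (E d) := Module.nontrivial_of_finrank_pos (R := ℝ) (by simp [NeZero.pos])
  calc
    ∫ x, F x = ∫ x : ({(0)}ᶜ : Set (E d)), F x ∂((volume : Measure (E d)).comap (↑)) := by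
      rw [integral_subtype_comap (measurableSet_singleton _).compl F, restrict_compl_singleton]
    _ = ∫ p, F (p.2.1 • p.1.1) ∂(volume : Measure (E d)).toSphere.prod (.volumeIoiPow (d - 1)) := by
      have := (volume : Measure (E d)).measurePreserving_homeomorphUnitSphereProd.integral_comp
        (Homeomorph.measurableEmbedding _) (fun p => F (p.2.1 • p.1.1))
      rw [hd] at this
      rw [← this]
      refine integral_congr_ae (.of_forall fun x => ?_)
      have hx := homeomorphUnitSphereProd_symm_apply_coe (E d) (homeomorphUnitSphereProd (E d) x)
      simp only [Homeomorph.symm_apply_apply] at hx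
      simp only [← hx]
    _ = ∫ p, g p.1 * h p.2.1 ∂(volume : Measure (E d)).toSphere.prod (.volumeIoiPow (d - 1)) :=
      integral_congr_ae (.of_forall fun p => hF _ _ p.2.2)
    _ = (∫ θ, g θ ∂(sphVol d)) * ∫ r : Ioi (0 : ℝ), h r ∂.volumeIoiPow (d - 1) :=
      integral_prod_mul (μ := (volume : Measure (E d)).toSphere) (ν := .volumeIoiPow (d - 1)) g
        (fun r : Ioi (0 : ℝ) => h r)
    _ = _ := by
      congr 1
      simp only [Measure.volumeIoiPow, ENNReal.ofReal]
      rw [integral_withDensity_eq_integral_smul,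
        integral_subtype_comap measurableSet_Ioi fun a ↦ Real.toNNReal (a ^ (d - 1)) • h a,
        setIntegral_congr_fun measurableSet_Ioi fun x hx ↦ ?_]
      · rw [NNReal.smul_def, Real.coe_toNNReal _ (pow_nonneg (le_of_lt hx) _), smul_eq_mul]
      · exact (measurable_subtype_coe.pow_const _).real_toNNReal

/-- The reflection in the hyperplane orthogonal to `v - ‖v‖e₀` maps `v` to `‖v‖e₀`, since both
vectors have the same norm. It reduces integrals of functions of `v·x` to a single coordinate. -/
theorem exists_isometry_inner_eq [NeZero d] (v : E d) :
    ∃ R : E d ≃ₗᵢ[ℝ] E d, ∀ x, (inner ℝ v x : ℝ) = ‖v‖ * (R x) 0 := by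
  set w : E d := EuclideanSpace.single 0 ‖v‖ with hw
  have h : ‖v‖ = ‖w‖ := by simp [hw]
  refine ⟨(ℝ ∙ (v - w))ᗮ.reflection, fun x => ?_⟩
  rw [← LinearIsometryEquiv.inner_map_map (ℝ ∙ (v - w))ᗮ.reflection v x,
    Submodule.reflection_sub h, hw, EuclideanSpace.inner_single_left]
  simp

/-- The Gaussian is rotation invariant and a product: after rotating `v` onto the first axis, Fubini
leaves one moment and `d - 1` plain Gaussian integrals. -/
theorem integral_inner_pow_gaussian [NeZero d] (v : E d) (n : ℕ) :
    ∫ x : E d, (inner ℝ v x : ℝ) ^ n * Real.exp (-‖x‖ ^ 2) =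
      ‖v‖ ^ n * ((∫ s : ℝ, s ^ n * Real.exp (-s ^ 2)) * √π ^ (d - 1)) := by
  obtain ⟨R, hR⟩ := exists_isometry_inner_eq v
  have h1 := R.measurePreserving.integral_comp R.toHomeomorph.measurableEmbedding
    (fun x => ‖v‖ ^ n * (x 0 ^ n * Real.exp (-‖x‖ ^ 2)))
  simp only [LinearIsometryEquiv.norm_map] at h1
  simp only [hR, mul_pow, mul_assoc]
  rw [h1, integral_const_mul]
  congr 1
  have h2 := (PiLp.volume_preserving_ofLp (Fin d)).integral_comp
    (MeasurableEquiv.toLp 2 (Fin d → ℝ)).symm.measurableEmbedding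
    (fun x : Fin d → ℝ => ∏ i, (if i = 0 then x i ^ n else 1) * Real.exp (-x i ^ 2))
  have h3 : ∀ x : Fin d → ℝ, (∏ i, (if i = 0 then x i ^ n else 1) * Real.exp (-x i ^ 2)) =
      x 0 ^ n * Real.exp (-∑ i, x i ^ 2) := fun x => by
    rw [Finset.prod_mul_distrib, ← Finset.sum_neg_distrib, Real.exp_sum]
    simp
  have h4 := integral_fintype_prod_eq_prod (𝕜 := ℝ) (ι := Fin d) (E := fun _ => ℝ)
    (f := fun i s => (if i = 0 then s ^ n else 1) * Real.exp (-s ^ 2)) (μ := fun _ => volume)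
  simp only [h3] at h2 h4
  rw [← volume_pi] at h4
  simp only [EuclideanSpace.norm_sq_eq, Real.norm_eq_abs, sq_abs]
  rw [h2, h4, ← Finset.mul_prod_erase Finset.univ _ (Finset.mem_univ 0)]
  congr 1
  have hg : ∫ s : ℝ, Real.exp (-s ^ 2) = √π := by simpa using integral_gaussian 1
  rw [Finset.prod_congr rfl (g := fun _ => √π)]
  · simp [Finset.card_erase_of_mem]
  · intro i hi
    simp [Finset.ne_of_mem_erase hi, hg]

/-- The moments of the surface measure of the sphere. -/
theorem sphere_moment [NeZero d] (v : E d) (n : ℕ) :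
    (∫ θ : Sph d, (inner ℝ v (θ : E d) : ℝ) ^ n ∂(sphVol d)) * (Real.Gamma ((n + d) / 2) / 2) =
      ‖v‖ ^ n * ((∫ s : ℝ, s ^ n * Real.exp (-s ^ 2)) * √π ^ (d - 1)) := by
  rw [← integral_inner_pow_gaussian, integral_polar_mul d
    (fun θ => (inner ℝ v (θ : E d) : ℝ) ^ n) (fun r => r ^ n * Real.exp (-r ^ 2))]
  · congr 1
    simp only [← mul_assoc, ← pow_add]
    rw [radial_gaussian_moment]
    have : (1 : ℝ) ≤ d := by exact_mod_cast NeZero.one_le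
    congr 3
    push_cast [NeZero.one_le (n := d)]
    ring
  · intro θ r hr
    rw [inner_smul_right, norm_smul]
    simp [mul_pow, abs_of_pos hr]
    ring

/-- After multiplication by `Γ((n+d)/2)/2`, the recursion for `a` becomes that of the
one-dimensional Gaussian moments. Hence any sequence with these two initial values and this
recursion gives the moments of the sphere; no slicing of the surface measure is needed. -/
theorem sphere_moment_eq [NeZero d] {a : ℕ → ℝ}
    (h0 : a 0 = 2 * √π ^ d / Real.Gamma (d / 2)) (h1 : a 1 = 0)
    (hrec : ∀ n : ℕ, (n + d : ℝ) * a (n + 2) = (n + 1) * a n) (v : E d) (n : ℕ) :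
    ∫ θ : Sph d, (inner ℝ v (θ : E d) : ℝ) ^ n ∂(sphVol d) = ‖v‖ ^ n * a n := by
  have hd : (0 : ℝ) < d := by exact_mod_cast NeZero.pos d
  have hG : ∀ n : ℕ, 0 < Real.Gamma ((n + d) / 2) := fun n => Real.Gamma_pos_of_pos (by positivity)
  have key : ∀ n : ℕ, a n * (Real.Gamma ((n + d) / 2) / 2) =
      (∫ s : ℝ, s ^ n * Real.exp (-s ^ 2)) * √π ^ (d - 1) := by
    intro n
    induction n using Nat.twoStepInduction with
    | zero =>
      have hg : ∫ s : ℝ, Real.exp (-s ^ 2) = √π := by simpa using integral_gaussian 1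
      have h := hG 0
      simp only [Nat.cast_zero, zero_add] at h
      simp only [h0, pow_zero, one_mul, hg, Nat.cast_zero, zero_add]
      rw [mul_pow_sub_one (NeZero.ne d)]
      field_simp
    | one => rw [h1, gaussian_moment_odd odd_one]; simp
    | more n ih _ =>
      rw [gaussian_moment_succ_succ]
      have e : ((n + 2 : ℕ) + d : ℝ) / 2 = (n + d) / 2 + 1 := by push_cast; ring
      rw [e, Real.Gamma_add_one (by positivity)]
      linear_combination (Real.Gamma ((n + d) / 2) / 2) / 2 * hrec n + (n + 1) / 2 * ih
  have h := sphere_moment v n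
  rw [← key, ← mul_assoc] at h
  exact mul_right_cancel₀ (by have := hG n; positivity) h

/-- Expansion of the characteristic function of a measure with density in terms of moments. -/
theorem hasSum_integral_exp_I {α : Type*} [MeasurableSpace α] {μ : Measure α} {ρ f : α → ℝ}
    (hρ : Integrable ρ μ) (hf : Measurable f) {B : ℝ} (hB : ∀ᵐ x ∂μ, |f x| ≤ B) :
    HasSum (fun n : ℕ => Complex.I ^ n / (n.factorial : ℂ) * ((∫ x, f x ^ n * ρ x ∂μ : ℝ) : ℂ))
      (∫ x, Complex.exp (Complex.I * f x) * ρ x ∂μ) := by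
  have hs : ∀ x, Summable fun n : ℕ => (|B| ^ n / n.factorial : ℝ) * |ρ x| := fun x =>
    (Real.summable_pow_div_factorial |B|).mul_right _
  have := hasSum_integral_of_dominated_convergence (μ := μ)
    (F := fun (n : ℕ) x => (Complex.I * f x) ^ n / (n.factorial : ℂ) * (ρ x : ℂ))
    (f := fun x => Complex.exp (Complex.I * f x) * ρ x)
    (fun n x => (|B| ^ n / n.factorial) * |ρ x|) ?_ ?_ ?_ ?_ ?_
  · refine this.congr_fun fun n => ?_
    rw [← integral_complex_ofReal, ← integral_const_mul]
    refine integral_congr_ae (.of_forall fun x => ?_)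
    push_cast
    simp only [mul_pow]
    ring
  · intro n
    refine AEStronglyMeasurable.mul (by fun_prop) ?_
    exact Complex.continuous_ofReal.comp_aestronglyMeasurable hρ.1
  · intro n
    filter_upwards [hB] with x hx
    simp only [norm_mul, norm_div, norm_pow, Complex.norm_I, one_mul, Complex.norm_real,
      Real.norm_eq_abs, Complex.norm_natCast]
    have := hx.trans (le_abs_self B)
    gcongr
  · exact .of_forall hs
  · simp only [tsum_mul_right]
    exact hρ.abs.const_mul _
  · refine .of_forall fun x => ?_
    have := (NormedSpace.expSeries_div_hasSum_exp (Complex.I * (f x : ℂ))).mul_right (ρ x : ℂ)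
    rwa [← Complex.exp_eq_exp_ℂ] at this

/-- It suffices to exhibit another integral or function with the same Taylor coefficients in order
to identify `sphFT`. -/
theorem hasSum_sphFT [NeZero d] {a : ℕ → ℝ}
    (h0 : a 0 = 2 * √π ^ d / Real.Gamma (d / 2)) (h1 : a 1 = 0)
    (hrec : ∀ n : ℕ, (n + d : ℝ) * a (n + 2) = (n + 1) * a n) (v : E d) :
    HasSum (fun n : ℕ => Complex.I ^ n / (n.factorial : ℂ) * ((‖v‖ ^ n * a n : ℝ) : ℂ))
      (sphFT v) := by
  have := hasSum_integral_exp_I (μ := sphVol d) (ρ := fun _ => 1)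
    (f := fun θ : Sph d => (inner ℝ v (θ : E d) : ℝ)) (integrable_const 1)
    (by fun_prop) (B := ‖v‖) (.of_forall fun θ => by
      simpa using abs_real_inner_le_norm v (θ : E d))
  simpa [sphere_moment_eq h0 h1 hrec, sphFT] using this

/-! ### Integrals against the weight `(1 - s²)^(m - 1)` on `[-1, 1]` -/

/-- The weight `(1 - s²)^(m - 1)`. -/
def gegWeight (m s : ℝ) : ℝ := (1 - s ^ 2) ^ (m - 1)

theorem gegWeight_neg (m s : ℝ) : gegWeight m (-s) = gegWeight m s := by simp [gegWeight]

theorem gegWeight_nonneg {m s : ℝ} (hs : s ∈ Icc (-1 : ℝ) 1) : 0 ≤ gegWeight m s :=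
  Real.rpow_nonneg (by nlinarith [hs.1, hs.2]) _

theorem measurable_gegWeight (m : ℝ) : Measurable (gegWeight m) := by
  unfold gegWeight; fun_prop

/-- For `m < 1` the weight blows up at both endpoints. On `[0, 1]` only the factor `(1 - s)^(m-1)`
is singular, and evenness gives the other half. -/
theorem intervalIntegrable_gegWeight {m : ℝ} (hm : 0 < m) :
    IntervalIntegrable (gegWeight m) volume (-1) 1 := by
  have h01 : IntervalIntegrable (gegWeight m) volume 0 1 := by
    have h1 : IntervalIntegrable (fun s : ℝ => (1 - s) ^ (m - 1)) volume 0 1 := by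
      simpa using (intervalIntegral.intervalIntegrable_rpow' (a := 1) (b := 0)
        (show -1 < m - 1 by linarith)).comp_sub_left 1
    have h2 := h1.mul_continuousOn (g := fun s : ℝ => (1 + s) ^ (m - 1)) (by
      refine ContinuousOn.rpow_const (by fun_prop) fun s hs => Or.inl ?_
      rw [uIcc_of_le zero_le_one] at hs
      linarith [hs.1])
    refine h2.congr fun s hs => ?_
    rw [uIoc_of_le zero_le_one] at hs
    simp only [gegWeight]
    rw [← Real.mul_rpow (by linarith [hs.2]) (by linarith [hs.1])]
    congr 1; ring
  have h10 : IntervalIntegrable (gegWeight m) volume (-1) 0 := by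
    rw [IntervalIntegrable.iff_comp_neg]
    simpa [gegWeight_neg] using h01.symm
  exact h10.trans h01

/-- The substitution `s = 2u - 1` gives the Beta integral `B(m, m)`, and the duplication formula
rewrites the resulting `Γ(2m)`. -/
theorem integral_gegWeight {m : ℝ} (hm : 0 < m) :
    ∫ s in (-1 : ℝ)..1, gegWeight m s = √π * Real.Gamma m / Real.Gamma (m + 1 / 2) := by
  have hβ : Real.Gamma m * Real.Gamma m = Real.Gamma (2 * m) *
      ∫ u in (0 : ℝ)..1, u ^ (m - 1) * (1 - u) ^ (m - 1) := by
    have h := Complex.Gamma_mul_Gamma_eq_betaIntegral (s := m) (t := m) (by simpa) (by simpa)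
    have e : Complex.betaIntegral m m =
        ((∫ u in (0 : ℝ)..1, u ^ (m - 1) * (1 - u) ^ (m - 1) : ℝ) : ℂ) := by
      rw [Complex.betaIntegral, ← intervalIntegral.integral_ofReal]
      refine intervalIntegral.integral_congr fun u hu => ?_
      rw [uIcc_of_le zero_le_one] at hu
      push_cast
      rw [Complex.ofReal_cpow hu.1, Complex.ofReal_cpow (by linarith [hu.2])]
      push_cast; rfl
    rw [e, ← two_mul, show 2 * (m : ℂ) = ((2 * m : ℝ) : ℂ) by push_cast; rfl,
      Complex.Gamma_ofReal, Complex.Gamma_ofReal] at h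
    exact_mod_cast h
  have hsub : ∫ s in (-1 : ℝ)..1, gegWeight m s =
      2 ^ (2 * m - 1) * ∫ u in (0 : ℝ)..1, u ^ (m - 1) * (1 - u) ^ (m - 1) := by
    have h := intervalIntegral.integral_comp_mul_sub (a := 0) (b := 1) (gegWeight m)
      (two_ne_zero (α := ℝ)) 1
    have e : ∀ u ∈ uIcc (0 : ℝ) 1, gegWeight m (2 * u - 1) =
        4 ^ (m - 1) * (u ^ (m - 1) * (1 - u) ^ (m - 1)) := fun u hu => by
      rw [uIcc_of_le zero_le_one] at hu
      rw [← Real.mul_rpow hu.1 (by linarith [hu.2]), ← Real.mul_rpow (by norm_num)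
        (mul_nonneg hu.1 (by linarith [hu.2])), gegWeight]
      congr 1; ring
    rw [intervalIntegral.integral_congr e, intervalIntegral.integral_const_mul] at h
    norm_num at h
    have h4 : (2 : ℝ) ^ (2 * m - 1) = 2 * 4 ^ (m - 1) := by
      rw [show (4 : ℝ) = 2 ^ (2 : ℝ) by norm_num, ← Real.rpow_mul two_pos.le,
        show 2 * m - 1 = 2 * (m - 1) + 1 by ring, Real.rpow_add_one two_ne_zero]
      ring
    rw [h4, mul_assoc, h]; ring
  have hd := Real.Gamma_mul_Gamma_add_half_of_pos hm
  have hG := Real.Gamma_pos_of_pos hm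
  have hG2 := Real.Gamma_pos_of_pos (by linarith : 0 < 2 * m)
  have hG3 := Real.Gamma_pos_of_pos (by linarith : 0 < m + 1 / 2)
  have h2 : (2 : ℝ) ^ (2 * m - 1) * 2 ^ (1 - 2 * m) = 1 := by
    rw [← Real.rpow_add two_pos]; simp
  rw [hsub, eq_div_iff hG3.ne']
  -- Clearing `Γ(2m)Γ(m)` makes the claim a combination of the Beta identity `hβ`, the duplication
  -- formula `hd` and the cancellation `h2` of powers of two.
  refine mul_left_cancel₀ (mul_pos hG2 hG).ne' ?_
  linear_combination (-(2 : ℝ) ^ (2 * m - 1) * (Real.Gamma m) * Real.Gamma (m + 1 / 2)) * hβ +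
    2 ^ (2 * m - 1) * Real.Gamma m ^ 2 * hd +
    Real.Gamma (2 * m) * √π * Real.Gamma m ^ 2 * h2

/-- Integration by parts against the weight. -/
theorem integral_parts_gegWeight {m : ℝ} (hm : 0 < m) {q q' : ℝ → ℝ}
    (hq : ∀ s, HasDerivAt q (q' s) s) (hq' : Continuous q') :
    ∫ s in (-1 : ℝ)..1, (q' s * (1 - s ^ 2) - 2 * m * s * q s) * gegWeight m s = 0 := by
  have hqc : Continuous q := continuous_iff_continuousAt.2 fun s => (hq s).continuousAt
  have h := intervalIntegral.integral_eq_sub_of_hasDeriv_right_of_le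
    (f := fun s : ℝ => q s * (1 - s ^ 2) ^ m)
    (f' := fun s => (q' s * (1 - s ^ 2) - 2 * m * s * q s) * gegWeight m s)
    (show (-1 : ℝ) ≤ 1 by norm_num) ?_ ?_ ?_
  · rw [h]; simp [Real.zero_rpow hm.ne']
  · exact hqc.continuousOn.mul (ContinuousOn.rpow_const (by fun_prop) fun _ _ => Or.inr hm.le)
  · intro s hs
    have hpos : 0 < 1 - s ^ 2 := by nlinarith [hs.1, hs.2]
    have h1 : HasDerivAt (fun s : ℝ => 1 - s ^ 2) (-(2 * s)) s := by
      simpa using (hasDerivAt_pow 2 s).const_sub 1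
    have h2 := (hq s).mul (h1.rpow_const (p := m) (Or.inl hpos.ne'))
    refine HasDerivAt.hasDerivWithinAt (h2.congr_deriv ?_)
    have : (1 - s ^ 2) ^ m = (1 - s ^ 2) * (1 - s ^ 2) ^ (m - 1) := by
      rw [Real.rpow_sub_one hpos.ne']; field_simp
    rw [this, gegWeight]; ring
  · exact (intervalIntegrable_gegWeight hm).continuousOn_mul (by fun_prop)

theorem gegWeight_moment_succ_succ {m : ℝ} (hm : 0 < m) (n : ℕ) :
    (n + (2 * m + 1)) * ∫ s in (-1 : ℝ)..1, s ^ (n + 2) * gegWeight m s =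
      (n + 1) * ∫ s in (-1 : ℝ)..1, s ^ n * gegWeight m s := by
  have h := integral_parts_gegWeight hm (q := fun s => s ^ (n + 1))
    (q' := fun s => (n + 1) * s ^ n) (fun s => by simpa using hasDerivAt_pow (n + 1) s)
    (by fun_prop)
  have hi : ∀ k : ℕ, IntervalIntegrable (fun s => s ^ k * gegWeight m s) volume (-1) 1 :=
    fun k => (intervalIntegrable_gegWeight hm).continuousOn_mul (by fun_prop)
  rw [← sub_eq_zero, ← intervalIntegral.integral_const_mul, ← intervalIntegral.integral_const_mul,
    ← intervalIntegral.integral_sub ((hi _).const_mul _) ((hi _).const_mul _), ← neg_eq_zero,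
    ← intervalIntegral.integral_neg, ← h]
  exact intervalIntegral.integral_congr fun s _ => by ring

theorem gegWeight_moment_one (m : ℝ) : ∫ s in (-1 : ℝ)..1, s ^ 1 * gegWeight m s = 0 := by
  have h := intervalIntegral.integral_comp_neg (a := -1) (b := 1)
    (fun s : ℝ => s ^ 1 * gegWeight m s)
  simp only [gegWeight_neg, pow_one, neg_mul, intervalIntegral.integral_neg, neg_neg] at h ⊢
  linarith

/-- The Bessel-type integral `∫ cos(rs) (1 - s²)^(m - 1) ds` over `[-1, 1]`. -/
def besselInt (m r : ℝ) : ℝ := ∫ s in (-1 : ℝ)..1, Real.cos (r * s) * gegWeight m s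

theorem integral_exp_gegWeight {m : ℝ} (hm : 0 < m) (r : ℝ) :
    ∫ s in (-1 : ℝ)..1, Complex.exp (Complex.I * (r * s : ℝ)) * gegWeight m s = besselInt m r := by
  have hc : ∀ g : ℝ → ℝ, Continuous g →
      IntervalIntegrable (fun s => g s * gegWeight m s) volume (-1) 1 := fun g hg =>
    (intervalIntegrable_gegWeight hm).continuousOn_mul hg.continuousOn
  have hsin : ∫ s in (-1 : ℝ)..1, Real.sin (r * s) * gegWeight m s = 0 := by
    have h := intervalIntegral.integral_comp_neg (a := -1) (b := 1)
      (fun s : ℝ => Real.sin (r * s) * gegWeight m s)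
    simp only [gegWeight_neg, mul_neg, Real.sin_neg, neg_mul, intervalIntegral.integral_neg,
      neg_neg] at h
    linarith
  have e : ∀ s : ℝ, Complex.exp (Complex.I * (r * s : ℝ)) * gegWeight m s =
      ((Real.cos (r * s) * gegWeight m s : ℝ) : ℂ) +
        Complex.I * ((Real.sin (r * s) * gegWeight m s : ℝ) : ℂ) := fun s => by
    rw [mul_comm Complex.I, Complex.exp_mul_I]; push_cast; ring
  simp only [e]
  rw [intervalIntegral.integral_add, intervalIntegral.integral_const_mul,
    intervalIntegral.integral_ofReal, intervalIntegral.integral_ofReal, hsin, besselInt]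
  · simp
  · have h := hc (fun s => Real.cos (r * s)) (by fun_prop)
    exact ⟨h.1.ofReal, h.2.ofReal⟩
  · have h := hc (fun s => Real.sin (r * s)) (by fun_prop)
    exact IntervalIntegrable.const_mul ⟨h.1.ofReal, h.2.ofReal⟩ _

/-- With `2m + 1 = d`, the moments of the weight obey the recursion of the sphere moments. The
prefactor normalizes the zeroth moment to the area of the sphere, so the two power series coincide.
-/
theorem sphFT_eq_besselInt [NeZero d] (hd : 2 ≤ d) (v : E d) :
    sphFT v = ((2 * π ^ (((d : ℝ) - 1) / 2) / Real.Gamma (((d : ℝ) - 1) / 2) *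
      besselInt (((d : ℝ) - 1) / 2) ‖v‖ : ℝ) : ℂ) := by
  set m : ℝ := ((d : ℝ) - 1) / 2 with hm_def
  have hm : 0 < m := by
    have : (2 : ℝ) ≤ d := by exact_mod_cast hd
    simp only [hm_def]; linarith
  set κ : ℝ := 2 * π ^ m / Real.Gamma m with hκ
  have hG := Real.Gamma_pos_of_pos hm
  have h1 := hasSum_sphFT (d := d)
    (a := fun n => κ * ∫ s in (-1 : ℝ)..1, s ^ n * gegWeight m s) ?_ ?_ ?_ v
  · have h2 := (hasSum_integral_exp_I (μ := volume.restrict (Ioc (-1 : ℝ) 1)) (ρ := gegWeight m)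
      (f := fun s => ‖v‖ * s) (intervalIntegrable_gegWeight hm).1 (by fun_prop) (B := ‖v‖) ?_)
    · rw [Complex.ofReal_mul, ← integral_exp_gegWeight hm]
      refine (h1.unique ((h2.mul_left (κ : ℂ)).congr_fun fun n => ?_)).trans ?_
      · simp only [mul_pow, mul_assoc]
        rw [integral_const_mul, intervalIntegral.integral_of_le (by norm_num)]
        push_cast; ring
      · rw [intervalIntegral.integral_of_le (by norm_num)]
    · filter_upwards [ae_restrict_mem measurableSet_Ioc] with s hs
      rw [abs_mul, abs_norm]
      exact mul_le_of_le_one_right (norm_nonneg _) (abs_le.2 ⟨hs.1.le, hs.2⟩)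
  · simp only [pow_zero, one_mul]
    rw [integral_gegWeight hm, hκ, show m + 1 / 2 = (d : ℝ) / 2 by rw [hm_def]; ring,
      Real.sqrt_eq_rpow, ← Real.rpow_natCast (π ^ (1 / 2 : ℝ)), ← Real.rpow_mul Real.pi_pos.le]
    have : π ^ (1 / 2 * (d : ℝ)) = π ^ m * π ^ (1 / 2 : ℝ) := by
      rw [← Real.rpow_add Real.pi_pos]; congr 1; rw [hm_def]; ring
    rw [this]; field_simp
  · simp only [gegWeight_moment_one, mul_zero]
  · intro n
    have h := gegWeight_moment_succ_succ hm n
    rw [show (2 * m + 1) = d by rw [hm_def]; ring] at h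
    linear_combination κ * h

/-- Here `m = 0` and the weight is not integrable. The sphere consists of two points, with moments
`1 + (-1)^n`. -/
theorem sphFT_one (v : E 1) : sphFT v = ((2 * Real.cos ‖v‖ : ℝ) : ℂ) := by
  have h1 := hasSum_sphFT (d := 1) (a := fun n => 1 + (-1) ^ n) ?_ ?_ ?_ v
  · have h2 := (NormedSpace.expSeries_div_hasSum_exp (Complex.I * ‖v‖)).add
      (NormedSpace.expSeries_div_hasSum_exp (-(Complex.I * ‖v‖)))
    rw [← Complex.exp_eq_exp_ℂ] at h2
    refine (h1.unique (h2.congr_fun fun n => ?_)).trans ?_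
    · rw [neg_pow, mul_pow]; push_cast; ring
    · push_cast; rw [Complex.two_cos, mul_comm Complex.I, neg_mul]
  · have := Real.sqrt_pos.2 Real.pi_pos
    rw [Nat.cast_one, Real.Gamma_one_half_eq]
    field_simp; norm_num
  · norm_num
  · intro n; push_cast; ring

/-! ### Laplace transform of powers -/

theorem integrableOn_rpow_mul_cexp {p : ℝ} (hp : 0 < p) {z : ℂ} (hz : 0 < z.re) :
    IntegrableOn (fun t : ℝ => ((t ^ (p - 1) : ℝ) : ℂ) * Complex.exp (-(z * t))) (Ioi 0) := by
  have h := integrableOn_rpow_mul_exp_neg_mul_rpow (p := 1) (s := p - 1) (b := z.re)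
    (by linarith) one_pos hz
  refine Integrable.mono' h (by fun_prop : Measurable fun t : ℝ =>
      ((t ^ (p - 1) : ℝ) : ℂ) * Complex.exp (-(z * t))).aestronglyMeasurable ?_
  filter_upwards [ae_restrict_mem measurableSet_Ioi] with t ht
  have ht : 0 < t := ht
  rw [norm_mul, Complex.norm_real, Complex.norm_exp, Real.norm_of_nonneg (by positivity)]
  simp

/-- The derivative of `t^p e^{-zt}` has integral zero, because the function vanishes at `0` and at
infinity. -/
theorem integral_rpow_mul_cexp_succ {p : ℝ} (hp : 0 < p) {z : ℂ} (hz : 0 < z.re) :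
    z * ∫ t in Ioi (0 : ℝ), ((t ^ p : ℝ) : ℂ) * Complex.exp (-(z * t)) =
      p * ∫ t in Ioi (0 : ℝ), ((t ^ (p - 1) : ℝ) : ℂ) * Complex.exp (-(z * t)) := by
  have h1 := integrableOn_rpow_mul_cexp hp hz
  have h2 := integrableOn_rpow_mul_cexp (p := p + 1) (by linarith) hz
  rw [add_sub_cancel_right] at h2
  have h := integral_Ioi_of_hasDerivAt_of_tendsto (a := 0)
    (f := fun t : ℝ => ((t ^ p : ℝ) : ℂ) * Complex.exp (-(z * t)))
    (f' := fun t : ℝ => p * (((t ^ (p - 1) : ℝ) : ℂ) * Complex.exp (-(z * t))) -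
      z * (((t ^ p : ℝ) : ℂ) * Complex.exp (-(z * t)))) (m := 0) ?_ ?_ ?_ ?_
  · rw [integral_sub (h1.const_mul _) (h2.const_mul _), integral_const_mul, integral_const_mul] at h
    simp [Real.zero_rpow hp.ne'] at h
    linear_combination -h
  · refine ContinuousAt.continuousWithinAt (ContinuousAt.mul ?_ (by fun_prop))
    exact Complex.continuous_ofReal.continuousAt.comp
      (Real.continuousAt_rpow_const _ _ (Or.inr hp.le))
  · intro t ht
    have e1 := (Real.hasDerivAt_rpow_const (x := t) (p := p) (Or.inl (ne_of_gt ht))).ofReal_comp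
    have e2 : HasDerivAt (fun t : ℝ => Complex.exp (-(z * t))) (Complex.exp (-(z * t)) * -z) t := by
      have := ((hasDerivAt_id (t : ℂ)).const_mul z).neg.cexp.comp_ofReal
      simpa using this
    refine (e1.mul e2).congr_deriv ?_
    push_cast; ring
  · exact (h1.const_mul _).sub (h2.const_mul _)
  · rw [tendsto_zero_iff_norm_tendsto_zero]
    have := tendsto_rpow_mul_exp_neg_mul_atTop_nhds_zero p z.re hz
    refine this.congr' ?_
    filter_upwards [eventually_gt_atTop 0] with t ht
    rw [norm_mul, Complex.norm_real, Complex.norm_exp, Real.norm_of_nonneg (by positivity)]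
    simp

/-- `∫ t^(p - 1) e^{-zt} dt = Γ(p) z^(-p)` over `(0, ∞)`, for complex `z` of positive real part. -/
theorem integral_rpow_mul_cexp {p : ℝ} (hp : 0 < p) {z : ℂ} (hz : 0 < z.re) :
    ∫ t in Ioi (0 : ℝ), ((t ^ (p - 1) : ℝ) : ℂ) * Complex.exp (-(z * t)) =
      Real.Gamma p * (1 / z) ^ (p : ℂ) := by
  -- The parameter moves along the vertical line through `z`. There `J` times `ζ^p` has zero
  -- derivative, so its value at `z` equals the one at the real point `ε`, where it is the Gamma
  -- integral.
  set ε := z.re with hε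
  set ζ : ℝ → ℂ := fun y => ε + Complex.I * y with hζ
  have hre : ∀ y, (ζ y).re = ε := fun y => by simp [hζ]
  have hslit : ∀ y, ζ y ∈ Complex.slitPlane := fun y => Or.inl (by rw [hre]; exact hz)
  have hne : ∀ y, ζ y ≠ 0 := fun y => Complex.slitPlane_ne_zero (hslit y)
  have hζd : ∀ y, HasDerivAt ζ Complex.I y := fun y => by
    simpa [hζ] using (((hasDerivAt_id (y : ℂ)).const_mul Complex.I).const_add (ε : ℂ)).comp_ofReal
  set J : ℝ → ℂ := fun y => ∫ t in Ioi (0 : ℝ), ((t ^ (p - 1) : ℝ) : ℂ) * Complex.exp (-(ζ y * t))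
    with hJ
  have hJd : ∀ y, HasDerivAt J (-Complex.I * (p / ζ y * J y)) y := by
    intro y
    have h := hasDerivAt_integral_of_dominated_loc_of_deriv_le (𝕜 := ℝ)
      (μ := volume.restrict (Ioi (0 : ℝ)))
      (F := fun y (t : ℝ) => ((t ^ (p - 1) : ℝ) : ℂ) * Complex.exp (-(ζ y * t)))
      (F' := fun y (t : ℝ) => -Complex.I * (((t ^ p : ℝ) : ℂ) * Complex.exp (-(ζ y * t))))
      (x₀ := y) (s := univ) (bound := fun t => t ^ p * Real.exp (-ε * t ^ (1 : ℝ)))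
      univ_mem (.of_forall fun y => ?_) ?_ ?_ ?_ ?_ ?_
    · refine h.2.congr_deriv ?_
      rw [integral_const_mul]
      congr 1
      have := integral_rpow_mul_cexp_succ hp (z := ζ y) (by rw [hre]; exact hz)
      rw [div_mul_eq_mul_div, eq_div_iff (hne y), ← this]; ring
    · exact (by fun_prop : Measurable fun t : ℝ =>
        ((t ^ (p - 1) : ℝ) : ℂ) * Complex.exp (-(ζ y * t))).aestronglyMeasurable
    · exact integrableOn_rpow_mul_cexp hp (by rw [hre]; exact hz)
    · exact (by fun_prop : Measurable fun t : ℝ => -Complex.I *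
        (((t ^ p : ℝ) : ℂ) * Complex.exp (-(ζ y * t)))).aestronglyMeasurable
    · filter_upwards [ae_restrict_mem measurableSet_Ioi] with t ht y _
      have ht : 0 < t := ht
      rw [norm_mul, norm_mul, Complex.norm_real, Complex.norm_exp,
        Real.norm_of_nonneg (by positivity)]
      simp [hre]
    · exact integrableOn_rpow_mul_exp_neg_mul_rpow (by linarith) one_pos hz
    · filter_upwards [ae_restrict_mem measurableSet_Ioi] with t ht y _
      have ht : 0 < t := ht
      have e := (((hζd y).mul_const (t : ℂ)).neg.cexp).const_mul ((t ^ (p - 1) : ℝ) : ℂ)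
      refine e.congr_deriv ?_
      rw [Real.rpow_sub_one ht.ne']
      have : (t : ℂ) ≠ 0 := by exact_mod_cast ht.ne'
      simp only [Pi.neg_apply]
      push_cast
      field_simp
  have hpow : ∀ y, HasDerivAt (fun y => ζ y ^ (p : ℂ))
      (p * ζ y ^ ((p : ℂ) - 1) * Complex.I) y := fun y => by
    have h : HasDerivAt (fun w : ℂ => (ε : ℂ) + Complex.I * w) Complex.I (y : ℂ) := by
      simpa using ((hasDerivAt_id (y : ℂ)).const_mul Complex.I).const_add (ε : ℂ)
    exact (h.cpow_const (c := p) (hslit y)).comp_ofReal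
  have hprod : ∀ y, HasDerivAt (fun y => J y * ζ y ^ (p : ℂ)) 0 y := fun y => by
    refine ((hJd y).mul (hpow y)).congr_deriv ?_
    rw [Complex.cpow_sub _ _ (hne y), Complex.cpow_one]
    have := hne y
    field_simp
    ring
  have hconst : ∀ y, J y * ζ y ^ (p : ℂ) = J 0 * ζ 0 ^ (p : ℂ) := by
    exact fun y => is_const_of_deriv_eq_zero (fun y => (hprod y).differentiableAt)
      (fun y => (hprod y).deriv) y 0
  have h0 : J 0 = Real.Gamma p * (1 / (ε : ℂ)) ^ (p : ℂ) := by
    have := Complex.integral_cpow_mul_exp_neg_mul_Ioi (a := p) (r := ε) (by simpa using hp) hz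
    rw [Complex.Gamma_ofReal, mul_comm] at this
    rw [← this]
    refine setIntegral_congr_fun measurableSet_Ioi fun t ht => ?_
    have ht : 0 < t := ht
    simp only [hζ]
    rw [Complex.ofReal_cpow ht.le]
    simp
  have hz' : ζ z.im = z := by
    simp only [hζ, hε]; rw [mul_comm]; exact Complex.re_add_im z
  have h1 := hconst z.im
  have hinv : ∀ y, (1 / ζ y) ^ (p : ℂ) = (ζ y ^ (p : ℂ))⁻¹ := fun y => by
    rw [one_div, Complex.inv_cpow _ _ (Complex.slitPlane_arg_ne_pi (hslit y))]
  have e0 : (1 / (ε : ℂ)) = 1 / ζ 0 := by simp [hζ]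
  rw [h0, e0, hinv, mul_assoc, inv_mul_cancel₀, mul_one] at h1
  · change J z.im * ζ z.im ^ (p : ℂ) = _ at h1
    have hJz : (∫ t in Ioi (0 : ℝ), ((t ^ (p - 1) : ℝ) : ℂ) * Complex.exp (-(z * t))) = J z.im := by
      simp only [hJ, hz']
    rw [hJz, ← hz', hinv, ← h1, hz', mul_assoc, mul_inv_cancel₀, mul_one]
    rw [← hz']; simp [Complex.cpow_eq_zero_iff, hne]
  · simp [Complex.cpow_eq_zero_iff, hne]

/-! ### Asymptotics of solutions of `w'' + w = c w / r²` -/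

/-- The energy `w² + w'²` has derivative `2c w w'/r²`, at most `|c|/r²` times the energy. Since
`1/r²` is integrable at infinity, the factor `e^{|c|/r}` turns the energy into a decreasing
quantity. -/
theorem ode_solution_bounded {w w₁ : ℝ → ℝ} {c : ℝ} (hw : ∀ r, 0 < r → HasDerivAt w (w₁ r) r)
    (hw₁ : ∀ r, 0 < r → HasDerivAt w₁ (-w r + c * w r / r ^ 2) r) :
    ∃ B, ∀ r, 1 ≤ r → |w r| ≤ B := by
  set F : ℝ → ℝ := fun r => (w r ^ 2 + w₁ r ^ 2) * Real.exp (|c| / r) with hF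
  have hFd : ∀ r, 0 < r → HasDerivAt F ((2 * c * w r * w₁ r / r ^ 2 -
      |c| * (w r ^ 2 + w₁ r ^ 2) / r ^ 2) * Real.exp (|c| / r)) r := by
    intro r hr
    have h1 := ((hw r hr).pow 2).add ((hw₁ r hr).pow 2)
    have h2 := ((hasDerivAt_inv hr.ne').const_mul |c|).exp
    refine (h1.mul h2).congr_deriv ?_
    simp only [div_eq_mul_inv, Pi.add_apply, Pi.pow_apply, Nat.add_one_sub_one, Nat.cast_ofNat]
    ring
  have hanti : AntitoneOn F (Ici 1) := by
    refine antitoneOn_of_deriv_nonpos (convex_Ici 1) ?_ ?_ ?_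
    · exact fun r hr => (hFd r (zero_lt_one.trans_le hr)).continuousAt.continuousWithinAt
    · rw [interior_Ici]
      exact fun r hr => (hFd r (zero_lt_one.trans hr)).differentiableAt.differentiableWithinAt
    · rw [interior_Ici]
      intro r hr
      have hr0 : 0 < r := zero_lt_one.trans hr
      rw [(hFd r hr0).deriv]
      refine mul_nonpos_of_nonpos_of_nonneg ?_ (Real.exp_pos _).le
      rw [← sub_div]
      refine div_nonpos_of_nonpos_of_nonneg ?_ (by positivity)
      have h1 : 2 * c * w r * w₁ r ≤ |c| * (2 * |w r| * |w₁ r|) := by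
        calc 2 * c * w r * w₁ r ≤ |2 * c * w r * w₁ r| := le_abs_self _
          _ = _ := by simp only [abs_mul, abs_two]; ring
      have h2 := mul_le_mul_of_nonneg_left (two_mul_le_add_sq |w r| |w₁ r|) (abs_nonneg c)
      simp only [sq_abs] at h2
      linarith
  refine ⟨√(F 1), fun r hr => Real.abs_le_sqrt ?_⟩
  have h := hanti (mem_Ici.2 le_rfl) (mem_Ici.2 hr) hr
  refine le_trans ?_ h
  have h1 : 1 ≤ Real.exp (|c| / r) := Real.one_le_exp (by positivity)
  simp only [hF]
  nlinarith [sq_nonneg (w r), sq_nonneg (w₁ r)]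

/-- Variation of constants: `g = (w - iw')e^{-ir}` would be constant for `c = 0`, and in general `g'
= O(1/r²)` because `w` is bounded. So `g` converges to some `L` at rate `1/r`, while `w = Re(g
e^{ir})`. -/
theorem ode_asymptotics {w w₁ : ℝ → ℝ} {c : ℝ} (hw : ∀ r, 0 < r → HasDerivAt w (w₁ r) r)
    (hw₁ : ∀ r, 0 < r → HasDerivAt w₁ (-w r + c * w r / r ^ 2) r) :
    ∃ (L : ℂ) (C : ℝ), ∀ r : ℝ, 1 ≤ r → |w r - (L * Complex.exp (Complex.I * r)).re| ≤ C / r := by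
  obtain ⟨B, hB⟩ := ode_solution_bounded hw hw₁
  have hB0 : 0 ≤ B := (abs_nonneg _).trans (hB 1 le_rfl)
  set M := |c| * B with hM
  have hM0 : 0 ≤ M := by positivity
  set g : ℝ → ℂ := fun r => (w r - Complex.I * w₁ r) * Complex.exp (-(Complex.I * r)) with hg
  have hgd : ∀ r, 0 < r → HasDerivAt g
      (-Complex.I * (c * w r / r ^ 2 : ℝ) * Complex.exp (-(Complex.I * r))) r := by
    intro r hr
    have h1 := (hw r hr).ofReal_comp.sub ((hw₁ r hr).ofReal_comp.const_mul Complex.I)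
    have h2 : HasDerivAt (fun r : ℝ => Complex.exp (-(Complex.I * r)))
        (Complex.exp (-(Complex.I * r)) * -Complex.I) r := by
      simpa using ((hasDerivAt_id (r : ℂ)).const_mul Complex.I).neg.cexp.comp_ofReal
    refine (h1.mul h2).congr_deriv ?_
    simp only [Pi.sub_apply]
    push_cast
    linear_combination (w₁ r : ℂ) * Complex.exp (-(Complex.I * r)) * Complex.I_sq
  have hgb : ∀ a b : ℝ, 1 ≤ a → a ≤ b → ‖g b - g a‖ ≤ M / a := by
    intro a b ha hab
    have ha0 : 0 < a := by linarith
    have hpos : ∀ x ∈ Icc a b, 0 < x := fun x hx => ha0.trans_le hx.1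
    have h := image_norm_le_of_norm_deriv_right_le_deriv_boundary' (a := a) (b := b)
      (f := fun r => g r - g a)
      (f' := fun r => -Complex.I * (c * w r / r ^ 2 : ℝ) * Complex.exp (-(Complex.I * r)))
      (B := fun r => M * (a⁻¹ - r⁻¹)) (B' := fun r => M * (r ^ 2)⁻¹)
      (fun x hx => ((hgd x (hpos x hx)).continuousAt.sub continuousAt_const).continuousWithinAt)
      (fun x hx => ((hgd x (hpos x ⟨hx.1, hx.2.le⟩)).sub_const _).hasDerivWithinAt)
      (by simp) (fun x hx => ?_) (fun x hx => ?_) (fun x hx => ?_) (right_mem_Icc.2 hab)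
    · refine h.trans ?_
      rw [div_eq_mul_inv]
      have : 0 < b⁻¹ := by have := ha0.trans_le hab; positivity
      gcongr; linarith
    · exact (continuousAt_const.mul
        (continuousAt_const.sub (continuousAt_inv₀ (hpos x hx).ne'))).continuousWithinAt
    · have := ((hasDerivAt_inv (hpos x ⟨hx.1, hx.2.le⟩).ne').const_sub a⁻¹).const_mul M
      simpa using this.hasDerivWithinAt
    · have hx0 := hpos x ⟨hx.1, hx.2.le⟩
      have hn : ‖Complex.exp (-(Complex.I * x))‖ = 1 := by
        rw [Complex.norm_exp]; simp
      rw [norm_mul, norm_mul, hn, Complex.norm_real, norm_neg, Complex.norm_I, one_mul, mul_one,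
        Real.norm_eq_abs, abs_div, abs_mul, abs_of_pos (by positivity : 0 < x ^ 2),
        div_eq_mul_inv, hM]
      have := hB x (ha.trans hx.1)
      gcongr
  -- The increment bound is available only from `1` on, hence the truncation.
  have hcau : CauchySeq fun r : ℝ => g (max r 1) := by
    refine cauchySeq_of_le_tendsto_0 (fun N => 2 * (M / max N 1)) (fun n m N hn hm => ?_) ?_
    · have h1 := hgb (max N 1) (max n 1) (le_max_right _ _) (max_le_max_right _ hn)
      have h2 := hgb (max N 1) (max m 1) (le_max_right _ _) (max_le_max_right _ hm)
      have h3 := dist_triangle_right (g (max n 1)) (g (max m 1)) (g (max N 1))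
      rw [← dist_eq_norm] at h1 h2
      linarith
    · rw [← mul_zero (2 : ℝ)]
      refine Tendsto.const_mul _ (Tendsto.div_atTop tendsto_const_nhds ?_)
      exact tendsto_atTop_mono (fun N => le_max_left N 1) tendsto_id
  obtain ⟨L, hL⟩ := cauchySeq_tendsto_of_complete hcau
  refine ⟨L, M, fun r hr => ?_⟩
  have hlim : ‖g r - L‖ ≤ M / r := by
    have h1 : Tendsto (fun b : ℝ => ‖g r - g (max b 1)‖) atTop (nhds ‖g r - L‖) :=
      (tendsto_const_nhds.sub hL).norm
    refine le_of_tendsto h1 ?_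
    filter_upwards [eventually_ge_atTop r] with b hb
    rw [norm_sub_rev]
    exact hgb r _ hr (hb.trans (le_max_left _ _))
  have hw' : w r = (g r * Complex.exp (Complex.I * r)).re := by
    simp only [hg]
    rw [mul_assoc, ← Complex.exp_add]
    simp
  rw [hw', ← Complex.sub_re, ← sub_mul]
  refine (Complex.abs_re_le_norm _).trans ?_
  rw [norm_mul, mul_comm Complex.I, Complex.norm_exp_ofReal_mul_I, mul_one]
  exact hlim

/-! ### Asymptotics of the Bessel-type integral -/

theorem hasDerivAt_integral_gegWeight {m : ℝ} (hm : 0 < m) {F F' : ℝ → ℝ → ℝ}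
    (hF : ∀ r, Continuous (F r)) (hF' : ∀ r, Continuous (F' r))
    (hb : ∀ r, ∀ s ∈ Ioc (-1 : ℝ) 1, |F' r s| ≤ 1)
    (hd : ∀ r s, HasDerivAt (fun r => F r s) (F' r s) r) (r : ℝ) :
    HasDerivAt (fun r => ∫ s in (-1 : ℝ)..1, F r s * gegWeight m s)
      (∫ s in (-1 : ℝ)..1, F' r s * gegWeight m s) r := by
  have hρ := intervalIntegrable_gegWeight hm
  have hmeas : ∀ g : ℝ → ℝ, Continuous g → AEStronglyMeasurable (fun s => g s * gegWeight m s)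
      (volume.restrict (uIoc (-1 : ℝ) 1)) := fun g hg =>
    (hg.measurable.mul (measurable_gegWeight m)).aestronglyMeasurable
  refine (intervalIntegral.hasDerivAt_integral_of_dominated_loc_of_deriv_le (s := univ)
    (bound := fun s => ‖gegWeight m s‖) univ_mem (.of_forall fun r => hmeas _ (hF r))
    (hρ.continuousOn_mul (hF r).continuousOn) (hmeas _ (hF' r)) (.of_forall ?_) hρ.norm
    (.of_forall fun s _ r _ => (hd r s).mul_const _)).2
  intro s hs r _
  rw [uIoc_of_le (by norm_num)] at hs
  rw [norm_mul]
  exact mul_le_of_le_one_left (norm_nonneg _) (hb r s hs)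

theorem abs_besselInt_le {m : ℝ} (hm : 0 < m) (r : ℝ) :
    |besselInt m r| ≤ ∫ s in (-1 : ℝ)..1, gegWeight m s := by
  rw [besselInt, ← Real.norm_eq_abs]
  refine (intervalIntegral.norm_integral_le_integral_norm (by norm_num)).trans ?_
  have hρ := intervalIntegrable_gegWeight hm
  refine intervalIntegral.integral_mono_on (by norm_num)
    (hρ.continuousOn_mul (by fun_prop)).norm hρ fun s hs => ?_
  rw [norm_mul, Real.norm_eq_abs, Real.norm_of_nonneg (gegWeight_nonneg hs)]
  exact mul_le_of_le_one_left (gegWeight_nonneg hs) (Real.abs_cos_le_one _)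

/-- Integrating by parts against `sin(rs)` gives `r(k + k'') + 2m k' = 0` for the integral `k`. The
factor `r^m` removes the first-order term and leaves the potential `m(m-1)/r²`. -/
theorem besselInt_ode {m : ℝ} (hm : 0 < m) :
    ∃ w₁ : ℝ → ℝ, (∀ r, 0 < r → HasDerivAt (fun r => r ^ m * besselInt m r) (w₁ r) r) ∧
      ∀ r, 0 < r → HasDerivAt w₁
        (-(r ^ m * besselInt m r) + m * (m - 1) * (r ^ m * besselInt m r) / r ^ 2) r := by
  set k₁ : ℝ → ℝ := fun r => ∫ s in (-1 : ℝ)..1, (-s * Real.sin (r * s)) * gegWeight m s with hk₁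
  set k₂ : ℝ → ℝ := fun r => ∫ s in (-1 : ℝ)..1, (-s * (s * Real.cos (r * s))) * gegWeight m s
    with hk₂
  have hs1 : ∀ s ∈ Ioc (-1 : ℝ) 1, |s| ≤ 1 := fun s hs => abs_le.2 ⟨hs.1.le, hs.2⟩
  have hd1 : ∀ r, HasDerivAt (besselInt m) (k₁ r) r := by
    refine hasDerivAt_integral_gegWeight hm (F := fun r s => Real.cos (r * s))
      (F' := fun r s => -s * Real.sin (r * s)) (fun r => by fun_prop) (fun r => by fun_prop)
      (fun r s hs => ?_) (fun r s => ?_)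
    · rw [abs_mul, abs_neg]
      exact mul_le_one₀ (hs1 s hs) (abs_nonneg _) (Real.abs_sin_le_one _)
    · refine ((hasDerivAt_id r).mul_const s).cos.congr_deriv ?_
      simp; ring
  have hd2 : ∀ r, HasDerivAt k₁ (k₂ r) r := by
    refine hasDerivAt_integral_gegWeight hm (F := fun r s => -s * Real.sin (r * s))
      (F' := fun r s => -s * (s * Real.cos (r * s))) (fun r => by fun_prop) (fun r => by fun_prop)
      (fun r s hs => ?_) (fun r s => ?_)
    · rw [abs_mul, abs_mul, abs_neg]
      exact mul_le_one₀ (hs1 s hs) (by positivity)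
        (mul_le_one₀ (hs1 s hs) (abs_nonneg _) (Real.abs_cos_le_one _))
    · refine ((((hasDerivAt_id r).mul_const s).sin).const_mul (-s)).congr_deriv ?_
      simp only [id_eq]; ring
  have hode : ∀ r, r * (besselInt m r + k₂ r) + 2 * m * k₁ r = 0 := by
    intro r
    have h := integral_parts_gegWeight hm (q := fun s => Real.sin (r * s))
      (q' := fun s => r * Real.cos (r * s)) (fun s => by
        refine ((hasDerivAt_id s).const_mul r).sin.congr_deriv ?_
        simp; ring) (by fun_prop)
    have hi : ∀ g : ℝ → ℝ, Continuous g →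
        IntervalIntegrable (fun s => g s * gegWeight m s) volume (-1) 1 := fun g hg =>
      (intervalIntegrable_gegWeight hm).continuousOn_mul hg.continuousOn
    rw [← h, besselInt, hk₁, hk₂]
    simp only
    rw [← intervalIntegral.integral_add (hi (fun s => Real.cos (r * s)) (by fun_prop))
      (hi (fun s => -s * (s * Real.cos (r * s))) (by fun_prop)),
      ← intervalIntegral.integral_const_mul, ← intervalIntegral.integral_const_mul,
      ← intervalIntegral.integral_add]
    · exact intervalIntegral.integral_congr fun s _ => by ring
    · exact ((hi (fun s => Real.cos (r * s)) (by fun_prop)).add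
        (hi (fun s => -s * (s * Real.cos (r * s))) (by fun_prop))).const_mul _
    · exact (hi (fun s => -s * Real.sin (r * s)) (by fun_prop)).const_mul _
  refine ⟨fun r => m * r ^ (m - 1) * besselInt m r + r ^ m * k₁ r, fun r hr => ?_, fun r hr => ?_⟩
  · exact (Real.hasDerivAt_rpow_const (Or.inl hr.ne')).mul (hd1 r)
  · have e1 : HasDerivAt (fun r : ℝ => r ^ m) (m * r ^ (m - 1)) r :=
      Real.hasDerivAt_rpow_const (Or.inl hr.ne')
    have e2 : HasDerivAt (fun r : ℝ => r ^ (m - 1)) ((m - 1) * r ^ (m - 1 - 1)) r :=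
      Real.hasDerivAt_rpow_const (Or.inl hr.ne')
    refine (((e2.const_mul m).mul (hd1 r)).add (e1.mul (hd2 r))).congr_deriv ?_
    rw [Real.rpow_sub_one hr.ne', Real.rpow_sub_one hr.ne']
    have := hode r
    field_simp
    linear_combination r * this

/-! ### Abel limits and the leading constant -/

theorem exists_abs_rpow_sub_le (p : ℝ) {a : ℝ} (ha : 0 < a) (b : ℝ) :
    ∃ C, 0 ≤ C ∧ ∀ x ∈ Icc a b, ∀ y ∈ Icc a b, |x ^ p - y ^ p| ≤ C * |x - y| := by
  obtain ⟨C, hC⟩ := isCompact_Icc.exists_bound_of_continuousOn (s := Icc a b)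
    (f := fun x : ℝ => p * x ^ (p - 1)) (continuousOn_const.mul (continuousOn_id.rpow_const
      fun x hx => Or.inl (ha.trans_le hx.1).ne'))
  refine ⟨max C 0, le_max_right _ _, fun x hx y hy => ?_⟩
  exact Convex.norm_image_sub_le_of_norm_hasDerivWithin_le (f := fun x : ℝ => x ^ p)
    (fun x hx => (Real.hasDerivAt_rpow_const (Or.inl (ha.trans_le hx.1).ne')).hasDerivWithinAt)
    (fun x hx => (hC x hx).trans (le_max_left _ _)) (convex_Icc a b) hy hx

theorem re_pos_inv_add_I_mul {ε : ℝ} (hε : 0 < ε) (u : ℝ) :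
    1 / ((ε : ℂ) + Complex.I * u) ∈ Complex.slitPlane := by
  left
  have : 0 < Complex.normSq ((ε : ℂ) + Complex.I * u) := Complex.normSq_pos.2 fun h => by
    have := congrArg Complex.re h
    simp at this
    exact hε.ne' this
  rw [one_div, Complex.inv_re]
  simp only [Complex.add_re, Complex.ofReal_re, Complex.mul_re, Complex.I_re, zero_mul,
    Complex.I_im, Complex.ofReal_im, mul_zero, sub_zero, add_zero]
  positivity

theorem norm_inv_add_I_mul_le {ε : ℝ} (hε : 0 < ε) {u : ℝ} (hu : 0 < u) :
    ‖1 / ((ε : ℂ) + Complex.I * u)‖ ≤ ε⁻¹ ∧ ‖1 / ((ε : ℂ) + Complex.I * u)‖ ≤ u⁻¹ := by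
  have h1 := Complex.abs_re_le_norm ((ε : ℂ) + Complex.I * u)
  have h2 := Complex.abs_im_le_norm ((ε : ℂ) + Complex.I * u)
  simp [abs_of_pos hε, abs_of_pos hu] at h1 h2
  rw [norm_div, norm_one, one_div]
  exact ⟨inv_anti₀ hε h1, inv_anti₀ hu h2⟩

theorem continuous_cpow_inv_add_I_mul {ε : ℝ} (hε : 0 < ε) (p : ℂ) :
    Continuous fun u : ℝ => (1 / ((ε : ℂ) + Complex.I * u)) ^ p := by
  refine Continuous.cpow (Continuous.div continuous_const (by fun_prop) fun u => ?_)
    continuous_const fun u => re_pos_inv_add_I_mul hε u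
  intro h
  have := congrArg Complex.re h
  simp at this
  exact hε.ne' this

/-- The exact primitive behind the Abel limit. -/
theorem integral_rpow_mul_cpow_inv {m : ℝ} (hm : 0 < m) {ε : ℝ} (hε : 0 < ε) {b : ℝ} (hb : 0 ≤ b) :
    ∫ u in (0 : ℝ)..b, (ε : ℂ) * (((u ^ (m - 1) : ℝ) : ℂ) *
      (1 / ((ε : ℂ) + Complex.I * u)) ^ ((m + 1 : ℝ) : ℂ)) =
      ((b ^ m / m : ℝ) : ℂ) * (1 / ((ε : ℂ) + Complex.I * b)) ^ (m : ℂ) := by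
  set z : ℝ → ℂ := fun u => 1 / ((ε : ℂ) + Complex.I * u) with hz
  have hslit : ∀ u, z u ∈ Complex.slitPlane := re_pos_inv_add_I_mul hε
  have hne : ∀ u : ℝ, (ε : ℂ) + Complex.I * u ≠ 0 := fun u h => by
    have := congrArg Complex.re h
    simp at this
    exact hε.ne' this
  have hzd : ∀ u : ℝ, HasDerivAt (fun u => z u ^ (m : ℂ))
      (m * z u ^ ((m : ℂ) - 1) * (-Complex.I * z u ^ 2)) u := fun u => by
    have h0 : HasDerivAt (fun w : ℂ => 1 / ((ε : ℂ) + Complex.I * w)) (-Complex.I * z u ^ 2)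
        (u : ℂ) := by
      have h1 : HasDerivAt (fun w : ℂ => (ε : ℂ) + Complex.I * w) Complex.I (u : ℂ) := by
        simpa using ((hasDerivAt_id (u : ℂ)).const_mul Complex.I).const_add (ε : ℂ)
      simp only [one_div, hz]
      refine (h1.inv (hne u)).congr_deriv ?_
      have := hne u
      field_simp
    exact (h0.cpow_const (c := m) (hslit u)).comp_ofReal
  have h := intervalIntegral.integral_eq_sub_of_hasDeriv_right_of_le (a := 0) (b := b)
    (f := fun u : ℝ => ((u ^ m / m : ℝ) : ℂ) * z u ^ (m : ℂ))
    (f' := fun u => (ε : ℂ) * (((u ^ (m - 1) : ℝ) : ℂ) * z u ^ ((m + 1 : ℝ) : ℂ)))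
    hb ?_ ?_ ?_
  · rw [h]; simp [Real.zero_rpow hm.ne', hz]
  · refine ContinuousOn.mul ?_ (fun u _ => (hzd u).continuousAt.continuousWithinAt)
    refine Complex.continuous_ofReal.comp_continuousOn (ContinuousOn.div_const ?_ _)
    exact continuousOn_id.rpow_const fun _ _ => Or.inr hm.le
  · intro u hu
    refine HasDerivAt.hasDerivWithinAt ?_
    have e1 := ((Real.hasDerivAt_rpow_const (x := u) (p := m)
      (Or.inl hu.1.ne')).div_const m).ofReal_comp
    refine (e1.mul (hzd u)).congr_deriv ?_
    have hz0 := Complex.slitPlane_ne_zero (hslit u)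
    have e3 : z u ^ ((m + 1 : ℝ) : ℂ) = z u ^ ((m : ℂ) - 1) * z u ^ 2 := by
      rw [← Complex.cpow_natCast, ← Complex.cpow_add _ _ hz0]; congr 1; push_cast; ring
    have e4 : z u ^ (m : ℂ) = z u ^ ((m : ℂ) - 1) * z u := by
      rw [Complex.cpow_sub _ _ hz0, Complex.cpow_one]; field_simp
    have e5 : (ε : ℂ) * z u = 1 - Complex.I * u * z u := by
      simp only [hz]; have := hne u; field_simp; ring
    have e6 : ((u ^ m : ℝ) : ℂ) = ((u ^ (m - 1) : ℝ) : ℂ) * u := by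
      rw [Real.rpow_sub_one hu.1.ne']
      have : (u : ℂ) ≠ 0 := by exact_mod_cast hu.1.ne'
      push_cast; field_simp
    have hm' : (m : ℂ) ≠ 0 := by exact_mod_cast hm.ne'
    rw [e3, e4]
    push_cast
    rw [e6]
    clear_value z
    field_simp
    linear_combination -((u ^ (m - 1) : ℝ) : ℂ) * z u ^ ((m : ℂ) - 1) * e5
  · have h1 : IntervalIntegrable (fun u : ℝ => ((u ^ (m - 1) : ℝ) : ℂ)) volume 0 b := by
      have := intervalIntegral.intervalIntegrable_rpow' (a := 0) (b := b)
        (show -1 < m - 1 by linarith)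
      exact ⟨this.1.ofReal, this.2.ofReal⟩
    exact (h1.mul_continuousOn (continuous_cpow_inv_add_I_mul hε _).continuousOn).const_mul _

/-- As `ε → 0` the kernel concentrates at `s = 1`, where, with `u = 1 - s`, the weight is `2^(m-1)
u^(m-1)` to leading order. That part has an exact primitive, and the rest tends to zero by dominated
convergence. -/
theorem tendsto_gegWeight_cpow {m : ℝ} (hm : 0 < m) :
    Tendsto (fun ε : ℝ => (ε : ℂ) * ∫ s in (-1 : ℝ)..1, (gegWeight m s : ℂ) *
        (1 / ((ε : ℂ) + Complex.I * ((1 - s : ℝ) : ℂ))) ^ ((m + 1 : ℝ) : ℂ))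
      (nhdsWithin 0 (Ioi 0)) (nhds ((2 ^ (m - 1) / m : ℝ) * (1 / Complex.I) ^ (m : ℂ))) := by
  set z : ℝ → ℝ → ℂ := fun ε u => (1 / ((ε : ℂ) + Complex.I * u)) ^ ((m + 1 : ℝ) : ℂ) with hz
  set G : ℝ → ℝ := fun u => gegWeight m (1 - u) - 2 ^ (m - 1) * u ^ (m - 1) with hG
  have hρ : IntervalIntegrable (fun u => gegWeight m (1 - u)) volume 0 2 := by
    have := (intervalIntegrable_gegWeight hm).comp_sub_left 1
    norm_num at this
    exact this.symm
  have hu : IntervalIntegrable (fun u : ℝ => u ^ (m - 1)) volume 0 2 :=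
    intervalIntegral.intervalIntegrable_rpow' (by linarith)
  have hGi : IntervalIntegrable G volume 0 2 := hρ.sub (hu.const_mul _)
  obtain ⟨C, hC0, hC⟩ := exists_abs_rpow_sub_le (m - 1) one_pos 2
  have hnorm : ∀ ε u, ‖z ε u‖ = ‖1 / ((ε : ℂ) + Complex.I * u)‖ ^ (m + 1) := fun ε u =>
    Complex.norm_cpow_real _ _
  have hsplit : ∀ ε : ℝ, 0 < ε → (ε : ℂ) * ∫ s in (-1 : ℝ)..1, (gegWeight m s : ℂ) *
        (1 / ((ε : ℂ) + Complex.I * ((1 - s : ℝ) : ℂ))) ^ ((m + 1 : ℝ) : ℂ) =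
      ((2 ^ (m - 1) : ℝ) : ℂ) * (((2 ^ m / m : ℝ) : ℂ) *
        (1 / ((ε : ℂ) + Complex.I * (2 : ℝ))) ^ (m : ℂ)) +
        ∫ u in (0 : ℝ)..2, (ε : ℂ) * ((G u : ℂ) * z ε u) := by
    intro ε hε
    have h := intervalIntegral.integral_comp_sub_left (a := 0) (b := 2)
      (fun s : ℝ => (gegWeight m s : ℂ) *
        (1 / ((ε : ℂ) + Complex.I * ((1 - s : ℝ) : ℂ))) ^ ((m + 1 : ℝ) : ℂ)) 1
    rw [show (1 : ℝ) - 2 = -1 by norm_num, sub_zero] at h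
    simp only [sub_sub_cancel] at h
    have hzc : ContinuousOn (z ε) (uIcc 0 2) :=
      (continuous_cpow_inv_add_I_mul hε ((m + 1 : ℝ) : ℂ)).continuousOn
    rw [← h, ← integral_rpow_mul_cpow_inv hm hε two_pos.le, ← intervalIntegral.integral_const_mul,
      ← intervalIntegral.integral_const_mul, ← intervalIntegral.integral_add]
    · refine intervalIntegral.integral_congr fun u _ => ?_
      simp only [hG, hz]
      push_cast; ring
    · exact ((IntervalIntegrable.mul_continuousOn ⟨hu.1.ofReal, hu.2.ofReal⟩ hzc).const_mul
        _).const_mul _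
    · exact (IntervalIntegrable.mul_continuousOn ⟨hGi.1.ofReal, hGi.2.ofReal⟩ hzc).const_mul _
  have hlim1 : Tendsto (fun ε : ℝ => (1 / ((ε : ℂ) + Complex.I * (2 : ℝ))) ^ (m : ℂ))
      (nhdsWithin 0 (Ioi 0)) (nhds ((1 / (((0 : ℝ) : ℂ) + Complex.I * (2 : ℝ))) ^ (m : ℂ))) := by
    have : ContinuousAt (fun ε : ℝ => (1 / ((ε : ℂ) + Complex.I * (2 : ℝ))) ^ (m : ℂ)) 0 := by
      refine ContinuousAt.cpow (ContinuousAt.div (by fun_prop) (by fun_prop) (by simp))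
        continuousAt_const ?_
      right
      simp
    exact this.tendsto.mono_left nhdsWithin_le_nhds
  -- Of the `m + 1` powers of `1/|ε + iu|`, one is bounded by `1/ε` and the other `m` by `1/u`.
  have hn1 : ∀ ε u : ℝ, 0 < ε → 0 < u → ε * ‖z ε u‖ ≤ u ^ (-m) := by
    intro ε u hε hu
    obtain ⟨h1, h2⟩ := norm_inv_add_I_mul_le hε hu
    rw [hnorm, Real.rpow_add_one' (norm_nonneg _) (by linarith), Real.rpow_neg hu.le,
      ← Real.inv_rpow hu.le]
    have h3 := Real.rpow_le_rpow (norm_nonneg _) h2 hm.le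
    calc _ ≤ ε * (u⁻¹ ^ m * ε⁻¹) := by gcongr
      _ = _ := by field_simp
  have hlim2 : Tendsto (fun ε : ℝ => ∫ u in (0 : ℝ)..2, (ε : ℂ) * ((G u : ℂ) * z ε u))
      (nhdsWithin 0 (Ioi 0)) (nhds 0) := by
    have := intervalIntegral.tendsto_integral_filter_of_dominated_convergence (μ := volume)
      (a := 0) (b := 2) (l := nhdsWithin 0 (Ioi 0)) (f := fun _ => (0 : ℂ))
      (F := fun (ε : ℝ) u => (ε : ℂ) * ((G u : ℂ) * z ε u)) (fun u => C + |G u|) ?_ ?_ ?_ ?_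
    · simpa using this
    · filter_upwards [self_mem_nhdsWithin] with ε hε
      have h1 : Measurable (z ε) := (continuous_cpow_inv_add_I_mul hε ((m + 1 : ℝ) : ℂ)).measurable
      have h2 : Measurable G := ((measurable_gegWeight m).comp (by fun_prop)).sub (by fun_prop)
      exact Measurable.aestronglyMeasurable (by fun_prop)
    · filter_upwards [self_mem_nhdsWithin] with ε hε
      refine .of_forall fun u hu => ?_
      rw [uIoc_of_le two_pos.le] at hu
      have h1 := hn1 ε u hε hu.1
      rw [norm_mul, norm_mul, Complex.norm_real, Complex.norm_real,
        Real.norm_of_nonneg (le_of_lt hε), Real.norm_eq_abs]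
      have h2 : ε * (|G u| * ‖z ε u‖) ≤ |G u| * u ^ (-m) := by
        calc _ = |G u| * (ε * ‖z ε u‖) := by ring
          _ ≤ _ := by gcongr
      refine h2.trans ?_
      -- Near `u = 0` the subtraction in `G` gains a factor `u`, so `|G u| u^(-m)` is bounded by the
      -- Lipschitz constant `C`. For `u ≥ 1` the factor `u^(-m)` is at most `1`, which leaves `|G
      -- u|`.
      rcases le_total u 1 with hu1 | hu1
      · have h3 : G u = u ^ (m - 1) * ((2 - u) ^ (m - 1) - 2 ^ (m - 1)) := by
          simp only [hG, gegWeight]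
          rw [show 1 - (1 - u) ^ 2 = u * (2 - u) by ring, Real.mul_rpow hu.1.le (by linarith)]
          ring
        have h4 := hC (2 - u) ⟨by linarith, by linarith [hu.1]⟩ 2 ⟨by norm_num, le_rfl⟩
        rw [show 2 - u - 2 = -u by ring, abs_neg, abs_of_pos hu.1] at h4
        have h5 : |G u| * u ^ (-m) ≤ C := by
          have h0 := hu.1
          rw [h3, abs_mul, abs_of_nonneg (by positivity), Real.rpow_neg h0.le,
            Real.rpow_sub_one h0.ne']
          calc _ = |(2 - u) ^ (m - 1) - 2 ^ (m - 1)| * u⁻¹ := by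
                have : 0 < u ^ m := by positivity
                field_simp
            _ ≤ C * u * u⁻¹ := by gcongr
            _ = C := by field_simp
        linarith [abs_nonneg (G u)]
      · have h3 : u ^ (-m) ≤ 1 := Real.rpow_le_one_of_one_le_of_nonpos hu1 (by linarith)
        nlinarith [mul_le_mul_of_nonneg_left h3 (abs_nonneg (G u))]
    · exact intervalIntegrable_const.add hGi.norm
    · refine .of_forall fun u hu => ?_
      rw [uIoc_of_le two_pos.le] at hu
      have h1 : Tendsto (fun ε : ℝ => |ε| * (|G u| * u⁻¹ ^ (m + 1))) (nhdsWithin 0 (Ioi 0))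
          (nhds 0) := by
        have : Continuous fun ε : ℝ => |ε| * (|G u| * u⁻¹ ^ (m + 1)) := by fun_prop
        have h := this.tendsto 0
        simp only [abs_zero, zero_mul] at h
        exact h.mono_left nhdsWithin_le_nhds
      refine squeeze_zero_norm' ?_ h1
      filter_upwards [self_mem_nhdsWithin] with ε hε
      rw [norm_mul, norm_mul, Complex.norm_real, Complex.norm_real, hnorm]
      have h2 := Real.rpow_le_rpow (norm_nonneg _) (norm_inv_add_I_mul_le hε hu.1).2
        (by linarith : 0 ≤ m + 1)
      simp only [Real.norm_eq_abs]
      gcongr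
  have h := (((hlim1.const_mul ((2 ^ m / m : ℝ) : ℂ)).const_mul ((2 ^ (m - 1) : ℝ) : ℂ)).add
    hlim2)
  have hval : ((2 ^ (m - 1) : ℝ) : ℂ) * (((2 ^ m / m : ℝ) : ℂ) *
      (1 / (((0 : ℝ) : ℂ) + Complex.I * (2 : ℝ))) ^ (m : ℂ)) + 0 =
      (2 ^ (m - 1) / m : ℝ) * (1 / Complex.I) ^ (m : ℂ) := by
    have hI : (1 : ℂ) / Complex.I ≠ 0 := by simp
    have e1 : (1 / (((0 : ℝ) : ℂ) + Complex.I * (2 : ℝ))) = ((2⁻¹ : ℝ) : ℂ) * (1 / Complex.I) := by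
      push_cast; rw [zero_add, one_div, mul_inv, one_div, mul_comm]
    have e2 : (((2⁻¹ : ℝ) : ℂ) * (1 / Complex.I)) ^ (m : ℂ) =
        ((2⁻¹ ^ m : ℝ) : ℂ) * (1 / Complex.I) ^ (m : ℂ) := by
      have h2 : ((2⁻¹ : ℝ) : ℂ) ≠ 0 := by norm_num
      rw [Complex.cpow_def_of_ne_zero (mul_ne_zero h2 hI), Complex.log_ofReal_mul (by norm_num) hI,
        add_mul, Complex.exp_add, Complex.ofReal_cpow (by norm_num),
        Complex.cpow_def_of_ne_zero h2, Complex.cpow_def_of_ne_zero hI,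
        Complex.ofReal_log (by norm_num)]
    have e3 : (2 : ℝ) ^ m * 2⁻¹ ^ m = 1 := by
      rw [← Real.mul_rpow (by norm_num) (by norm_num)]; norm_num
    rw [e1, e2, add_zero, ← mul_assoc, ← mul_assoc, ← Complex.ofReal_mul, ← Complex.ofReal_mul]
    congr 2
    calc _ = 2 ^ (m - 1) / m * (2 ^ m * 2⁻¹ ^ m) := by ring
      _ = _ := by rw [e3, mul_one]
  rw [hval] at h
  refine h.congr' ?_
  filter_upwards [self_mem_nhdsWithin] with ε hε
  rw [hsplit ε hε]

/-- Against `e^{-(ε+i)r}` the component `L e^{ir}/2` is no longer oscillating and contributes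
`L/(2ε)`. The conjugate component stays bounded, and the error contributes `O(ε^(-1/2))`. The
exponent `-1/2` makes the error bound integrable at `0` while still decaying at infinity, which
`1/r` does not. -/
theorem abel_limit {w : ℝ → ℝ} {L : ℂ} {C : ℝ} (hw : ContinuousOn w (Ioi 0))
    (hC : ∀ r : ℝ, 0 < r → |w r - (L * Complex.exp (Complex.I * r)).re| ≤ C * r ^ (-(1 / 2) : ℝ)) :
    Tendsto (fun ε : ℝ => (ε : ℂ) * ∫ r in Ioi (0 : ℝ),
        (w r : ℂ) * Complex.exp (-(((ε : ℂ) + Complex.I) * r)))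
      (nhdsWithin 0 (Ioi 0)) (nhds (L / 2)) := by
  have hC0 : 0 ≤ C := by simpa using (abs_nonneg _).trans (hC 1 one_pos)
  set e : ℝ → ℝ := fun r => w r - (L * Complex.exp (Complex.I * r)).re with he
  have hec : ContinuousOn e (Ioi 0) := hw.sub (by fun_prop)
  set g : ℝ → ℝ → ℂ := fun ε r => (e r : ℂ) * Complex.exp (-(((ε : ℂ) + Complex.I) * r)) with hg
  have hbi : ∀ ε : ℝ, 0 < ε → IntegrableOn
      (fun r : ℝ => C * (r ^ ((1 / 2 : ℝ) - 1) * Real.exp (-(ε * r)))) (Ioi 0) := fun ε hε => by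
    have := integrableOn_rpow_mul_exp_neg_mul_rpow (p := 1) (s := (1 / 2 : ℝ) - 1) (b := ε)
      (by norm_num) one_pos hε
    simp only [Real.rpow_one, neg_mul] at this
    exact this.const_mul C
  have hgb : ∀ ε : ℝ, ∀ᵐ r ∂(volume.restrict (Ioi (0 : ℝ))),
      ‖g ε r‖ ≤ C * (r ^ ((1 / 2 : ℝ) - 1) * Real.exp (-(ε * r))) := fun ε => by
    filter_upwards [ae_restrict_mem measurableSet_Ioi] with r hr
    rw [norm_mul, Complex.norm_real, Complex.norm_exp, ← mul_assoc]
    have h1 := hC r hr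
    rw [show (-(1 / 2) : ℝ) = 1 / 2 - 1 by norm_num] at h1
    have h2 : (-(((ε : ℂ) + Complex.I) * r)).re = -(ε * r) := by simp
    rw [h2]
    exact mul_le_mul_of_nonneg_right h1 (Real.exp_pos _).le
  have hgi : ∀ ε : ℝ, 0 < ε → IntegrableOn (g ε) (Ioi 0) := fun ε hε =>
    Integrable.mono' (hbi ε hε) (ContinuousOn.aestronglyMeasurable
      ((Complex.continuous_ofReal.comp_continuousOn hec).mul (by fun_prop)) measurableSet_Ioi)
      (hgb ε)
  have hmain : ∀ ε : ℝ, 0 < ε → (ε : ℂ) * ∫ r in Ioi (0 : ℝ),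
        (w r : ℂ) * Complex.exp (-(((ε : ℂ) + Complex.I) * r)) =
      L / 2 + ε * (conj L / 2 * (1 / ((ε : ℂ) + 2 * Complex.I))) +
        ε * ∫ r in Ioi (0 : ℝ), g ε r := by
    intro ε hε
    have hε' : (ε : ℂ) ≠ 0 := by exact_mod_cast hε.ne'
    have hre1 : (-(ε : ℂ)).re < 0 := by simpa using hε
    have hre2 : (-((ε : ℂ) + 2 * Complex.I)).re < 0 := by simpa using hε
    have i1 := (integrableOn_exp_mul_complex_Ioi hre1 0).const_mul (L / 2)
    have i2 := (integrableOn_exp_mul_complex_Ioi hre2 0).const_mul (conj L / 2)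
    have e1 := integral_exp_mul_complex_Ioi hre1 0
    have e2 := integral_exp_mul_complex_Ioi hre2 0
    have hpt : ∀ r : ℝ, (w r : ℂ) * Complex.exp (-(((ε : ℂ) + Complex.I) * r)) =
        (L / 2 * Complex.exp (-(ε : ℂ) * r) +
          conj L / 2 * Complex.exp (-((ε : ℂ) + 2 * Complex.I) * r)) + g ε r := by
      intro r
      have hre : (((L * Complex.exp (Complex.I * r)).re : ℝ) : ℂ) =
          (L * Complex.exp (Complex.I * r) + conj L * Complex.exp (-(Complex.I * r))) / 2 := by
        rw [Complex.re_eq_add_conj, map_mul, ← Complex.exp_conj]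
        simp
      have hx1 : Complex.exp (-(ε : ℂ) * r) = Complex.exp (Complex.I * r) *
          Complex.exp (-(((ε : ℂ) + Complex.I) * r)) := by
        rw [← Complex.exp_add]; congr 1; ring
      have hx2 : Complex.exp (-((ε : ℂ) + 2 * Complex.I) * r) = Complex.exp (-(Complex.I * r)) *
          Complex.exp (-(((ε : ℂ) + Complex.I) * r)) := by
        rw [← Complex.exp_add]; congr 1; ring
      simp only [hg, he]
      push_cast
      rw [hre, hx1, hx2]
      ring
    have i12 : Integrable (fun r : ℝ => L / 2 * Complex.exp (-(ε : ℂ) * r) +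
        conj L / 2 * Complex.exp (-((ε : ℂ) + 2 * Complex.I) * r))
        (volume.restrict (Ioi (0 : ℝ))) := i1.add i2
    simp only [hpt]
    rw [integral_add i12 (hgi ε hε), integral_add i1 i2, integral_const_mul,
      integral_const_mul, e1, e2]
    simp only [Complex.ofReal_zero, mul_zero, Complex.exp_zero, neg_div_neg_eq]
    have h : (ε : ℂ) * (L / 2 * (1 / ε)) = L / 2 := by field_simp
    linear_combination h
  have hz1 : Tendsto (fun ε : ℝ => (ε : ℂ) * (conj L / 2 * (1 / ((ε : ℂ) + 2 * Complex.I))))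
      (nhdsWithin 0 (Ioi 0)) (nhds 0) := by
    have : ContinuousAt (fun ε : ℝ =>
        (ε : ℂ) * (conj L / 2 * (1 / ((ε : ℂ) + 2 * Complex.I)))) 0 := by
      refine ContinuousAt.mul (by fun_prop) (ContinuousAt.mul (by fun_prop)
        (ContinuousAt.div (by fun_prop) (by fun_prop) ?_))
      simp
    have h := this.tendsto
    simp only [Complex.ofReal_zero, zero_mul] at h
    exact h.mono_left nhdsWithin_le_nhds
  have hz2 : Tendsto (fun ε : ℝ => (ε : ℂ) * ∫ r in Ioi (0 : ℝ), g ε r)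
      (nhdsWithin 0 (Ioi 0)) (nhds 0) := by
    have hb : Tendsto (fun ε : ℝ => C * √π * ε ^ (1 / 2 : ℝ)) (nhdsWithin 0 (Ioi 0)) (nhds 0) := by
      have : ContinuousAt (fun ε : ℝ => C * √π * ε ^ (1 / 2 : ℝ)) 0 :=
        continuousAt_const.mul (Real.continuousAt_rpow_const _ _ (Or.inr (by norm_num)))
      have h := this.tendsto
      rw [Real.zero_rpow (by norm_num), mul_zero] at h
      exact h.mono_left nhdsWithin_le_nhds
    refine squeeze_zero_norm' ?_ hb
    filter_upwards [self_mem_nhdsWithin] with ε hε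
    have hε : 0 < ε := hε
    have h1 : ‖∫ r in Ioi (0 : ℝ), g ε r‖ ≤ C * ((1 / ε) ^ (1 / 2 : ℝ) * √π) := by
      refine (norm_integral_le_of_norm_le (hbi ε hε) (hgb ε)).trans_eq ?_
      rw [integral_const_mul, Real.integral_rpow_mul_exp_neg_mul_Ioi (by norm_num) hε,
        Real.Gamma_one_half_eq]
    rw [norm_mul, Complex.norm_real, Real.norm_of_nonneg hε.le]
    refine (mul_le_mul_of_nonneg_left h1 hε.le).trans_eq ?_
    have h2 : ε * (1 / ε) ^ (1 / 2 : ℝ) = ε ^ (1 / 2 : ℝ) := by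
      rw [one_div ε, Real.inv_rpow hε.le, ← Real.rpow_neg hε.le]
      nth_rewrite 1 [← Real.rpow_one ε]
      rw [← Real.rpow_add hε]; norm_num
    rw [← h2]; ring
  have h3 := (tendsto_const_nhds (x := L / 2)).add hz1 |>.add hz2
  rw [add_zero, add_zero] at h3
  refine h3.congr' ?_
  filter_upwards [self_mem_nhdsWithin] with ε hε
  rw [hmain ε hε]

/-- Fubini: for fixed `s` the integral over `r` is the Laplace transform of `r^m` at `ε + i(1 - s)`.
-/
theorem integral_besselInt_cexp {m : ℝ} (hm : 0 < m) {ε : ℝ} (hε : 0 < ε) :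
    ∫ r in Ioi (0 : ℝ), ((r ^ m * besselInt m r : ℝ) : ℂ) *
        Complex.exp (-(((ε : ℂ) + Complex.I) * r)) =
      Real.Gamma (m + 1) * ∫ s in (-1 : ℝ)..1, (gegWeight m s : ℂ) *
        (1 / ((ε : ℂ) + Complex.I * ((1 - s : ℝ) : ℂ))) ^ ((m + 1 : ℝ) : ℂ) := by
  set f : ℝ → ℝ → ℂ := fun r s => ((r ^ m : ℝ) : ℂ) *
      Complex.exp (-(((ε : ℂ) + Complex.I * ((1 - s : ℝ) : ℂ)) * r)) * (gegWeight m s : ℂ) with hf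
  have hint : Integrable (Function.uncurry f)
      ((volume.restrict (Ioi (0 : ℝ))).prod (volume.restrict (Ioc (-1 : ℝ) 1))) := by
    have h1 : IntegrableOn (fun r : ℝ => r ^ m * Real.exp (-(ε * r))) (Ioi 0) := by
      have := integrableOn_rpow_mul_exp_neg_mul_rpow (p := 1) (s := m) (b := ε)
        (by linarith) one_pos hε
      simpa only [Real.rpow_one, neg_mul] using this
    have h2 := (intervalIntegrable_gegWeight hm).1
    refine (h1.mul_prod h2).mono ?_ (.of_forall fun p => ?_)
    · refine Measurable.aestronglyMeasurable ?_
      have := measurable_gegWeight m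
      simp only [hf, Function.uncurry_def]
      fun_prop
    · simp only [hf, Function.uncurry_def, norm_mul, Complex.norm_real, Complex.norm_exp]
      simp
  have hL : ∀ r : ℝ, ((r ^ m * besselInt m r : ℝ) : ℂ) *
      Complex.exp (-(((ε : ℂ) + Complex.I) * r)) = ∫ s in Ioc (-1 : ℝ) 1, f r s := by
    intro r
    rw [Complex.ofReal_mul, ← integral_exp_gegWeight hm, mul_right_comm, 
      intervalIntegral.integral_of_le (by norm_num), ← integral_const_mul]
    refine integral_congr_ae (.of_forall fun s => ?_)
    simp only [hf]
    rw [show -(((ε : ℂ) + Complex.I * ((1 - s : ℝ) : ℂ)) * r) =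
      -(((ε : ℂ) + Complex.I) * r) + Complex.I * ((r * s : ℝ) : ℂ) by push_cast; ring,
      Complex.exp_add]
    ring
  simp only [hL]
  rw [integral_integral_swap hint, intervalIntegral.integral_of_le (by norm_num),
    ← integral_const_mul]
  refine integral_congr_ae (.of_forall fun s => ?_)
  simp only [hf]
  rw [integral_mul_const]
  have h := integral_rpow_mul_cexp (p := m + 1) (by linarith)
    (z := (ε : ℂ) + Complex.I * ((1 - s : ℝ) : ℂ)) (by simpa using hε)
  rw [add_sub_cancel_right] at h
  rw [h]; ring

/-- Hankel asymptotics of the Bessel-type integral. -/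
theorem besselInt_asymptotics {m : ℝ} (hm : 0 < m) :
    ∃ C, 0 ≤ C ∧ ∀ r : ℝ, 0 < r → |r ^ m * besselInt m r -
      (((Real.Gamma m * 2 ^ m : ℝ) : ℂ) * (1 / Complex.I) ^ (m : ℂ) *
        Complex.exp (Complex.I * r)).re| ≤ C / r := by
  obtain ⟨w₁, hw, hw₁⟩ := besselInt_ode hm
  obtain ⟨L, C, hC⟩ := ode_asymptotics hw hw₁
  set B := ∫ s in (-1 : ℝ)..1, gegWeight m s
  set D := B + ‖L‖
  have hB : 0 ≤ B := (abs_nonneg _).trans (abs_besselInt_le hm 0)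
  have hD : 0 ≤ D := by positivity
  have hC0 : 0 ≤ C := by simpa using (abs_nonneg _).trans (hC 1 le_rfl)
  have hsmall : ∀ r : ℝ, 0 < r → r ≤ 1 →
      |r ^ m * besselInt m r - (L * Complex.exp (Complex.I * r)).re| ≤ D := by
    intro r hr hr1
    refine (abs_sub _ _).trans (add_le_add ?_ ?_)
    · rw [abs_mul, abs_of_nonneg (by positivity)]
      exact (mul_le_of_le_one_left (abs_nonneg _) (Real.rpow_le_one hr.le hr1 hm.le)).trans
        (abs_besselInt_le hm r)
    · refine (Complex.abs_re_le_norm _).trans_eq ?_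
      rw [norm_mul, mul_comm Complex.I, Complex.norm_exp_ofReal_mul_I, mul_one]
  have hall : ∀ r : ℝ, 0 < r →
      |r ^ m * besselInt m r - (L * Complex.exp (Complex.I * r)).re| ≤ (C + D) / r := by
    intro r hr
    rcases le_total r 1 with h | h
    · refine (hsmall r hr h).trans ?_
      rw [le_div_iff₀ hr]
      nlinarith
    · exact (hC r h).trans (by gcongr; linarith)
  -- The weaker majorant `r^(-1/2)` dominates both the constant bound below `1` and the `1/r` bound
  -- above it, as required for the Abel limit.
  have hhalf : ∀ r : ℝ, 0 < r →
      |r ^ m * besselInt m r - (L * Complex.exp (Complex.I * r)).re| ≤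
        (C + D) * r ^ (-(1 / 2) : ℝ) := by
    intro r hr
    rcases le_total r 1 with h | h
    · refine (hsmall r hr h).trans ?_
      have : 1 ≤ r ^ (-(1 / 2) : ℝ) :=
        Real.one_le_rpow_of_pos_of_le_one_of_nonpos hr h (by norm_num)
      nlinarith
    · refine (hall r hr).trans ?_
      rw [div_eq_mul_inv, ← Real.rpow_neg_one]
      gcongr
      norm_num
  -- Two evaluations of one limit determine the constant `L`, which the differential equation leaves
  -- free.
  have h1 := abel_limit (fun r hr => (hw r hr).continuousAt.continuousWithinAt) hhalf
  have h2 := (tendsto_gegWeight_cpow hm).const_mul ((Real.Gamma (m + 1) : ℝ) : ℂ)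
  have h3 : L / 2 = (Real.Gamma (m + 1) : ℝ) *
      ((2 ^ (m - 1) / m : ℝ) * (1 / Complex.I) ^ (m : ℂ)) := by
    refine tendsto_nhds_unique h1 (h2.congr' ?_)
    filter_upwards [self_mem_nhdsWithin] with ε hε
    rw [integral_besselInt_cexp hm hε]; ring
  have hL : L = ((Real.Gamma m * 2 ^ m : ℝ) : ℂ) * (1 / Complex.I) ^ (m : ℂ) := by
    have hm' : (m : ℂ) ≠ 0 := by exact_mod_cast hm.ne'
    rw [Real.Gamma_add_one hm.ne', Real.rpow_sub_one two_ne_zero] at h3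
    push_cast at h3 ⊢
    field_simp at h3
    rw [h3]
  rw [← hL]
  exact ⟨C + D, by positivity, hall⟩

/-! ### Contributions of the two poles of the sphere -/

/-- The phase `e^{∓iπ(d-1)/4}` of stationary phase at the poles of the sphere. -/
def polePhase (d : ℕ) (ε : ℤˣ) : ℂ :=
  Complex.exp (-((ε : ℤ) : ℂ) * Complex.I * (π / 4) * ((d : ℂ) - 1))

theorem sum_units_int {M : Type*} [AddCommMonoid M] (f : ℤˣ → M) : ∑ ε : ℤˣ, f ε = f 1 + f (-1) := by
  rw [UnitsInt.univ, Finset.sum_pair (by decide)]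

theorem one_div_I_cpow (m : ℝ) :
    (1 / Complex.I) ^ (m : ℂ) = Complex.exp (((-(π / 2) * m : ℝ) : ℂ) * Complex.I) := by
  rw [Complex.cpow_def_of_ne_zero (by simp), one_div, Complex.inv_I, Complex.log_neg_I]
  congr 1; push_cast; ring

theorem sum_polePhase_mul_exp (r : ℝ) :
    ∑ ε : ℤˣ, polePhase d ε * Complex.exp (((ε : ℤ) : ℂ) * Complex.I * r) =
      ((2 * (((1 / Complex.I) ^ (((((d : ℝ) - 1) / 2 : ℝ)) : ℂ)) *
        Complex.exp (Complex.I * r)).re : ℝ) : ℂ) := by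
  rw [one_div_I_cpow, ← Complex.exp_add, Complex.ofReal_mul, Complex.re_eq_add_conj,
    ← Complex.exp_conj, sum_units_int]
  simp only [polePhase, ← Complex.exp_add]
  simp only [Units.val_one, Int.cast_one, Units.val_neg, Int.cast_neg, map_add, map_mul,
    Complex.conj_ofReal, Complex.conj_I, Complex.ofReal_ofNat]
  rw [mul_div_cancel₀ _ two_ne_zero]
  congr 2 <;> · push_cast; ring

/-- Asymptotics of the Fourier transform of the surface measure of the sphere. -/
theorem sphFT_asymptotics (d : ℕ) [NeZero d] :
    ∃ C, 0 ≤ C ∧ ∀ v : E d, v ≠ 0 →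
      ‖sphFT v - (((2 * π / ‖v‖) ^ (((d : ℝ) - 1) / 2) : ℝ) : ℂ) *
        ∑ ε : ℤˣ, polePhase d ε * Complex.exp (((ε : ℤ) : ℂ) * Complex.I * ‖v‖)‖ ≤
      C * ‖v‖ ^ (-(((d : ℝ) - 1) / 2 + 1)) := by
  rcases (show d = 1 ∨ 2 ≤ d by have := NeZero.pos d; omega) with rfl | hd
  -- For `d = 1` the expansion is exact.
  · refine ⟨0, le_rfl, fun v hv => ?_⟩
    rw [sphFT_one, sum_polePhase_mul_exp]
    simp [mul_comm Complex.I, Complex.exp_ofReal_mul_I_re]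
  · set m : ℝ := ((d : ℝ) - 1) / 2 with hm_def
    have hm : 0 < m := by
      have : (2 : ℝ) ≤ d := by exact_mod_cast hd
      simp only [hm_def]; linarith
    obtain ⟨C, hC0, hC⟩ := besselInt_asymptotics hm
    have hG := Real.Gamma_pos_of_pos hm
    set κ : ℝ := 2 * π ^ m / Real.Gamma m with hκ
    have hκ0 : 0 < κ := by positivity
    refine ⟨κ * C, by positivity, fun v hv => ?_⟩
    have hr : 0 < ‖v‖ := norm_pos_iff.2 hv
    set r := ‖v‖
    rw [sphFT_eq_besselInt hd, sum_polePhase_mul_exp, ← Complex.ofReal_mul, ← Complex.ofReal_sub,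
      Complex.norm_real, Real.norm_eq_abs, ← hm_def]
    have h := hC r hr
    rw [mul_assoc, Complex.re_ofReal_mul] at h
    set X := (((1 / Complex.I) ^ (m : ℂ)) * Complex.exp (Complex.I * r)).re
    have e : κ * besselInt m r - (2 * π / r) ^ m * (2 * X) =
        κ * r ^ (-m) * (r ^ m * besselInt m r - Real.Gamma m * 2 ^ m * X) := by
      rw [Real.div_rpow (by positivity) hr.le, Real.mul_rpow two_pos.le Real.pi_pos.le,
        Real.rpow_neg hr.le, hκ]
      have : 0 < r ^ m := by positivity
      field_simp
    change |κ * besselInt m r - (2 * π / r) ^ m * (2 * X)| ≤ _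
    rw [e, abs_mul, abs_of_pos (by positivity), neg_add, ← sub_eq_add_neg,
      Real.rpow_sub_one hr.ne']
    calc _ ≤ κ * r ^ (-m) * (C / r) := by gcongr
      _ = _ := by ring

theorem norm_sphFT_le (v : E d) : ‖sphFT v‖ ≤ (sphVol d).real univ := by
  refine (norm_integral_le_integral_norm _).trans_eq ?_
  simp [mul_comm Complex.I, Complex.norm_exp_ofReal_mul_I]

/-! ### Shifted asymptotics -/

theorem norm_exp_units_mul_I (ε : ℤˣ) (x : ℝ) :
    ‖Complex.exp (((ε : ℤ) : ℂ) * Complex.I * x)‖ = 1 := by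
  rw [show ((ε : ℤ) : ℂ) * Complex.I * x = (((ε : ℤ) * x : ℝ) : ℂ) * Complex.I by push_cast; ring]
  exact Complex.norm_exp_ofReal_mul_I _

theorem norm_polePhase (ε : ℤˣ) : ‖polePhase d ε‖ = 1 := by
  rw [polePhase, show -((ε : ℤ) : ℂ) * Complex.I * (π / 4) * ((d : ℂ) - 1) =
    ((ε : ℤ) : ℂ) * Complex.I * ((-(π / 4) * (d - 1) : ℝ) : ℂ) by push_cast; ring]
  exact norm_exp_units_mul_I _ _

theorem norm_exp_units_sub_le (ε : ℤˣ) (x y : ℝ) :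
    ‖Complex.exp (((ε : ℤ) : ℂ) * Complex.I * x) - Complex.exp (((ε : ℤ) : ℂ) * Complex.I * y)‖ ≤
      |x - y| := by
  have h : Complex.exp (((ε : ℤ) : ℂ) * Complex.I * x) -
      Complex.exp (((ε : ℤ) : ℂ) * Complex.I * y) =
      Complex.exp (((ε : ℤ) : ℂ) * Complex.I * y) *
        (Complex.exp (Complex.I * (((ε : ℤ) * (x - y) : ℝ) : ℂ)) - 1) := by
    rw [mul_sub, ← Complex.exp_add, mul_one]
    congr 2; push_cast; ring
  rw [h, norm_mul, norm_exp_units_mul_I, one_mul]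
  refine (Real.norm_exp_I_mul_ofReal_sub_one_le).trans_eq ?_
  rw [Real.norm_eq_abs, abs_mul]
  rcases Int.units_eq_one_or ε with rfl | rfl <;> simp

/-- With `ρ` the norm and `a = η·u`, the difference of squares `ρ² - (r + a)²` equals `‖η‖² - a²`,
and `ρ + r + a ≥ r` in this range. -/
theorem abs_norm_smul_add_sub_le {u η : E d} (hu : ‖u‖ = 1) {r : ℝ} (hr : 0 < r)
    (hη : ‖η‖ ≤ r / 2) : |‖r • u + η‖ - (r + inner ℝ η u)| ≤ ‖η‖ ^ 2 / r := by
  set ρ := ‖r • u + η‖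
  set a : ℝ := inner ℝ η u
  have ha : |a| ≤ ‖η‖ := by simpa [hu] using abs_real_inner_le_norm η u
  have ha' := abs_le.1 ha
  have hρ2 : ρ ^ 2 = r ^ 2 + 2 * r * a + ‖η‖ ^ 2 := by
    rw [norm_add_sq_real, norm_smul, hu, inner_smul_left, real_inner_comm]
    simp [abs_of_pos hr, a]; ring
  have hρ : r / 2 ≤ ρ := by
    have := norm_sub_norm_le (r • u) (-η)
    rw [sub_neg_eq_add, norm_neg, norm_smul, hu, Real.norm_of_nonneg hr.le] at this
    linarith
  have h1 : (ρ - (r + a)) * (ρ + (r + a)) = ‖η‖ ^ 2 - a ^ 2 := by linear_combination hρ2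
  have h2 : r ≤ ρ + (r + a) := by linarith
  have h3 : a ^ 2 ≤ ‖η‖ ^ 2 := sq_le_sq' ha'.1 ha'.2
  have h4 : |ρ - (r + a)| * (ρ + (r + a)) = ‖η‖ ^ 2 - a ^ 2 := by
    rw [← abs_of_pos (hr.trans_le h2), ← abs_mul, h1, abs_of_nonneg (by linarith)]
  rw [le_div_iff₀ hr]
  nlinarith [mul_le_mul_of_nonneg_left h2 (abs_nonneg (ρ - (r + a)))]

/-- For `‖η‖ ≤ r/2` one substitutes `‖ru + η‖ = r + η·u + O(‖η‖²/r)` in the asymptotics. Otherwise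
both terms are merely bounded, and the loss is covered by the power of `1 + ‖η‖`. The exponent `d +
2` only needs to be at least `2` for the first case and `(d+1)/2` for the second. The linear
dependence of the phase on `η` is what allows the plane waves to be resummed. -/
theorem sphFT_shift (d : ℕ) [NeZero d] :
    ∃ C, 0 ≤ C ∧ ∀ (u η : E d) (r : ℝ), ‖u‖ = 1 → 1 ≤ r →
      ‖sphFT (r • u + η) - (((2 * π / r) ^ (((d : ℝ) - 1) / 2) : ℝ) : ℂ) *
        ∑ ε : ℤˣ, polePhase d ε * Complex.exp (((ε : ℤ) : ℂ) * Complex.I * r) *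
          Complex.exp (((ε : ℤ) : ℂ) * Complex.I * (inner ℝ η u : ℝ))‖ ≤
      C * r ^ (-(((d : ℝ) - 1) / 2 + 1)) * (1 + ‖η‖) ^ (d + 2) := by
  obtain ⟨C₀, hC₀, hasym⟩ := sphFT_asymptotics d
  set m : ℝ := ((d : ℝ) - 1) / 2 with hm_def
  have hd1 : (1 : ℝ) ≤ d := by exact_mod_cast NeZero.one_le
  have hm : 0 ≤ m := by simp only [hm_def]; linarith
  -- The ratio `ρ/r` lies in `[1/2, 3/2]` when `‖η‖ ≤ r/2`.
  obtain ⟨CL, hCL0, hCL⟩ := exists_abs_rpow_sub_le (-m) (a := 1 / 2) (by norm_num) (3 / 2)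
  set P : ℝ := (2 * π) ^ m with hP
  have hP0 : 0 < P := by positivity
  set V : ℝ := (sphVol d).real univ
  have hV : 0 ≤ V := measureReal_nonneg
  -- `C₁` serves the range `‖η‖ > r/2`, and `C₂` the range `‖η‖ ≤ r/2`.
  set C₁ := (V + P * 2) * 2 ^ (m + 1)
  set C₂ := C₀ * 2 ^ (m + 1) + P * (2 * CL + 2)
  refine ⟨C₁ + C₂, by positivity, fun u η r hu hr => ?_⟩
  have hr0 : 0 < r := by linarith
  have hPr : (2 * π / r) ^ m = P * r ^ (-m) := by
    rw [Real.div_rpow (by positivity) hr0.le, Real.rpow_neg hr0.le]; rfl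
  set a : ℝ := inner ℝ η u with ha_def
  set S : ℝ → ℂ := fun x => ∑ ε : ℤˣ, polePhase d ε * Complex.exp (((ε : ℤ) : ℂ) * Complex.I * x)
    with hS
  have hSn : ∀ x, ‖S x‖ ≤ 2 := fun x => by
    refine (norm_sum_le _ _).trans ?_
    simp [norm_polePhase, norm_exp_units_mul_I]
  have hSd : ∀ x y, ‖S x - S y‖ ≤ 2 * |x - y| := fun x y => by
    simp only [hS]
    rw [← Finset.sum_sub_distrib]
    simp only [← mul_sub]
    refine (norm_sum_le _ _).trans ?_
    simp only [norm_mul, norm_polePhase, one_mul]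
    refine (Finset.sum_le_sum fun ε _ => norm_exp_units_sub_le ε x y).trans ?_
    simp
  have hSa : (∑ ε : ℤˣ, polePhase d ε * Complex.exp (((ε : ℤ) : ℂ) * Complex.I * r) *
      Complex.exp (((ε : ℤ) : ℂ) * Complex.I * a)) = S (r + a) := by
    refine Finset.sum_congr rfl fun ε _ => ?_
    rw [mul_assoc, ← Complex.exp_add]; congr 2; push_cast; ring
  rw [hSa, hPr]
  have hR0 : 0 < r ^ (-(m + 1)) := by positivity
  have hW : (1 : ℝ) ≤ 1 + ‖η‖ := by linarith [norm_nonneg η]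
  rcases le_or_gt (‖η‖) (r / 2) with hη | hη
  · set ρ := ‖r • u + η‖
    have hρ1 : r / 2 ≤ ρ := by
      have := norm_sub_norm_le (r • u) (-η)
      rw [sub_neg_eq_add, norm_neg, norm_smul, hu, Real.norm_of_nonneg hr0.le] at this
      linarith
    have hρr : |ρ - r| ≤ ‖η‖ := by
      have := abs_norm_sub_norm_le (r • u + η) (r • u)
      rw [add_sub_cancel_left, norm_smul, hu, Real.norm_of_nonneg hr0.le, mul_one] at this
      exact this
    have hρ0 : 0 < ρ := by linarith
    have h1 := hasym (r • u + η) (norm_pos_iff.1 hρ0)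
    change ‖_ - (((2 * π / ρ) ^ m : ℝ) : ℂ) * S ρ‖ ≤ C₀ * ρ ^ (-(m + 1)) at h1
    have h2 : ρ ^ (-(m + 1)) ≤ 2 ^ (m + 1) * r ^ (-(m + 1)) := by
      calc ρ ^ (-(m + 1)) ≤ (r / 2) ^ (-(m + 1)) :=
            Real.rpow_le_rpow_of_nonpos (by linarith) hρ1 (by linarith)
        _ = _ := by
            rw [Real.div_rpow hr0.le two_pos.le, Real.rpow_neg two_pos.le, div_inv_eq_mul,
              mul_comm]
    have hPρ : (2 * π / ρ) ^ m = P * r ^ (-m) * (ρ / r) ^ (-m) := by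
      rw [Real.div_rpow (by positivity) hρ0.le, Real.div_rpow hρ0.le hr0.le,
        Real.rpow_neg hr0.le, Real.rpow_neg hρ0.le, hP]
      have : 0 < r ^ m := by positivity
      field_simp
    have h3 : |(ρ / r) ^ (-m) - 1| ≤ CL * (‖η‖ / r) := by
      have hb := abs_le.1 hρr
      have := hCL (ρ / r) ⟨by rw [le_div_iff₀ hr0]; linarith, by rw [div_le_iff₀ hr0]; linarith⟩
        1 ⟨by norm_num, by norm_num⟩
      rw [Real.one_rpow] at this
      refine this.trans (mul_le_mul_of_nonneg_left ?_ hCL0)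
      rw [div_sub_one hr0.ne', abs_div, abs_of_pos hr0]
      gcongr
    have h4 := abs_norm_smul_add_sub_le hu hr0 hη
    have hsplit : sphFT (r • u + η) - ((P * r ^ (-m) : ℝ) : ℂ) * S (r + a) =
        (sphFT (r • u + η) - (((2 * π / ρ) ^ m : ℝ) : ℂ) * S ρ) +
          ((P * r ^ (-m) : ℝ) : ℂ) * (((((ρ / r) ^ (-m) - 1 : ℝ) : ℂ)) * S ρ +
            (S ρ - S (r + a))) := by
      rw [hPρ]; push_cast; ring
    have hrm : r ^ (-m) = r * r ^ (-(m + 1)) := by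
      rw [neg_add, ← sub_eq_add_neg, Real.rpow_sub_one hr0.ne']; field_simp
    rw [hsplit]
    calc _ ≤ C₀ * (2 ^ (m + 1) * r ^ (-(m + 1))) +
          P * r ^ (-m) * (CL * (‖η‖ / r) * 2 + 2 * (‖η‖ ^ 2 / r)) := by
          refine (norm_add_le _ _).trans (add_le_add (h1.trans (by gcongr)) ?_)
          rw [norm_mul, Complex.norm_real, Real.norm_of_nonneg (by positivity)]
          refine mul_le_mul_of_nonneg_left ?_ (by positivity)
          refine (norm_add_le _ _).trans (add_le_add ?_ ((hSd _ _).trans (by gcongr)))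
          rw [norm_mul, Complex.norm_real]
          exact mul_le_mul h3 (hSn _) (norm_nonneg _) (by positivity)
      _ = (C₀ * 2 ^ (m + 1) + P * (2 * CL * ‖η‖ + 2 * ‖η‖ ^ 2)) * r ^ (-(m + 1)) := by
          rw [hrm]; field_simp
      _ ≤ ((C₀ * 2 ^ (m + 1) + P * (2 * CL + 2)) * (1 + ‖η‖) ^ (d + 2)) * r ^ (-(m + 1)) := by
          have e1 : (1 : ℝ) ≤ (1 + ‖η‖) ^ (d + 2) := one_le_pow₀ hW
          have e2 : (1 + ‖η‖) ^ 2 ≤ (1 + ‖η‖) ^ (d + 2) := pow_le_pow_right₀ hW (by omega)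
          have e3 : ‖η‖ ≤ (1 + ‖η‖) ^ (d + 2) := by nlinarith [norm_nonneg η]
          have e4 : ‖η‖ ^ 2 ≤ (1 + ‖η‖) ^ (d + 2) := by nlinarith [norm_nonneg η]
          refine mul_le_mul_of_nonneg_right ?_ hR0.le
          rw [add_mul, mul_assoc P, add_mul]
          refine add_le_add (le_mul_of_one_le_right (by positivity) e1) ?_
          gcongr
      _ ≤ _ := by
          have : 0 ≤ C₁ * (1 + ‖η‖) ^ (d + 2) * r ^ (-(m + 1)) := by positivity
          change C₂ * _ * _ ≤ _
          linear_combination this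
  · have h1 : ‖sphFT (r • u + η) - ((P * r ^ (-m) : ℝ) : ℂ) * S (r + a)‖ ≤ V + P * 2 := by
      refine (norm_sub_le _ _).trans (add_le_add (norm_sphFT_le _) ?_)
      rw [norm_mul, Complex.norm_real, Real.norm_of_nonneg (by positivity)]
      have : r ^ (-m) ≤ 1 := Real.rpow_le_one_of_one_le_of_nonpos hr (by linarith)
      calc _ ≤ P * 1 * 2 := by gcongr; exact hSn _
        _ = _ := by ring
    have h2 : 1 ≤ 2 ^ (m + 1) * r ^ (-(m + 1)) * (1 + ‖η‖) ^ (d + 2) := by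
      have e1 : (r / 2) ^ (m + 1) ≤ (1 + ‖η‖) ^ (d + 2) := by
        calc (r / 2) ^ (m + 1) ≤ (1 + ‖η‖) ^ (m + 1) := by gcongr; linarith
          _ ≤ (1 + ‖η‖) ^ ((d + 2 : ℕ) : ℝ) := by
            refine Real.rpow_le_rpow_of_exponent_le hW ?_
            push_cast; simp only [hm_def]; linarith
          _ = _ := Real.rpow_natCast _ _
      calc 1 = 2 ^ (m + 1) * r ^ (-(m + 1)) * (r / 2) ^ (m + 1) := by
            rw [Real.div_rpow hr0.le two_pos.le, Real.rpow_neg hr0.le]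
            have : 0 < r ^ (m + 1) := by positivity
            field_simp
        _ ≤ _ := by gcongr
    calc _ ≤ (V + P * 2) * 1 := by rw [mul_one]; exact h1
      _ ≤ (V + P * 2) * (2 ^ (m + 1) * r ^ (-(m + 1)) * (1 + ‖η‖) ^ (d + 2)) := by gcongr
      _ = C₁ * r ^ (-(m + 1)) * (1 + ‖η‖) ^ (d + 2) := by simp only [C₁]; ring
      _ ≤ _ := by
          have : 0 ≤ C₂ := by positivity
          gcongr; linarith

/-! ### Fourier series of smooth periodic functions -/

section FourierSeries

variable {ι : Type*}

/-- The integer points form a lattice of rank `card ι`, to which the summability of `‖n‖^(-N)`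
applies. The comparison fails only at `n = 0`, hence the cofinite filter. -/
theorem summable_one_add_norm_pow_inv (ι : Type*) [Fintype ι] {N : ℕ} (hN : Fintype.card ι < N) :
    Summable fun n : ι → ℤ => ((1 + ‖n‖) ^ N)⁻¹ := by
  classical
  set b := Pi.basisFun ℝ ι
  set L := Submodule.span ℤ (range b)
  have hmem : ∀ n : ι → ℤ, (fun i => (n i : ℝ)) ∈ L := fun n => by
    rw [b.mem_span_iff_repr_mem ℤ]
    exact fun i => ⟨n i, by simp [b]⟩
  have hrank : Module.finrank ℤ L < N := by
    rw [ZLattice.rank ℝ L]; simpa using hN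
  have h := (ZLattice.summable_norm_pow_inv L N hrank).comp_injective
    (i := fun n : ι → ℤ => (⟨fun i => (n i : ℝ), hmem n⟩ : L)) (fun n n' h => by
      ext i
      have := congrFun (Subtype.ext_iff.1 h) i
      simpa using this)
  have hnorm : ∀ n : ι → ℤ, ‖(fun i => (n i : ℝ))‖ = ‖n‖ := fun n => by
    simp only [Pi.norm_def]
    congr
  refine Summable.of_norm_bounded_eventually h ?_
  have h0 : {n : ι → ℤ | n = 0}.Finite := by simp
  filter_upwards [h0.compl_mem_cofinite] with n hn
  have hpos : 0 < ‖n‖ := norm_pos_iff.2 hn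
  have hn' : ‖(⟨fun i => (n i : ℝ), hmem n⟩ : L)‖ = ‖n‖ := hnorm n
  simp only [Function.comp]
  rw [hn', Real.norm_of_nonneg (by positivity), inv_pow]
  gcongr
  linarith

/-- Periodicity with respect to `ℤ^ι`. -/
def IntPeriodic (g : (ι → ℝ) → ℂ) : Prop := ∀ (k : ι → ℤ) (x : ι → ℝ), g (x + fun i => (k i : ℝ)) = g x

/-- The canonical projection `ℝ^ι → (ℝ/ℤ)^ι`. -/
def unitProj (x : ι → ℝ) : UnitAddTorus ι := fun i => (x i : UnitAddCircle)

theorem isOpenQuotientMap_unitProj : IsOpenQuotientMap (unitProj (ι := ι)) :=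
  IsOpenQuotientMap.piMap (f := fun _ (x : ℝ) => (x : UnitAddCircle))
    fun _ => QuotientAddGroup.isOpenQuotientMap_mk

/-- The function on the torus defined by a periodic function. -/
def descend (g : (ι → ℝ) → ℂ) (T : UnitAddTorus ι) : ℂ :=
  g (Function.surjInv (isOpenQuotientMap_unitProj (ι := ι)).surjective T)

theorem descend_unitProj {g : (ι → ℝ) → ℂ} (hg : IntPeriodic g) (x : ι → ℝ) :
    descend g (unitProj x) = g x := by
  set y := Function.surjInv (isOpenQuotientMap_unitProj (ι := ι)).surjective (unitProj x) with hy
  have h : unitProj y = unitProj x := Function.surjInv_eq _ _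
  have hk : ∀ i, ∃ k : ℤ, (k : ℝ) = y i - x i := fun i => by
    have h1 : ((y i - x i : ℝ) : UnitAddCircle) = 0 := by
      rw [AddCircle.coe_sub, sub_eq_zero]; exact congrFun h i
    obtain ⟨k, hk⟩ := AddCircle.coe_eq_zero_iff (1 : ℝ) |>.1 h1
    exact ⟨k, by simpa using hk⟩
  choose k hk using hk
  change g y = g x
  rw [← hg k x]
  congr 1
  ext i
  simp [hk]

theorem continuous_descend {g : (ι → ℝ) → ℂ} (hg : IntPeriodic g) (hc : Continuous g) :
    Continuous (descend g) := by
  rw [(isOpenQuotientMap_unitProj (ι := ι)).isQuotientMap.continuous_iff]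
  convert! hc using 1
  ext x
  exact descend_unitProj hg x

variable [Fintype ι]

/-- The normalized Haar measure of the torus. -/
def haarTorus (ι : Type*) [Fintype ι] : Measure (UnitAddTorus ι) :=
  Measure.pi fun _ => AddCircle.haarAddCircle

instance : IsProbabilityMeasure (haarTorus ι) :=
  inferInstanceAs (IsProbabilityMeasure (Measure.pi fun _ : ι => AddCircle.haarAddCircle))

instance : (haarTorus ι).IsAddLeftInvariant :=
  inferInstanceAs (Measure.pi fun _ : ι => AddCircle.haarAddCircle (T := 1)).IsAddLeftInvariant

theorem mFourierCoeff_eq (f : UnitAddTorus ι → ℂ) (n : ι → ℤ) :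
    UnitAddTorus.mFourierCoeff f n = ∫ t, UnitAddTorus.mFourier (-n) t * f t ∂(haarTorus ι) := rfl

theorem mFourier_unitProj (n : ι → ℤ) (x : ι → ℝ) :
    UnitAddTorus.mFourier n (unitProj x) =
      Complex.exp (2 * π * Complex.I * ∑ i, (n i : ℂ) * x i) := by
  simp only [UnitAddTorus.mFourier, ContinuousMap.coe_mk, unitProj, fourier_coe_apply]
  rw [Finset.mul_sum, Complex.exp_sum]
  refine Finset.prod_congr rfl fun i _ => ?_
  congr 1
  push_cast; ring

/-- By invariance of Haar measure the integral of a translate does not depend on the translation;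
differentiate under the integral sign at `0`. -/
theorem integral_descend_deriv [DecidableEq ι] {g g' : (ι → ℝ) → ℂ} (hg : IntPeriodic g)
    (hg' : IntPeriodic g') (hc : Continuous g) (hc' : Continuous g') (j : ι)
    (hd : ∀ x, HasDerivAt (fun s : ℝ => g (x + s • Pi.single j 1)) (g' x) 0) :
    ∫ t, descend g' t ∂(haarTorus ι) = 0 := by
  set v : ℝ → ι → ℝ := fun s => s • Pi.single j 1 with hv
  have hadd : ∀ x s, unitProj (x + v s) = unitProj (v s) + unitProj x := fun x s => by
    ext i; simp [unitProj, add_comm]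
  have hD : Continuous (descend g) := continuous_descend hg hc
  have hD' : Continuous (descend g') := continuous_descend hg' hc'
  obtain ⟨C, hC⟩ := (isCompact_univ (X := UnitAddTorus ι)).exists_bound_of_continuousOn
    hD'.continuousOn
  have hder : ∀ (t : UnitAddTorus ι) (s : ℝ),
      HasDerivAt (fun s => descend g (unitProj (v s) + t)) (descend g' (unitProj (v s) + t)) s := by
    intro t s
    obtain ⟨x, rfl⟩ := (isOpenQuotientMap_unitProj (ι := ι)).surjective t
    simp only [← hadd, descend_unitProj hg, descend_unitProj hg']
    have h := hd (x + v s)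
    have h2 := HasDerivAt.comp_sub_const s s (f := fun σ : ℝ => g (x + v s + σ • Pi.single j 1))
      (f' := g' (x + v s)) (by rwa [sub_self])
    refine h2.congr_of_eventuallyEq (.of_forall fun σ => ?_)
    simp only [hv]
    congr 1
    ext i
    simp; ring
  have hmeas : ∀ s (f : UnitAddTorus ι → ℂ), Continuous f →
      AEStronglyMeasurable (fun t => f (unitProj (v s) + t)) (haarTorus ι) := fun s f hf =>
    (hf.comp (by fun_prop)).aestronglyMeasurable
  have h := (hasDerivAt_integral_of_dominated_loc_of_deriv_le (𝕜 := ℝ) (μ := haarTorus ι)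
    (F := fun s t => descend g (unitProj (v s) + t))
    (F' := fun s t => descend g' (unitProj (v s) + t)) (x₀ := 0) (s := univ) (bound := fun _ => C)
    univ_mem (.of_forall fun s => hmeas s _ hD)
    ((hD.comp (by fun_prop)).integrable_of_hasCompactSupport (HasCompactSupport.of_compactSpace _))
    (hmeas 0 _ hD')
    (.of_forall fun t s _ => hC _ (mem_univ _)) (integrable_const _)
    (.of_forall fun t s _ => hder t s)).2
  simp only [integral_add_left_eq_self] at h
  exact h.unique (hasDerivAt_const _ _)

/-- Integration by parts: the derivative of the product of `g` with a character has integral zero.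
-/
theorem mFourierCoeff_deriv [DecidableEq ι] {g g' : (ι → ℝ) → ℂ} (hg : IntPeriodic g)
    (hg' : IntPeriodic g') (hc : Continuous g) (hc' : Continuous g') (j : ι)
    (hd : ∀ x, HasDerivAt (fun s : ℝ => g (x + s • Pi.single j 1)) (g' x) 0) (n : ι → ℤ) :
    UnitAddTorus.mFourierCoeff (descend g') n =
      2 * π * Complex.I * n j * UnitAddTorus.mFourierCoeff (descend g) n := by
  set e : (ι → ℝ) → ℂ := fun x => UnitAddTorus.mFourier (-n) (unitProj x) with he
  have hep : IntPeriodic e := fun k x => by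
    simp only [he]
    congr 1
    ext i
    simp [unitProj]
  have hec : Continuous e :=
    (UnitAddTorus.mFourier (-n)).continuous.comp isOpenQuotientMap_unitProj.continuous
  have hed : ∀ x, HasDerivAt (fun s : ℝ => e (x + s • Pi.single j 1))
      (-(2 * π * Complex.I * n j) * e x) 0 := fun x => by
    simp only [he, mFourier_unitProj]
    have h0 : HasDerivAt (fun s : ℂ => 2 * π * Complex.I *
        (∑ i, ((-n) i : ℂ) * x i + ((-n) j : ℂ) * s)) (2 * π * Complex.I * (-n) j) ((0 : ℝ) : ℂ) := by
      simpa using (((hasDerivAt_id ((0 : ℝ) : ℂ)).const_mul (((-n) j : ℤ) : ℂ)).const_add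
        (∑ i, ((-n) i : ℂ) * x i)).const_mul (2 * π * Complex.I)
    have h1 := h0.cexp.comp_ofReal
    have hs : ∀ s : ℝ, ∑ i, (((-n) i : ℤ) : ℂ) * ((x + s • Pi.single j (1 : ℝ) : ι → ℝ) i : ℝ) =
        ∑ i, ((-n) i : ℂ) * x i + ((-n) j : ℂ) * s := fun s => by
      simp only [Pi.add_apply, Pi.smul_apply, smul_eq_mul, Complex.ofReal_add, mul_add,
        Finset.sum_add_distrib, add_right_inj]
      rw [Finset.sum_eq_single j (fun i _ hi => by simp [Pi.single_eq_of_ne hi]) (by simp)]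
      simp
    simp only [hs]
    refine h1.congr_deriv ?_
    simp
    ring
  have h := integral_descend_deriv (g := fun x => e x * g x)
    (g' := fun x => -(2 * π * Complex.I * n j) * (e x * g x) + e x * g' x) (j := j)
    (fun k x => by simp only [hep k x, hg k x]) (fun k x => by simp only [hep k x, hg k x, hg' k x])
    (by fun_prop) (by fun_prop) (fun x => by
      refine ((hed x).mul (hd x)).congr_deriv ?_
      simp; ring)
  have h1 : ∀ t, descend (fun x => -(2 * π * Complex.I * n j) * (e x * g x) + e x * g' x) t =
      -(2 * π * Complex.I * n j) * (UnitAddTorus.mFourier (-n) t * descend g t) +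
        UnitAddTorus.mFourier (-n) t * descend g' t := fun t => by
    simp only [descend, he, Function.surjInv_eq]
  have hD : Continuous (descend g) := continuous_descend hg hc
  have hD' : Continuous (descend g') := continuous_descend hg' hc'
  have hi : ∀ f : UnitAddTorus ι → ℂ, Continuous f → Integrable f (haarTorus ι) := fun f hf =>
    hf.integrable_of_hasCompactSupport (HasCompactSupport.of_compactSpace _)
  simp only [h1] at h
  rw [integral_add (hi _ (by fun_prop)) (hi _ (by fun_prop)), integral_const_mul] at h
  rw [mFourierCoeff_eq, mFourierCoeff_eq]
  linear_combination h

theorem norm_mFourierCoeff_le (f : UnitAddTorus ι → ℂ) {B : ℝ} (hB : ∀ t, ‖f t‖ ≤ B) (n : ι → ℤ) :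
    ‖UnitAddTorus.mFourierCoeff f n‖ ≤ B := by
  rw [mFourierCoeff_eq]
  refine (norm_integral_le_of_norm_le_const (C := B) (.of_forall fun t => ?_)).trans_eq (by simp)
  have h := (UnitAddTorus.mFourier (-n)).norm_coe_le_norm t
  rw [UnitAddTorus.mFourier_norm] at h
  rw [norm_mul]
  exact (mul_le_of_le_one_left (norm_nonneg _) h).trans (hB t)

/-- The `N`-th derivative along the `j`-th axis has coefficients multiplied by `(2πi n_j)^N`, and
`2π ≥ 1` is dropped. -/
theorem norm_mFourierCoeff_mul_pow_le {g : (ι → ℝ) → ℂ} (hg : IntPeriodic g)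
    (hs : ContDiff ℝ ∞ g) {N : ℕ} {B : ℝ} (hB : ∀ x, ‖iteratedFDeriv ℝ N g x‖ ≤ B) (n : ι → ℤ) (j : ι) :
    ‖(n j : ℝ)‖ ^ N * ‖UnitAddTorus.mFourierCoeff (descend g) n‖ ≤ B := by
  classical
  set D : ℕ → (ι → ℝ) → ℂ := fun k x => iteratedFDeriv ℝ k g x fun _ => Pi.single j 1 with hD
  have hper : ∀ k, IntPeriodic (D k) := fun k l x => by
    have h1 : iteratedFDeriv ℝ k (fun y => g (y + fun i => (l i : ℝ))) x =
        iteratedFDeriv ℝ k g (x + fun i => (l i : ℝ)) := iteratedFDeriv_comp_add_right k _ x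
    have h2 : (fun y => g (y + fun i => (l i : ℝ))) = g := funext fun y => hg l y
    rw [h2] at h1
    simp only [hD, h1]
  have hcont : ∀ k, Continuous (D k) := fun k => by
    have := hs.continuous_iteratedFDeriv (m := k) (by exact_mod_cast le_top)
    simp only [hD]
    exact (ContinuousMultilinearMap.apply ℝ (fun _ : Fin k => ι → ℝ) ℂ
      (fun _ => Pi.single j 1)).continuous.comp this
  have hder : ∀ k x, HasDerivAt (fun s : ℝ => D k (x + s • Pi.single j 1)) (D (k + 1) x) 0 := by
    intro k x
    have h1 : DifferentiableAt ℝ (iteratedFDeriv ℝ k g) (x + (0 : ℝ) • Pi.single j (1 : ℝ)) :=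
      (hs.differentiable_iteratedFDeriv (m := k) (by exact_mod_cast WithTop.coe_lt_top _)) _
    have h2 : HasDerivAt (fun s : ℝ => x + s • Pi.single j (1 : ℝ)) (Pi.single j (1 : ℝ)) 0 := by
      simpa using ((hasDerivAt_id (0 : ℝ)).smul_const (Pi.single j (1 : ℝ))).const_add x
    have h3 := h1.hasFDerivAt.comp_hasDerivAt _ h2
    have h4 := (ContinuousMultilinearMap.apply ℝ (fun _ : Fin k => ι → ℝ) ℂ
      (fun _ => Pi.single j 1)).hasFDerivAt.comp_hasDerivAt _ h3
    refine h4.congr_deriv ?_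
    simp only [hD, iteratedFDeriv_succ_apply_left, zero_smul, add_zero]
    rfl
  have hcoef : ∀ k, UnitAddTorus.mFourierCoeff (descend (D k)) n =
      (2 * π * Complex.I * n j) ^ k * UnitAddTorus.mFourierCoeff (descend g) n := by
    intro k
    induction k with
    | zero => simp [hD]
    | succ k ih =>
      rw [mFourierCoeff_deriv (hper k) (hper (k + 1)) (hcont k) (hcont (k + 1)) j (hder k), ih]
      ring
  have hbound : ∀ t, ‖descend (D N) t‖ ≤ B := fun t => by
    simp only [descend, hD]
    refine (ContinuousMultilinearMap.le_opNorm _ _).trans ?_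
    simpa [Pi.norm_single] using hB _
  have h := norm_mFourierCoeff_le _ hbound n
  rw [hcoef, norm_mul, norm_pow] at h
  refine le_trans ?_ h
  gcongr
  simp only [norm_mul, Complex.norm_real, Complex.norm_I, Complex.norm_ofNat, mul_one,
    Complex.norm_intCast, Real.norm_of_nonneg Real.pi_pos.le, Real.norm_eq_abs]
  nlinarith [Real.pi_gt_three, abs_nonneg (n j : ℝ)]

theorem one_add_norm_pow_mul_norm_mFourierCoeff_le {g : (ι → ℝ) → ℂ} (hg : IntPeriodic g)
    (hs : ContDiff ℝ ∞ g) {N : ℕ} {B : ℝ} (hB0 : ∀ x, ‖g x‖ ≤ B)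
    (hB : ∀ x, ‖iteratedFDeriv ℝ N g x‖ ≤ B) (n : ι → ℤ) :
    (1 + ‖n‖) ^ N * ‖UnitAddTorus.mFourierCoeff (descend g) n‖ ≤ 2 ^ N * (2 * B) := by
  have hBnn : 0 ≤ B := (norm_nonneg _).trans (hB0 0)
  have h0 := norm_mFourierCoeff_le (descend g) (fun t => hB0 _) n
  have h1 : ‖n‖ ^ N * ‖UnitAddTorus.mFourierCoeff (descend g) n‖ ≤ B := by
    rcases isEmpty_or_nonempty ι with hι | hι
    · have hn : ‖n‖ = 0 := by simp [Subsingleton.elim n 0]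
      rw [hn]
      rcases Nat.eq_zero_or_pos N with rfl | hN
      · simpa using h0
      · simpa [zero_pow hN.ne'] using hBnn
    -- The sup norm of `n` is attained at one coordinate, so derivatives along a single axis
    -- suffice.
    · obtain ⟨j, hj⟩ := Finite.exists_max fun i => ‖n i‖
      have hn : ‖n‖ ≤ ‖(n j : ℝ)‖ := (pi_norm_le_iff_of_nonneg (norm_nonneg _)).2 hj
      refine le_trans ?_ (norm_mFourierCoeff_mul_pow_le hg hs hB n j)
      gcongr
  set c := ‖UnitAddTorus.mFourierCoeff (descend g) n‖
  have hc : 0 ≤ c := norm_nonneg _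
  have h2 : (1 + ‖n‖) ^ N ≤ 2 ^ N * (1 + ‖n‖ ^ N) := by
    refine (add_pow_le zero_le_one (norm_nonneg n) N).trans ?_
    rw [one_pow]
    gcongr
    · norm_num
    · omega
  calc _ ≤ 2 ^ N * (1 + ‖n‖ ^ N) * c := by gcongr
    _ = 2 ^ N * (c + ‖n‖ ^ N * c) := by ring
    _ ≤ 2 ^ N * (2 * B) := by gcongr; linarith

theorem hasSum_mFourier_of_smooth {g : (ι → ℝ) → ℂ} (hg : IntPeriodic g) (hs : ContDiff ℝ ∞ g)
    (hsum : Summable (UnitAddTorus.mFourierCoeff (descend g))) (x : ι → ℝ) :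
    HasSum (fun n : ι → ℤ => UnitAddTorus.mFourierCoeff (descend g) n *
      Complex.exp (2 * π * Complex.I * ∑ i, (n i : ℂ) * x i)) (g x) := by
  have h := UnitAddTorus.hasSum_mFourier_series_apply_of_summable
    (f := ⟨descend g, continuous_descend hg hs.continuous⟩) hsum (unitProj x)
  simp only [mFourier_unitProj, ContinuousMap.coe_mk, descend_unitProj hg] at h
  exact h

end FourierSeries

/-! ### The homogeneous extension and the `C^N` norms -/

theorem contDiffAt_homExt [NeZero d] {φ : ST d → ℂ} (hφ : φ ∈ smoothST d) {p : E d × E d}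
    (hp : p.2 ≠ 0) : ContDiffAt ℝ ∞ (homExt φ) p := by
  set v₀ := p.2
  have hv₀ : 0 < ‖v₀‖ := norm_pos_iff.2 hp
  -- The map `ρ` is the identity near `v₀` and never vanishes, as it stays within `‖v₀‖/2` of `v₀`.
  -- Replacing `v` by `ρ v` makes the normalization a globally smooth map into the sphere without
  -- changing the function near the point.
  let χ : ContDiffBump v₀ := ⟨‖v₀‖ / 4, ‖v₀‖ / 2, by positivity, by linarith⟩
  set ρ : E d → E d := fun v => v₀ + χ v • (v - v₀) with hρ
  have hρs : ContDiff ℝ ∞ ρ :=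
    contDiff_const.add (χ.contDiff.smul (contDiff_id.sub contDiff_const))
  have hρ0 : ∀ v, ρ v ≠ 0 := fun v h => by
    have h1 : ‖χ v • (v - v₀)‖ = ‖v₀‖ := by
      rw [eq_neg_of_add_eq_zero_right (a := v₀) h, norm_neg]
    have h2 : ‖χ v • (v - v₀)‖ ≤ ‖v₀‖ / 2 := by
      rcases lt_or_ge (dist v v₀) (‖v₀‖ / 2) with h3 | h3
      · rw [norm_smul, Real.norm_of_nonneg χ.nonneg, ← dist_eq_norm]
        exact (mul_le_of_le_one_left dist_nonneg χ.le_one).trans h3.le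
      · rw [χ.zero_of_le_dist h3, zero_smul, norm_zero]; positivity
    linarith
  have hN : ContDiff ℝ ∞ fun q : E d × E d => ‖ρ q.2‖⁻¹ • ρ q.2 := by
    have h1 : ContDiff ℝ ∞ fun q : E d × E d => ρ q.2 := hρs.comp contDiff_snd
    exact ((h1.norm ℝ fun q => hρ0 _).inv fun q => norm_ne_zero_iff.2 (hρ0 _)).smul h1
  have hmem : ∀ q : E d × E d, ‖ρ q.2‖⁻¹ • ρ q.2 ∈ Metric.sphere (0 : E d) 1 := fun q => by
    simp [norm_smul, hρ0]
  have hS := (hN.contMDiff).codRestrict_sphere (n := d - 1) hmem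
  have hF : ContMDiff 𝓘(ℝ, E d × E d) 𝓘(ℝ, ℂ) ∞ fun q : E d × E d =>
      φ (proj q.1, ⟨‖ρ q.2‖⁻¹ • ρ q.2, hmem q⟩) := by
    have h1 : ContMDiff 𝓘(ℝ, E d × E d) 𝓘(ℝ, E d) ∞ (Prod.fst : E d × E d → E d) :=
      contDiff_fst.contMDiff
    exact (mem_smoothST.1 hφ).comp (h1.prodMk hS)
  refine (hF.contDiff.contDiffAt (x := p)).congr_of_eventuallyEq ?_
  have hnear : ∀ᶠ q : E d × E d in nhds p, q.2 ∈ Metric.ball v₀ (‖v₀‖ / 4) :=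
    continuous_snd.continuousAt.eventually (Metric.ball_mem_nhds _ (by positivity))
  filter_upwards [hnear] with q hq
  have hq1 : ρ q.2 = q.2 := by
    simp only [hρ, χ.one_of_mem_closedBall (Metric.ball_subset_closedBall hq)]
    simp
  have hq2 : q.2 ≠ 0 := by rw [← hq1]; exact hρ0 _
  simp only [homExt, dif_pos hq2, hq1]

theorem proj_add_two_pi_freq (x : E d) (k : Fin d → ℤ) :
    proj (x + (2 * π) • freq k) = proj x := by
  ext i
  simp only [proj, freq, PiLp.add_apply, PiLp.smul_apply, smul_eq_mul, AddCircle.coe_add]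
  have := AddCircle.coe_eq_zero_iff (2 * π) (x := 2 * π * (k i : ℝ)) |>.2
    ⟨k i, by simp [mul_comm]⟩
  rw [this, add_zero]

theorem homExt_add_two_pi_freq (φ : ST d → ℂ) (x v : E d) (k : Fin d → ℤ) :
    homExt φ (x + (2 * π) • freq k, v) = homExt φ (x, v) := by
  simp only [homExt, proj_add_two_pi_freq]

theorem homExt_sphere (φ : ST d → ℂ) (x : E d) (θ : Sph d) :
    homExt φ (x, (θ : E d)) = φ (proj x, θ) := by
  have hθ : (θ : E d) ≠ 0 := ne_zero_of_mem_unit_sphere θ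
  simp only [homExt]
  rw [dif_pos hθ]
  congr
  simp

/-- Every point of `ℝ^d` has a representative modulo `2πℤ^d` in a fixed compact set. -/
theorem exists_isCompact_fundamental (d : ℕ) :
    ∃ K : Set (E d), IsCompact K ∧ ∀ x : E d, ∃ k : Fin d → ℤ, x + (2 * π) • freq k ∈ K := by
  refine ⟨(WithLp.toLp 2) '' (Set.pi univ fun _ : Fin d => Icc (0 : ℝ) (0 + 2 * π)),
    (isCompact_univ_pi fun _ => isCompact_Icc).image (PiLp.continuous_toLp 2 _), fun x => ?_⟩
  refine ⟨fun i => -toIcoDiv Real.two_pi_pos 0 (x i),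
    fun i => toIcoMod Real.two_pi_pos 0 (x i), fun i _ =>
      Ico_subset_Icc_self (toIcoMod_mem_Ico Real.two_pi_pos 0 (x i)), ?_⟩
  ext i
  have h := self_sub_toIcoDiv_zsmul Real.two_pi_pos 0 (x i)
  rw [zsmul_eq_mul] at h
  simp only [freq, PiLp.add_apply, PiLp.smul_apply, smul_eq_mul, Int.cast_neg, ← h]
  ring

/-- By periodicity the supremum is over a compact set. This is needed because an unbounded real
supremum takes the default value `0`. -/
theorem cNorm_bddAbove [NeZero d] {φ : ST d → ℂ} (hφ : φ ∈ smoothST d) (N : ℕ) :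
    BddAbove (range fun p : E d × Sph d =>
      ∑ k ∈ Finset.range (N + 1), ‖iteratedFDeriv ℝ k (homExt φ) (p.1, (p.2 : E d))‖) := by
  obtain ⟨K, hK, hKx⟩ := exists_isCompact_fundamental d
  have hcont : Continuous fun p : E d × Sph d =>
      ∑ k ∈ Finset.range (N + 1), ‖iteratedFDeriv ℝ k (homExt φ) (p.1, (p.2 : E d))‖ := by
    refine continuous_finsetSum _ fun k _ => Continuous.norm ?_
    rw [continuous_iff_continuousAt]
    intro p
    have h1 : ContDiffAt ℝ 0 (iteratedFDeriv ℝ k (homExt φ)) (p.1, (p.2 : E d)) :=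
      (contDiffAt_homExt hφ (ne_zero_of_mem_unit_sphere p.2)).iteratedFDeriv_right
        (by rw [zero_add]; exact_mod_cast le_top)
    exact ContinuousAt.comp (f := fun p : E d × Sph d => (p.1, (p.2 : E d))) h1.continuousAt
      (by fun_prop)
  obtain ⟨C, hC⟩ := (hK.prod (isCompact_univ (X := Sph d))).exists_bound_of_continuousOn
    hcont.continuousOn
  refine ⟨C, ?_⟩
  rintro _ ⟨⟨x, θ⟩, rfl⟩
  obtain ⟨k, hk⟩ := hKx x
  have hper : ∀ n, iteratedFDeriv ℝ n (homExt φ) (x, (θ : E d)) =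
      iteratedFDeriv ℝ n (homExt φ) (x + (2 * π) • freq k, (θ : E d)) := fun n => by
    have h1 := iteratedFDeriv_comp_add_right (𝕜 := ℝ) (f := homExt φ) n ((2 * π) • freq k, 0)
      (x, (θ : E d))
    have h2 : (fun z : E d × E d => homExt φ (z + ((2 * π) • freq k, 0))) = homExt φ :=
      funext fun z => by
        rw [show z + ((2 * π) • freq k, 0) = (z.1 + (2 * π) • freq k, z.2) by
          ext <;> simp, homExt_add_two_pi_freq]
    rw [h2] at h1
    rw [h1]; simp
  simp only [hper]
  exact (le_abs_self _).trans (hC (x + (2 * π) • freq k, θ) ⟨hk, mem_univ _⟩)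

theorem norm_iteratedFDeriv_homExt_le [NeZero d] {φ : ST d → ℂ} (hφ : φ ∈ smoothST d) {N k : ℕ}
    (hk : k ≤ N) (x : E d) (θ : Sph d) :
    ‖iteratedFDeriv ℝ k (homExt φ) (x, (θ : E d))‖ ≤ cNorm N φ := by
  refine le_trans ?_ (le_ciSup (cNorm_bddAbove hφ N) (x, θ))
  exact Finset.single_le_sum (f := fun k => ‖iteratedFDeriv ℝ k (homExt φ) (x, (θ : E d))‖)
    (fun _ _ => norm_nonneg _) (Finset.mem_range.2 (by omega))

theorem cNorm_nonneg (N : ℕ) (φ : ST d → ℂ) : 0 ≤ cNorm N φ :=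
  Real.iSup_nonneg fun _ => Finset.sum_nonneg fun _ _ => norm_nonneg _

theorem isOpen_snd_ne_zero : IsOpen {p : E d × E d | p.2 ≠ 0} :=
  isOpen_ne_fun continuous_snd continuous_const

/-- The extension is invariant under rescaling of the second variable. Rescaling `p` to the unit
sphere uses a factor at most `2`, which enters once for each derivative. -/
theorem norm_iteratedFDeriv_homExt_le_of_half_le [NeZero d] {φ : ST d → ℂ} (hφ : φ ∈ smoothST d)
    {N k : ℕ} (hk : k ≤ N) {p : E d × E d} (hp : 1 / 2 ≤ ‖p.2‖) :
    ‖iteratedFDeriv ℝ k (homExt φ) p‖ ≤ 2 ^ k * cNorm N φ := by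
  have hp0 : 0 < ‖p.2‖ := by linarith
  have hpne : p.2 ≠ 0 := norm_pos_iff.1 hp0
  set s : Set (E d × E d) := {p | p.2 ≠ 0}
  have hs : IsOpen s := isOpen_snd_ne_zero
  set c : ℝˣ := Units.mk0 ‖p.2‖⁻¹ (inv_ne_zero hp0.ne')
  set g : (E d × E d) ≃L[ℝ] (E d × E d) :=
    (ContinuousLinearEquiv.refl ℝ (E d)).prodCongr (ContinuousLinearEquiv.smulLeft c)
  have hg : ∀ q : E d × E d, g q = (q.1, ‖p.2‖⁻¹ • q.2) := fun q => rfl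
  have hcomp : homExt φ ∘ g = homExt φ := funext fun q => by
    simp only [Function.comp, hg, homExt]
    by_cases hq : q.2 = 0
    · simp [hq]
    · have h1 : ‖p.2‖⁻¹ • q.2 ≠ 0 := smul_ne_zero (inv_ne_zero hp0.ne') hq
      rw [dif_pos hq, dif_pos h1]
      congr 3
      rw [norm_smul, smul_smul, norm_inv, norm_norm, mul_inv, inv_inv]
      congr 1
      field_simp
  have hpre : g ⁻¹' s = s := by
    ext q
    simp only [mem_preimage, hg, s, Set.mem_ofPred_eq]
    simp [hpne]
  have hgs : g p ∈ s := by rw [← mem_preimage, hpre]; exact hpne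
  have h := g.iteratedFDerivWithin_comp_right (homExt φ) hs.uniqueDiffOn hgs k
  rw [hcomp, hpre, iteratedFDerivWithin_of_isOpen k hs hpne,
    iteratedFDerivWithin_of_isOpen k hs hgs] at h
  have hθ : ‖p.2‖⁻¹ • p.2 ∈ Metric.sphere (0 : E d) 1 := by simp [norm_smul, hpne]
  have hgn : ‖(g : (E d × E d) →L[ℝ] (E d × E d))‖ ≤ 2 := by
    refine ContinuousLinearMap.opNorm_le_bound _ two_pos.le fun q => ?_
    have h2 : ‖p.2‖⁻¹ ≤ 2 := by
      rw [inv_le_comm₀ hp0 two_pos]; linarith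
    change ‖g q‖ ≤ _
    rw [hg, Prod.norm_def, Prod.norm_def, norm_smul, norm_inv, norm_norm]
    have hq1 := le_max_left ‖q.1‖ ‖q.2‖
    have hq2 := le_max_right ‖q.1‖ ‖q.2‖
    refine max_le ?_ ?_
    · linarith [norm_nonneg q.1]
    · exact mul_le_mul h2 hq2 (norm_nonneg _) two_pos.le
  rw [h]
  refine (ContinuousMultilinearMap.norm_compContinuousLinearMap_le _ _).trans ?_
  rw [Finset.prod_const, Finset.card_univ, Fintype.card_fin, mul_comm]
  have := norm_iteratedFDeriv_homExt_le hφ hk p.1 ⟨_, hθ⟩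
  gcongr
  exact this

/-! ### Cut-off and periodization in the fibre variable -/

/-- A smooth radial cut-off equal to `1` on the unit sphere and supported in an annulus. -/
def radialCut (d : ℕ) (v : E d) : ℂ :=
  (((⟨1 / 4, 1 / 2, by norm_num, by norm_num⟩ : ContDiffBump (1 : ℝ)) (‖v‖ ^ 2) : ℝ) : ℂ)

theorem contDiff_radialCut (d : ℕ) : ContDiff ℝ ∞ (radialCut d) :=
  Complex.ofRealCLM.contDiff.comp ((ContDiffBump.contDiff _).comp (contDiff_norm_sq ℝ))

theorem radialCut_sphere (θ : Sph d) : radialCut d θ = 1 := by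
  have h : ‖(θ : E d)‖ = 1 := norm_eq_of_mem_sphere θ
  rw [radialCut, h, ContDiffBump.one_of_mem_closedBall _ (by simp)]
  simp

theorem radialCut_eq_zero_of_le {v : E d} (h : ‖v‖ ≤ 1 / 2) : radialCut d v = 0 := by
  rw [radialCut, ContDiffBump.zero_of_le_dist, Complex.ofReal_zero]
  have : ‖v‖ ^ 2 ≤ (1 / 2) ^ 2 := by gcongr
  rw [Real.dist_eq, abs_sub_comm, abs_of_nonneg] <;> norm_num at * <;> linarith

theorem radialCut_eq_zero_of_ge {v : E d} (h : 2 ≤ ‖v‖) : radialCut d v = 0 := by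
  rw [radialCut, ContDiffBump.zero_of_le_dist, Complex.ofReal_zero]
  have : 2 ^ 2 ≤ ‖v‖ ^ 2 := by gcongr
  rw [Real.dist_eq, abs_of_nonneg] <;> norm_num at * <;> linarith

theorem exists_norm_iteratedFDeriv_radialCut_le (d N : ℕ) :
    ∃ A : ℝ, 0 ≤ A ∧ ∀ k ≤ N, ∀ v, ‖iteratedFDeriv ℝ k (radialCut d) v‖ ≤ A := by
  have hc : HasCompactSupport (radialCut d) :=
    HasCompactSupport.intro (isCompact_closedBall (0 : E d) 2) fun v hv =>
      radialCut_eq_zero_of_ge (by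
        rw [Metric.mem_closedBall, dist_zero_right, not_le] at hv; exact hv.le)
  have h1 : ∀ k : ℕ, ∃ C, ∀ v, ‖iteratedFDeriv ℝ k (radialCut d) v‖ ≤ C := fun k =>
    (hc.iteratedFDeriv k).exists_bound_of_continuous
      ((contDiff_radialCut d).continuous_iteratedFDeriv (by exact_mod_cast le_top))
  choose C hC using h1
  refine ⟨∑ k ∈ Finset.range (N + 1), C k, Finset.sum_nonneg fun k _ =>
    (norm_nonneg _).trans (hC k 0), fun k hk v => (hC k v).trans ?_⟩
  exact Finset.single_le_sum (f := C) (fun k _ => (norm_nonneg _).trans (hC k 0))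
    (Finset.mem_range.2 (by omega))

/-- The homogeneous extension, cut off near the unit sphere. -/
def cutExt (φ : ST d → ℂ) (p : E d × E d) : ℂ := radialCut d p.2 * homExt φ p

theorem cutExt_eq_zero_of_ge (φ : ST d → ℂ) (x : E d) {v : E d} (h : 2 ≤ ‖v‖) :
    cutExt φ (x, v) = 0 := by
  rw [cutExt, radialCut_eq_zero_of_ge h, zero_mul]

theorem cutExt_eventuallyEq_zero (φ : ST d → ℂ) {p : E d × E d} (h : ‖p.2‖ < 1 / 2) :
    cutExt φ =ᶠ[nhds p] fun _ => 0 := by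
  have h1 : ∀ᶠ q : E d × E d in nhds p, ‖q.2‖ < 1 / 2 :=
    (continuous_snd.norm.continuousAt (x := p)).eventually (gt_mem_nhds h)
  filter_upwards [h1] with q hq
  rw [cutExt, radialCut_eq_zero_of_le hq.le, zero_mul]

theorem contDiff_cutExt [NeZero d] {φ : ST d → ℂ} (hφ : φ ∈ smoothST d) :
    ContDiff ℝ ∞ (cutExt φ) := by
  rw [contDiff_iff_contDiffAt]
  intro p
  rcases lt_or_ge ‖p.2‖ (1 / 2) with h | h
  · exact contDiffAt_const.congr_of_eventuallyEq (cutExt_eventuallyEq_zero φ h)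
  · have hp : p.2 ≠ 0 := norm_pos_iff.1 (by linarith)
    exact (((contDiff_radialCut d).comp contDiff_snd).contDiffAt).mul (contDiffAt_homExt hφ hp)

theorem norm_iteratedFDeriv_comp_snd_le {f : E d → ℂ} (hf : ContDiff ℝ ∞ f) (k : ℕ)
    (p : E d × E d) : ‖iteratedFDeriv ℝ k (fun q : E d × E d => f q.2) p‖ ≤
      ‖iteratedFDeriv ℝ k f p.2‖ := by
  have h := (ContinuousLinearMap.snd ℝ (E d) (E d)).iteratedFDeriv_comp_right hf p
    (i := k) (by exact_mod_cast le_top)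
  have h2 : (f ∘ (ContinuousLinearMap.snd ℝ (E d) (E d))) = fun q : E d × E d => f q.2 := rfl
  rw [h2] at h
  rw [h]
  refine (ContinuousMultilinearMap.norm_compContinuousLinearMap_le _ _).trans ?_
  refine mul_le_of_le_one_right (norm_nonneg _) ?_
  rw [Finset.prod_const]
  exact pow_le_one₀ (norm_nonneg _) (ContinuousLinearMap.norm_snd_le _ _ _)

/-- Leibniz rule on `‖v‖ ≥ 1/2`; inside that ball the function vanishes. The constant depends on the
cut-off only, not on `φ`. -/
theorem exists_norm_iteratedFDeriv_cutExt_le (d N : ℕ) [NeZero d] :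
    ∃ A : ℝ, 0 ≤ A ∧ ∀ φ ∈ smoothST d, ∀ k ≤ N, ∀ p,
      ‖iteratedFDeriv ℝ k (cutExt φ) p‖ ≤ A * cNorm N φ := by
  obtain ⟨A, hA, hAb⟩ := exists_norm_iteratedFDeriv_radialCut_le d N
  refine ⟨∑ k ∈ Finset.range (N + 1), ∑ i ∈ Finset.range (k + 1), (k.choose i : ℝ) * A *
    2 ^ (k - i), by positivity, fun φ hφ k hk p => ?_⟩
  have hc := cNorm_nonneg N φ
  rcases lt_or_ge ‖p.2‖ (1 / 2) with h | h
  · rw [((cutExt_eventuallyEq_zero φ h).iteratedFDeriv ℝ k).eq_of_nhds, iteratedFDeriv_fun_zero,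
      Pi.zero_apply, norm_zero]
    positivity
  have hp : p.2 ≠ 0 := norm_pos_iff.1 (by linarith)
  set s : Set (E d × E d) := {p | p.2 ≠ 0}
  have hs : IsOpen s := isOpen_snd_ne_zero
  have hps : p ∈ s := hp
  have hχ : ContDiff ℝ ∞ fun q : E d × E d => radialCut d q.2 :=
    (contDiff_radialCut d).comp contDiff_snd
  have h1 := norm_iteratedFDerivWithin_mul_le (n := k) (N := ∞) hχ.contDiffOn
    (fun q (hq : q ∈ s) => (contDiffAt_homExt hφ hq).contDiffWithinAt) hs.uniqueDiffOn hps
    (by exact_mod_cast le_top)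
  rw [iteratedFDerivWithin_of_isOpen k hs hps] at h1
  refine h1.trans ?_
  have h2 : ∀ i ∈ Finset.range (k + 1), (k.choose i : ℝ) *
      ‖iteratedFDerivWithin ℝ i (fun q : E d × E d => radialCut d q.2) s p‖ *
      ‖iteratedFDerivWithin ℝ (k - i) (homExt φ) s p‖ ≤
      (k.choose i : ℝ) * A * 2 ^ (k - i) * cNorm N φ := fun i hi => by
    rw [Finset.mem_range] at hi
    rw [iteratedFDerivWithin_of_isOpen i hs hps, iteratedFDerivWithin_of_isOpen (k - i) hs hps,
      mul_assoc _ _ (cNorm N φ)]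
    gcongr
    · exact (norm_iteratedFDeriv_comp_snd_le (contDiff_radialCut d) i p).trans
        (hAb i (by omega) _)
    · exact norm_iteratedFDeriv_homExt_le_of_half_le hφ (by omega) h
  refine (Finset.sum_le_sum h2).trans ?_
  rw [← Finset.sum_mul]
  gcongr
  exact Finset.single_le_sum (f := fun k => ∑ i ∈ Finset.range (k + 1), (k.choose i : ℝ) * A *
    2 ^ (k - i)) (fun k _ => by positivity) (Finset.mem_range.2 (by omega : k < N + 1))

/-- The representative modulo `2πℤ^d` in `[-π, π)^d`. -/
def wrap (v : E d) : E d := WithLp.toLp 2 fun i => toIcoMod Real.two_pi_pos (-π) (v i)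

theorem wrap_add_two_pi_freq (v : E d) (k : Fin d → ℤ) : wrap (v + (2 * π) • freq k) = wrap v := by
  ext i
  have h : (v + (2 * π) • freq k) i = v i + k i • (2 * π) := by
    simp [freq, mul_comm]
  simp only [wrap, h, toIcoMod_add_zsmul]

theorem exists_wrap_eq (v : E d) : ∃ k : Fin d → ℤ, wrap v = v + (2 * π) • freq k := by
  refine ⟨fun i => -toIcoDiv Real.two_pi_pos (-π) (v i), ?_⟩
  ext i
  have h := self_sub_toIcoDiv_zsmul Real.two_pi_pos (-π) (v i)
  rw [zsmul_eq_mul] at h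
  simp only [wrap, freq, PiLp.add_apply, PiLp.smul_apply, smul_eq_mul, Int.cast_neg, ← h]
  ring

theorem wrap_eq_self {v : E d} (h : ∀ i, v i ∈ Ico (-π) π) : wrap v = v := by
  ext i
  simp only [wrap]
  rw [toIcoMod_eq_self]
  have := h i
  rwa [show -π + 2 * π = π by ring]

/-- Periodization in the fibre variable is locally a translation. -/
theorem eventually_comp_wrap_eq {g : E d × E d → ℂ} (hg : ∀ x v, 2 ≤ ‖v‖ → g (x, v) = 0)
    (p : E d × E d) : ∃ k : Fin d → ℤ,
      (fun q : E d × E d => g (q.1, wrap q.2)) =ᶠ[nhds p]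
        fun q => g (q + (0, (2 * π) • freq k)) := by
  obtain ⟨k, hk⟩ := exists_wrap_eq p.2
  refine ⟨k, ?_⟩
  -- The fundamental cell is half-open, so a point near its face `-π` may leave it on that side
  -- only; the interval is enlarged there by `1`.
  have hmem : ∀ i, (p.2 + (2 * π) • freq k) i ∈ Ioo (-π - 1) π := fun i => by
    rw [← hk]
    have h : wrap p.2 i ∈ Ico (-π) (-π + 2 * π) := toIcoMod_mem_Ico Real.two_pi_pos (-π) (p.2 i)
    rw [show -π + 2 * π = π by ring] at h
    exact ⟨by linarith [h.1], h.2⟩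
  have hev : ∀ᶠ q : E d × E d in nhds p, ∀ i, (q.2 + (2 * π) • freq k) i ∈ Ioo (-π - 1) π := by
    rw [eventually_all]
    intro i
    have hc : Continuous fun q : E d × E d => (q.2 + (2 * π) • freq k) i := by fun_prop
    exact hc.continuousAt.eventually (isOpen_Ioo.mem_nhds (hmem i))
  filter_upwards [hev] with q hq
  rw [show q + (0, (2 * π) • freq k) = (q.1, q.2 + (2 * π) • freq k) by ext <;> simp,
    ← wrap_add_two_pi_freq q.2 k]
  set u := q.2 + (2 * π) • freq k
  by_cases hu : ∀ i, -π ≤ u i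
  · rw [wrap_eq_self fun i => ⟨hu i, (hq i).2⟩]
  -- Where a coordinate slips below `-π`, wrapping moves it into `(π - 1, π)`. Both points then have
  -- norm at least `2` because `π > 3`, and `g` vanishes at both.
  · push Not at hu
    obtain ⟨i, hi⟩ := hu
    have hπ := Real.pi_gt_three
    have h1 : 2 ≤ ‖u‖ := by
      refine le_trans ?_ (PiLp.norm_apply_le u i)
      rw [Real.norm_eq_abs, abs_of_neg (by linarith)]
      linarith
    have h2 : 2 ≤ ‖wrap u‖ := by
      refine le_trans ?_ (PiLp.norm_apply_le (wrap u) i)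
      have h3 : wrap u i = u i + 2 * π := by
        simp only [wrap]
        rw [← toIcoMod_add_right, toIcoMod_eq_self]
        exact ⟨by linarith [(hq i).1], by linarith⟩
      rw [h3, Real.norm_eq_abs, abs_of_nonneg (by linarith [(hq i).1])]
      linarith [(hq i).1]
    rw [hg _ _ h1, hg _ _ h2]

/-- The cut-off extension, periodized in the fibre variable. -/
def torusExt (φ : ST d → ℂ) (p : E d × E d) : ℂ := cutExt φ (p.1, wrap p.2)

theorem contDiff_torusExt [NeZero d] {φ : ST d → ℂ} (hφ : φ ∈ smoothST d) :
    ContDiff ℝ ∞ (torusExt φ) := by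
  rw [contDiff_iff_contDiffAt]
  intro p
  obtain ⟨k, hk⟩ := eventually_comp_wrap_eq (fun x v => cutExt_eq_zero_of_ge φ x) p
  exact ((contDiff_cutExt hφ).comp (contDiff_id.add contDiff_const)).contDiffAt.congr_of_eventuallyEq
    hk

theorem exists_norm_iteratedFDeriv_torusExt_le (d N : ℕ) [NeZero d] :
    ∃ A : ℝ, 0 ≤ A ∧ ∀ φ ∈ smoothST d, ∀ k ≤ N, ∀ p,
      ‖iteratedFDeriv ℝ k (torusExt φ) p‖ ≤ A * cNorm N φ := by
  obtain ⟨A, hA, hAb⟩ := exists_norm_iteratedFDeriv_cutExt_le d N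
  refine ⟨A, hA, fun φ hφ k hk p => ?_⟩
  obtain ⟨l, hl⟩ := eventually_comp_wrap_eq (fun x v => cutExt_eq_zero_of_ge φ x) p
  have h : torusExt φ =ᶠ[nhds p] fun q => cutExt φ (q + (0, (2 * π) • freq l)) := hl
  rw [(h.iteratedFDeriv ℝ k).eq_of_nhds, iteratedFDeriv_comp_add_right]
  exact hAb φ hφ k hk _

theorem torusExt_sphere (φ : ST d → ℂ) (x : E d) (θ : Sph d) :
    torusExt φ (x, (θ : E d)) = φ (proj x, θ) := by
  have h : wrap (θ : E d) = θ := wrap_eq_self fun i => by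
    have h1 := PiLp.norm_apply_le (θ : E d) i
    rw [norm_eq_of_mem_sphere θ, Real.norm_eq_abs, abs_le] at h1
    have := Real.pi_gt_three
    exact ⟨by linarith, by linarith⟩
  rw [torusExt, cutExt, h, radialCut_sphere, one_mul, homExt_sphere]

theorem torusExt_add (φ : ST d → ℂ) (x v : E d) (k l : Fin d → ℤ) :
    torusExt φ (x + (2 * π) • freq k, v + (2 * π) • freq l) = torusExt φ (x, v) := by
  simp only [torusExt, cutExt, wrap_add_two_pi_freq, homExt_add_two_pi_freq]

/-! ### Fourier expansion of smooth functions on the unit tangent bundle -/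

/-- The coordinates `(x, v) = 2π w` of `ℝ^d × ℝ^d`. -/
def torusCoord (d : ℕ) : (Fin d ⊕ Fin d → ℝ) →L[ℝ] E d × E d :=
  ((2 * π) • ((EuclideanSpace.equiv (Fin d) ℝ).symm.toContinuousLinearMap.comp
    (ContinuousLinearMap.pi fun i => ContinuousLinearMap.proj (Sum.inl i)))).prod
  ((2 * π) • ((EuclideanSpace.equiv (Fin d) ℝ).symm.toContinuousLinearMap.comp
    (ContinuousLinearMap.pi fun i => ContinuousLinearMap.proj (Sum.inr i))))

theorem torusCoord_apply (w : Fin d ⊕ Fin d → ℝ) : torusCoord d w =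
    ((2 * π) • WithLp.toLp 2 (fun i => w (Sum.inl i)),
      (2 * π) • WithLp.toLp 2 (fun i => w (Sum.inr i))) := rfl

/-- The periodized extension as a function on `ℝ^{2d}` with period `1` in each variable. -/
def unitExt (φ : ST d → ℂ) (w : Fin d ⊕ Fin d → ℝ) : ℂ := torusExt φ (torusCoord d w)

theorem intPeriodic_unitExt (φ : ST d → ℂ) : IntPeriodic (unitExt φ) := by
  intro k w
  rw [unitExt, unitExt, torusCoord_apply, torusCoord_apply]
  refine Eq.trans ?_ (torusExt_add φ _ _ (fun i => k (Sum.inl i)) (fun i => k (Sum.inr i)))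
  congr 1
  ext i <;> simp [freq] <;> ring

theorem contDiff_unitExt [NeZero d] {φ : ST d → ℂ} (hφ : φ ∈ smoothST d) :
    ContDiff ℝ ∞ (unitExt φ) :=
  (contDiff_torusExt hφ).comp (torusCoord d).contDiff

theorem exists_norm_iteratedFDeriv_unitExt_le (d N : ℕ) [NeZero d] :
    ∃ A : ℝ, 0 ≤ A ∧ ∀ φ ∈ smoothST d, ∀ k ≤ N, ∀ p,
      ‖iteratedFDeriv ℝ k (unitExt φ) p‖ ≤ A * cNorm N φ := by
  obtain ⟨A, hA, hAb⟩ := exists_norm_iteratedFDeriv_torusExt_le d N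
  refine ⟨A * ∑ k ∈ Finset.range (N + 1), ‖torusCoord d‖ ^ k, by positivity,
    fun φ hφ k hk p => ?_⟩
  have h := (torusCoord d).iteratedFDeriv_comp_right (contDiff_torusExt hφ) p
    (i := k) (by exact_mod_cast le_top)
  have h2 : torusExt φ ∘ (torusCoord d) = unitExt φ := rfl
  rw [h2] at h
  rw [h]
  refine (ContinuousMultilinearMap.norm_compContinuousLinearMap_le _ _).trans ?_
  rw [Finset.prod_const, Finset.card_univ, Fintype.card_fin]
  have h3 := hAb φ hφ k hk (torusCoord d p)
  have h4 : ‖torusCoord d‖ ^ k ≤ ∑ k ∈ Finset.range (N + 1), ‖torusCoord d‖ ^ k :=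
    Finset.single_le_sum (f := fun k => ‖torusCoord d‖ ^ k) (fun _ _ => by positivity)
      (Finset.mem_range.2 (by omega))
  calc _ ≤ A * cNorm N φ * ∑ k ∈ Finset.range (N + 1), ‖torusCoord d‖ ^ k := by
        have := cNorm_nonneg N φ
        gcongr
    _ = _ := by ring

/-- The Fourier coefficients of a smooth function on `S𝕋^d`, more precisely of its periodized
extension, indexed by the frequencies `(ξ, η)` of `x` and `θ`. -/
def fcoef (φ : ST d → ℂ) (k : (Fin d → ℤ) × (Fin d → ℤ)) : ℂ :=
  UnitAddTorus.mFourierCoeff (descend (unitExt φ)) (Sum.elim k.1 k.2)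

/-- The weight `(1 + |ξ|)(1 + |η|)`. -/
def wt (k : (Fin d → ℤ) × (Fin d → ℤ)) : ℝ := (1 + ‖freq k.1‖) * (1 + ‖freq k.2‖)

/-- The weighted `ℓ¹` norm of the Fourier coefficients. -/
def wnorm (M : ℕ) (φ : ST d → ℂ) : ℝ := ∑' k, ‖fcoef φ k‖ * wt k ^ M

theorem one_le_wt (k : (Fin d → ℤ) × (Fin d → ℤ)) : 1 ≤ wt k :=
  one_le_mul_of_one_le_of_one_le (by linarith [norm_nonneg (freq k.1)])
    (by linarith [norm_nonneg (freq k.2)])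

theorem wt_pos (k : (Fin d → ℤ) × (Fin d → ℤ)) : 0 < wt k := zero_lt_one.trans_le (one_le_wt k)

theorem norm_freq_le {ξ : Fin d → ℤ} {B : ℝ} (hB : 0 ≤ B) (h : ∀ i, ‖ξ i‖ ≤ B) :
    ‖freq ξ‖ ≤ d * B := by
  refine abs_le_of_sq_le_sq' ?_ (by positivity) |>.2
  rw [EuclideanSpace.norm_sq_eq, mul_pow]
  have h1 : ∀ i ∈ Finset.univ, ‖freq ξ i‖ ^ 2 ≤ B ^ 2 := fun i _ => by
    have : ‖freq ξ i‖ = ‖ξ i‖ := by simp [freq, Int.norm_eq_abs]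
    rw [this]
    exact pow_le_pow_left₀ (norm_nonneg _) (h i) 2
  refine (Finset.sum_le_sum h1).trans ?_
  rw [Finset.sum_const, Finset.card_univ, Fintype.card_fin, nsmul_eq_mul]
  gcongr
  exact_mod_cast Nat.le_self_pow two_ne_zero d

theorem wt_le (k : (Fin d → ℤ) × (Fin d → ℤ)) :
    wt k ≤ ((d + 1) * (1 + ‖(Sum.elim k.1 k.2 : Fin d ⊕ Fin d → ℤ)‖)) ^ 2 := by
  set n : Fin d ⊕ Fin d → ℤ := Sum.elim k.1 k.2
  have h1 : ‖freq k.1‖ ≤ d * ‖n‖ :=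
    norm_freq_le (norm_nonneg _) fun i => norm_le_pi_norm n (Sum.inl i)
  have h2 : ‖freq k.2‖ ≤ d * ‖n‖ :=
    norm_freq_le (norm_nonneg _) fun i => norm_le_pi_norm n (Sum.inr i)
  have hd : (0 : ℝ) ≤ d := by positivity
  have hn := norm_nonneg n
  rw [wt, sq]
  gcongr <;> nlinarith

/-- Each factor of `wt` costs two powers of `1 + ‖n‖`, whence `2M` derivatives. The further `2d + 1`
leave a factor summable over a lattice of rank `2d`. -/
theorem exists_norm_fcoef_mul_wt_le (d M : ℕ) [NeZero d] :
    ∃ (N : ℕ) (C : ℝ), 0 ≤ C ∧ ∀ φ ∈ smoothST d, ∀ k, ‖fcoef φ k‖ * wt k ^ M ≤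
      C * cNorm N φ * ((1 + ‖(Sum.elim k.1 k.2 : Fin d ⊕ Fin d → ℤ)‖) ^ (2 * d + 1))⁻¹ := by
  obtain ⟨A, hA, hAb⟩ := exists_norm_iteratedFDeriv_unitExt_le d (2 * M + (2 * d + 1))
  refine ⟨2 * M + (2 * d + 1), ((d : ℝ) + 1) ^ (2 * M) * (2 ^ (2 * M + (2 * d + 1)) * (2 * A)),
    by positivity, fun φ hφ k => ?_⟩
  set n : Fin d ⊕ Fin d → ℤ := Sum.elim k.1 k.2 with hn
  have h1 := one_add_norm_pow_mul_norm_mFourierCoeff_le (intPeriodic_unitExt φ)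
    (contDiff_unitExt hφ) (N := 2 * M + (2 * d + 1)) (fun x => by
      have := hAb φ hφ 0 (Nat.zero_le _) x
      rwa [norm_iteratedFDeriv_zero] at this) (hAb φ hφ _ le_rfl) n
  have hpos : 0 < 1 + ‖n‖ := by positivity
  rw [le_mul_inv_iff₀ (by positivity)]
  calc ‖fcoef φ k‖ * wt k ^ M * (1 + ‖n‖) ^ (2 * d + 1)
      ≤ ‖fcoef φ k‖ * (((d + 1) * (1 + ‖n‖)) ^ 2) ^ M * (1 + ‖n‖) ^ (2 * d + 1) := by
        have := (wt_pos k).le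
        gcongr
        exact wt_le k
    _ = ((d : ℝ) + 1) ^ (2 * M) * ((1 + ‖n‖) ^ (2 * M + (2 * d + 1)) *
          ‖UnitAddTorus.mFourierCoeff (descend (unitExt φ)) n‖) := by
        rw [fcoef, ← hn, ← pow_mul, mul_pow, pow_add (1 + ‖n‖)]; ring
    _ ≤ ((d : ℝ) + 1) ^ (2 * M) *
          (2 ^ (2 * M + (2 * d + 1)) * (2 * (A * cNorm (2 * M + (2 * d + 1)) φ))) := by
        gcongr
    _ = _ := by ring

theorem summable_sumElim_inv (d : ℕ) : Summable fun k : (Fin d → ℤ) × (Fin d → ℤ) =>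
    ((1 + ‖(Sum.elim k.1 k.2 : Fin d ⊕ Fin d → ℤ)‖) ^ (2 * d + 1))⁻¹ := by
  have h := summable_one_add_norm_pow_inv (Fin d ⊕ Fin d) (N := 2 * d + 1)
    (by simp; omega)
  exact (Equiv.sumArrowEquivProdArrow (Fin d) (Fin d) ℤ).symm.summable_iff.2 h

theorem summable_fcoef_mul_wt [NeZero d] {φ : ST d → ℂ} (hφ : φ ∈ smoothST d) (M : ℕ) :
    Summable fun k => ‖fcoef φ k‖ * wt k ^ M := by
  obtain ⟨N, C, -, h⟩ := exists_norm_fcoef_mul_wt_le d M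
  exact Summable.of_nonneg_of_le
    (fun k => mul_nonneg (norm_nonneg _) (pow_nonneg (wt_pos k).le _)) (h φ hφ)
    ((summable_sumElim_inv d).mul_left _)

/-- This converts estimates in Fourier coefficients into bounds by `C^N` norms of the test function,
as required for distributions. -/
theorem exists_wnorm_le (d M : ℕ) [NeZero d] :
    ∃ (N : ℕ) (C : ℝ), 0 ≤ C ∧ ∀ φ ∈ smoothST d, wnorm M φ ≤ C * cNorm N φ := by
  obtain ⟨N, C, hC, h⟩ := exists_norm_fcoef_mul_wt_le d M
  refine ⟨N, C * ∑' k : (Fin d → ℤ) × (Fin d → ℤ),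
    ((1 + ‖(Sum.elim k.1 k.2 : Fin d ⊕ Fin d → ℤ)‖) ^ (2 * d + 1))⁻¹,
    mul_nonneg hC (tsum_nonneg fun k => by positivity), fun φ hφ => ?_⟩
  refine ((summable_fcoef_mul_wt hφ M).tsum_le_tsum (h φ hφ)
    ((summable_sumElim_inv d).mul_left _)).trans_eq ?_
  rw [tsum_mul_left]
  ring

theorem wnorm_nonneg (M : ℕ) (φ : ST d → ℂ) : 0 ≤ wnorm M φ :=
  tsum_nonneg fun k => mul_nonneg (norm_nonneg _) (pow_nonneg (wt_pos k).le _)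

theorem summable_norm_fcoef [NeZero d] {φ : ST d → ℂ} (hφ : φ ∈ smoothST d) :
    Summable fun k => ‖fcoef φ k‖ := by
  simpa using summable_fcoef_mul_wt hφ 0

/-- The plane wave `θ ↦ e^{i η·θ}` on the sphere. -/
def wave (η : Fin d → ℤ) (v : E d) : ℂ := Complex.exp (Complex.I * (inner ℝ (freq η) v : ℝ))

theorem norm_wave (η : Fin d → ℤ) (v : E d) : ‖wave η v‖ = 1 := by
  rw [wave, mul_comm, Complex.norm_exp_ofReal_mul_I]

theorem continuous_wave (η : Fin d → ℤ) : Continuous (wave η : E d → ℂ) := by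
  unfold wave; fun_prop

theorem proj_surjective (x : Torus d) : ∃ y : E d, proj y = x := by
  choose y hy using fun i => QuotientAddGroup.mk_surjective (x i)
  exact ⟨WithLp.toLp 2 y, funext hy⟩

theorem norm_chr (ξ : Fin d → ℤ) (x : Torus d) : ‖chr ξ x‖ = 1 := by
  obtain ⟨y, rfl⟩ := proj_surjective x
  rw [chr_proj, mul_comm, Complex.norm_exp_ofReal_mul_I]

/-- The Fourier series of the periodized extension is restricted to the sphere, where the extension
agrees with `φ`. It writes the dependence on `θ` as a superposition of plane waves. -/
theorem hasSum_fcoef [NeZero d] {φ : ST d → ℂ} (hφ : φ ∈ smoothST d) (x : Torus d) (θ : Sph d) :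
    HasSum (fun k => fcoef φ k * chr k.1 x * wave k.2 (θ : E d)) (φ (x, θ)) := by
  obtain ⟨y, rfl⟩ := proj_surjective x
  have hs : Summable (UnitAddTorus.mFourierCoeff (descend (unitExt φ))) := by
    refine .of_norm ((Equiv.sumArrowEquivProdArrow (Fin d) (Fin d) ℤ).symm.summable_iff.1 ?_)
    exact summable_norm_fcoef hφ
  have h := hasSum_mFourier_of_smooth (intPeriodic_unitExt φ) (contDiff_unitExt hφ) hs
    (Sum.elim (fun i => y i / (2 * π)) (fun i => (θ : E d) i / (2 * π)))
  have hpi : (2 * π) ≠ 0 := Real.two_pi_pos.ne'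
  have hval : unitExt φ (Sum.elim (fun i => y i / (2 * π)) (fun i => (θ : E d) i / (2 * π))) =
      φ (proj y, θ) := by
    rw [← torusExt_sphere φ y θ, unitExt, torusCoord_apply]
    congr 1
    ext i <;> simp <;> field_simp
  rw [hval] at h
  convert (Equiv.sumArrowEquivProdArrow (Fin d) (Fin d) ℤ).symm.hasSum_iff.2 h using 1
  funext k
  rw [chr_proj, wave, mul_assoc, ← Complex.exp_add]
  simp only [Function.comp, fcoef]
  congr 2
  have hpi' : (π : ℂ) ≠ 0 := by exact_mod_cast Real.pi_ne_zero
  have hin : ∀ (ξ : Fin d → ℤ) (z : E d), ((inner ℝ (freq ξ) z : ℝ) : ℂ) =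
      ∑ i, (ξ i : ℂ) * z i := fun ξ z => by
    simp [freq, PiLp.inner_apply, mul_comm]
  rw [hin, hin, Fintype.sum_sum_type, ← mul_add, mul_assoc (2 * (π : ℂ)), mul_comm (2 * (π : ℂ)),
    mul_assoc]
  congr 1
  rw [add_mul, Finset.sum_mul, Finset.sum_mul]
  congr 1 <;> refine Finset.sum_congr rfl fun i _ => ?_
  · simp [Equiv.sumArrowEquivProdArrow]; field_simp
  · simp [Equiv.sumArrowEquivProdArrow]; field_simp

/-! ### Absolutely convergent trigonometric series on the torus -/

theorem hasSum_iff_of_eq {κ : Type*} {f g : κ → ℂ} {s : ℂ} (h : ∀ k, f k = g k) :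
    HasSum f s ↔ HasSum g s := by rw [funext h]

theorem chr_add (ξ η : Fin d → ℤ) (x : Torus d) : chr (ξ + η) x = chr ξ x * chr η x := by
  simp only [chr, Pi.add_apply, fourier_add, Finset.prod_mul_distrib]

theorem chr_neg (ξ : Fin d → ℤ) (x : Torus d) : chr (-ξ) x = conj (chr ξ x) := by
  simp only [chr, Pi.neg_apply, fourier_neg, map_prod]

theorem chr_zero (x : Torus d) : chr 0 x = 1 := by
  simp [chr]

theorem chr_apply_add (ξ : Fin d → ℤ) (x y : Torus d) : chr ξ (x + y) = chr ξ x * chr ξ y := by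
  obtain ⟨x, rfl⟩ := proj_surjective x
  obtain ⟨y, rfl⟩ := proj_surjective y
  have : proj x + proj y = proj (x + y) := by ext i; simp [proj]
  rw [this, chr_proj, chr_proj, chr_proj, ← Complex.exp_add, inner_add_right]
  push_cast
  ring_nf

theorem chr_apply_neg (ξ : Fin d → ℤ) (x : Torus d) : chr ξ (-x) = chr (-ξ) x := by
  obtain ⟨x, rfl⟩ := proj_surjective x
  have h1 : -proj x = proj (-x) := by ext i; simp [proj]
  have h2 : freq (-ξ) = -freq ξ := by ext i; simp [freq]
  rw [h1, chr_proj, chr_proj, h2, inner_neg_left, inner_neg_right]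

theorem freq_neg (ξ : Fin d → ℤ) : freq (-ξ) = -freq ξ := by ext i; simp [freq]

theorem continuous_chr (ξ : Fin d → ℤ) : Continuous (chr ξ : Torus d → ℂ) :=
  continuous_finsetProd _ fun i _ => (fourier (ξ i)).continuous.comp (continuous_apply i)

theorem integral_chr (ξ : Fin d → ℤ) :
    ∫ x : Torus d, chr ξ x = if ξ = 0 then (((2 * π) ^ d : ℝ) : ℂ) else 0 := by
  have h1 : ∀ n : ℤ, ∫ x : AddCircle (2 * π), fourier n x = if n = 0 then ((2 * π : ℝ) : ℂ) else 0 := by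
    intro n
    split_ifs with hn
    · subst hn
      simp only [fourier_zero, integral_const]
      rw [Measure.real, AddCircle.measure_univ, ENNReal.toReal_ofReal Real.two_pi_pos.le]
      simp
    · exact integral_eq_zero_of_add_right_eq_neg (fourier_add_half_inv_index hn Real.two_pi_pos)
  have h2 : ∫ x : Torus d, chr ξ x = ∏ i, ∫ x : AddCircle (2 * π), fourier (ξ i) x :=
    integral_fintype_prod_volume_eq_prod fun i (x : AddCircle (2 * π)) => fourier (ξ i) x
  rw [h2]
  simp only [h1]
  split_ifs with h
  · subst h; simp
  · obtain ⟨i, hi⟩ := Function.ne_iff.1 h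
    exact Finset.prod_eq_zero (Finset.mem_univ i) (if_neg hi)

theorem integrable_of_continuous_torus {f : Torus d → ℂ} (hf : Continuous f) : Integrable f :=
  hf.integrable_of_hasCompactSupport (HasCompactSupport.of_compactSpace f)

section Series

variable {κ : Type*} {ξ : κ → Fin d → ℤ} {a : κ → ℂ} {f : Torus d → ℂ}

theorem norm_mul_chr (c : ℂ) (ξ : Fin d → ℤ) (x : Torus d) : ‖c * chr ξ x‖ = ‖c‖ := by
  rw [norm_mul, norm_chr, mul_one]

theorem continuous_of_hasSum_chr (ha : Summable fun k => ‖a k‖)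
    (hf : ∀ x, HasSum (fun k => a k * chr (ξ k) x) (f x)) : Continuous f := by
  have : f = fun x => ∑' k, a k * chr (ξ k) x := funext fun x => (hf x).tsum_eq.symm
  rw [this]
  exact continuous_tsum (fun k => continuous_const.mul (continuous_chr _)) ha
    fun k x => (norm_mul_chr _ _ _).le

theorem hasSum_integral_mul_chr [Countable κ] (ha : Summable fun k => ‖a k‖)
    (hf : ∀ x, HasSum (fun k => a k * chr (ξ k) x) (f x)) (η : Fin d → ℤ) :
    HasSum (fun k => if ξ k + η = 0 then (((2 * π) ^ d : ℝ) : ℂ) * a k else 0)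
      (∫ x, f x * chr η x) := by
  have hF : ∀ k x, a k * chr (ξ k) x * chr η x = a k * chr (ξ k + η) x := fun k x => by
    rw [chr_add, mul_assoc]
  have h := hasSum_integral_of_summable_integral_norm
    (μ := (volume : Measure (Torus d))) (F := fun k x => a k * chr (ξ k) x * chr η x)
    (fun k => integrable_of_continuous_torus
      ((continuous_const.mul (continuous_chr _)).mul (continuous_chr _)))
    (by
      simp only [hF, norm_mul_chr, integral_const]
      exact ha.mul_left _)
  have h2 : (fun x => f x * chr η x) = fun x => ∑' k, a k * chr (ξ k) x * chr η x :=
    funext fun x => ((hf x).mul_right (chr η x)).tsum_eq.symm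
  rw [h2]
  refine (hasSum_iff_of_eq fun k => ?_).2 h
  simp only [hF, integral_const_mul, integral_chr]
  split_ifs <;> simp [mul_comm]

theorem hasSum_coef [Countable κ] (ha : Summable fun k => ‖a k‖)
    (hf : ∀ x, HasSum (fun k => a k * chr (ξ k) x) (f x)) (η : Fin d → ℤ) :
    HasSum (fun k => if ξ k = η then a k else 0) (coef f η) := by
  have h := (hasSum_integral_mul_chr ha hf (-η)).mul_left ((((2 * π : ℝ) ^ d : ℝ) : ℂ)⁻¹)
  have hc : coef f η = (((2 * π : ℝ) ^ d : ℝ) : ℂ)⁻¹ * ∫ x, f x * chr (-η) x := by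
    simp only [coef, chr_neg]
    push_cast; rfl
  rw [hc]
  have hp : (((2 * π : ℝ) ^ d : ℝ) : ℂ) ≠ 0 := by
    exact_mod_cast (pow_pos Real.two_pi_pos d).ne'
  refine (hasSum_iff_of_eq fun k => ?_).2 h
  simp only [add_neg_eq_zero]
  split_ifs
  · rw [inv_mul_cancel_left₀ hp]
  · simp

theorem coef_eq_of_injective [Countable κ] (hξ : Function.Injective ξ)
    (ha : Summable fun k => ‖a k‖)
    (hf : ∀ x, HasSum (fun k => a k * chr (ξ k) x) (f x)) (k : κ) : coef f (ξ k) = a k := by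
  classical
  have h := hasSum_coef ha hf (ξ k)
  simp only [hξ.eq_iff] at h
  refine h.unique ((hasSum_iff_of_eq fun j => ?_).1 (hasSum_ite_eq k (a k)))
  split_ifs with hj
  · rw [hj]
  · rfl

/-! ### Rapidly decaying coefficients and smoothness -/

theorem norm_iteratedDeriv_exp_I_mul (n : ℕ) (t : ℝ) :
    ‖iteratedDeriv n (fun t : ℝ => Complex.exp (Complex.I * t)) t‖ = 1 := by
  have h : ∀ n : ℕ, iteratedDeriv n (fun t : ℝ => Complex.exp (Complex.I * t)) =
      fun t : ℝ => Complex.I ^ n * Complex.exp (Complex.I * t) := by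
    intro n
    induction n with
    | zero => simp
    | succ n ih =>
      rw [iteratedDeriv_succ, ih]
      funext t
      have h1 : HasDerivAt (fun t : ℝ => Complex.I * (t : ℂ)) Complex.I t := by
        simpa using (Complex.ofRealCLM.hasDerivAt (x := t)).const_mul Complex.I
      rw [(h1.cexp.const_mul (Complex.I ^ n)).deriv]
      ring
  rw [h, norm_mul, norm_pow, Complex.norm_I, one_pow, one_mul, mul_comm,
    Complex.norm_exp_ofReal_mul_I]

theorem contDiff_chr_proj (ξ : Fin d → ℤ) : ContDiff ℝ ∞ fun y : E d => chr ξ (proj y) := by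
  simp only [chr_proj]
  exact (contDiff_const.mul (Complex.ofRealCLM.contDiff.comp
    (contDiff_const.inner ℝ contDiff_id))).cexp

theorem norm_iteratedFDeriv_chr_proj_le (ξ : Fin d → ℤ) (n : ℕ) (y : E d) :
    ‖iteratedFDeriv ℝ n (fun y : E d => chr ξ (proj y)) y‖ ≤ ‖freq ξ‖ ^ n := by
  have hE : ContDiff ℝ ∞ fun t : ℝ => Complex.exp (Complex.I * t) :=
    (contDiff_const.mul Complex.ofRealCLM.contDiff).cexp
  have h := (innerSL ℝ (freq ξ)).iteratedFDeriv_comp_right hE y (i := n) (by exact_mod_cast le_top)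
  have h2 : (fun t : ℝ => Complex.exp (Complex.I * t)) ∘ (innerSL ℝ (freq ξ)) =
      fun y : E d => chr ξ (proj y) := funext fun y => by
    rw [chr_proj]; rfl
  rw [h2] at h
  rw [h]
  refine (ContinuousMultilinearMap.norm_compContinuousLinearMap_le _ _).trans ?_
  rw [norm_iteratedFDeriv_eq_norm_iteratedDeriv, norm_iteratedDeriv_exp_I_mul, one_mul,
    Finset.prod_const, Finset.card_univ, Fintype.card_fin, innerSL_apply_norm]

/-- A family of coefficients `a k` of the characters of frequency `ξ k` is rapidly decaying. -/
def RapidDecay (ξ : κ → Fin d → ℤ) (a : κ → ℂ) : Prop :=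
  ∀ M : ℕ, Summable fun k => ‖a k‖ * (1 + ‖freq (ξ k)‖) ^ M

theorem RapidDecay.summable (ha : RapidDecay ξ a) : Summable fun k => ‖a k‖ := by
  simpa using ha 0

theorem RapidDecay.mem_smoothT (ha : RapidDecay ξ a) :
    (fun x => ∑' k, a k * chr (ξ k) x) ∈ smoothT d := by
  rw [TorusFlow.mem_smoothT]
  refine contDiff_tsum (N := ⊤) (v := fun n k => ‖a k‖ * (1 + ‖freq (ξ k)‖) ^ n)
    (fun k => contDiff_const.mul (contDiff_chr_proj _)) (fun n _ => ha n) fun n k x _ => ?_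
  have h1 : (fun y : E d => a k * chr (ξ k) (proj y)) =
    a k • fun y : E d => chr (ξ k) (proj y) := rfl
  rw [h1, iteratedFDeriv_const_smul_apply
    (((contDiff_chr_proj (ξ k)).contDiffAt).of_le (by exact_mod_cast le_top)), norm_smul]
  gcongr
  exact (norm_iteratedFDeriv_chr_proj_le _ _ _).trans
    (pow_le_pow_left₀ (norm_nonneg _) (by linarith) _)

theorem RapidDecay.hasSum (ha : RapidDecay ξ a) (x : Torus d) :
    HasSum (fun k => a k * chr (ξ k) x) (∑' k, a k * chr (ξ k) x) := by
  refine (Summable.of_norm ?_).hasSum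
  simpa only [norm_mul_chr] using ha.summable

end Series

/-! ### Fourier coefficients in the base variable -/

/-- The `ℓ¹` norm, in the fibre frequency, of the Fourier coefficients of base frequency `ξ`. -/
def fibreNorm (φ : ST d → ℂ) (ξ : Fin d → ℤ) : ℝ := ∑' η, ‖fcoef φ (ξ, η)‖

theorem norm_fcoef_mul_wave_mul_chr (φ : ST d → ℂ) (k : (Fin d → ℤ) × (Fin d → ℤ)) (x : Torus d)
    (v : E d) : ‖fcoef φ k * chr k.1 x * wave k.2 v‖ = ‖fcoef φ k‖ := by
  rw [norm_mul, norm_wave, mul_one, norm_mul_chr]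

theorem fibreNorm_nonneg (φ : ST d → ℂ) (ξ : Fin d → ℤ) : 0 ≤ fibreNorm φ ξ :=
  tsum_nonneg fun _ => norm_nonneg _

theorem one_le_norm_freq {ξ : Fin d → ℤ} (hξ : ξ ≠ 0) : 1 ≤ ‖freq ξ‖ := by
  obtain ⟨i, hi⟩ := Function.ne_iff.1 hξ
  refine le_trans ?_ (PiLp.norm_apply_le (freq ξ) i)
  have h : ‖freq ξ i‖ = |(ξ i : ℝ)| := rfl
  rw [h]
  exact_mod_cast Int.one_le_abs hi

theorem neg_val_injective : Function.Injective fun ξ : Freq d => -ξ.1 :=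
  neg_injective.comp Subtype.val_injective

/-- The kernel `e^{i(y-x)·ξ}` selects the frequency `-ξ`, while the direction remains `εξ/|ξ|`; this
sign is what distinguishes `Pop` from `Pi0`. -/
theorem Pop_eq (ε : ℤˣ) (ψ : ST d → ℂ) :
    Pop ε ψ = fun x => ∑' ξ : Freq d, pcoef ψ (-ξ.1) (dir ε ξ) * chr (-ξ.1) x := by
  funext x
  refine tsum_congr fun ξ => ?_
  have h : ∀ y, ψ (y, dir ε ξ) * chr ξ.1 (y - x) =
      ψ (y, dir ε ξ) * conj (chr (-ξ.1) y) * chr (-ξ.1) x := fun y => by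
    rw [sub_eq_add_neg, chr_apply_add, chr_apply_neg, ← chr_neg, neg_neg, mul_assoc]
  simp only [h, integral_mul_const]
  rw [← mul_assoc]
  simp [pcoef, coef]

/-- The coefficient of `f` at `-ξ` meets that of `φ` at `ξ`, since the pairing is bilinear. -/
theorem PdagTerm_eq (ε : ℤˣ) (f : Torus d → ℂ) (φ : ST d → ℂ) (ξ : Freq d) :
    PdagTerm ε f φ ξ = (((2 * π) ^ d : ℝ) : ℂ) * coef f (-ξ.1) * pcoef φ ξ.1 (dir ε ξ) := by
  have h : ∀ x y, f y * chr ξ.1 (y - x) =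
      f y * conj (chr (-ξ.1) y) * chr (-ξ.1) x := fun x y => by
    rw [sub_eq_add_neg, chr_apply_add, chr_apply_neg, ← chr_neg, neg_neg, mul_assoc]
  have hp : (((2 * π : ℝ) ^ d : ℝ) : ℂ) ≠ 0 := by
    exact_mod_cast (pow_pos Real.two_pi_pos d).ne'
  have h2 : ∀ x, (((2 * π : ℝ) ^ d : ℝ)⁻¹ * ∫ y, f y * chr ξ.1 (y - x)) * φ (x, dir ε ξ) =
      coef f (-ξ.1) * (φ (x, dir ε ξ) * conj (chr ξ.1 x)) := fun x => by
    simp only [h, integral_mul_const, coef]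
    rw [← chr_neg]
    ring
  rw [PdagTerm]
  simp only [h2, integral_const_mul, pcoef]
  rw [coef, coef]
  push_cast at hp ⊢
  field_simp

theorem pcoef_smul (c : ℂ) (φ : ST d → ℂ) (ξ : Fin d → ℤ) (θ : Sph d) :
    pcoef (c • φ) ξ θ = c * pcoef φ ξ θ := by
  simp only [pcoef, coef, Pi.smul_apply, smul_eq_mul, mul_assoc, integral_const_mul]
  ring

section Smooth

variable [NeZero d] {φ : ST d → ℂ}

theorem continuous_of_mem_smoothST (hφ : φ ∈ smoothST d) : Continuous φ := by
  have : φ = fun p : ST d => ∑' k, fcoef φ k * chr k.1 p.1 * wave k.2 (p.2 : E d) :=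
    funext fun p => (hasSum_fcoef hφ p.1 p.2).tsum_eq.symm
  rw [this]
  exact continuous_tsum (fun k => (continuous_const.mul ((continuous_chr _).comp continuous_fst)).mul
    ((continuous_wave _).comp (continuous_subtype_val.comp continuous_snd)))
    (summable_norm_fcoef hφ) fun k p => (norm_fcoef_mul_wave_mul_chr _ _ _ _).le

theorem summable_norm_fcoef_fibre (hφ : φ ∈ smoothST d) (ξ : Fin d → ℤ) :
    Summable fun η => ‖fcoef φ (ξ, η)‖ :=
  (summable_norm_fcoef hφ).prod_factor ξ

/-- Integrating the double series in `x` against a character keeps the terms of base frequency `ξ`.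
-/
theorem hasSum_pcoef (hφ : φ ∈ smoothST d) (ξ : Fin d → ℤ) (θ : Sph d) :
    HasSum (fun η => fcoef φ (ξ, η) * wave η (θ : E d)) (pcoef φ ξ θ) := by
  have h := hasSum_coef (ξ := Prod.fst) (a := fun k => fcoef φ k * wave k.2 (θ : E d))
    (f := fun x => φ (x, θ)) (by
      simpa only [norm_mul, norm_wave, mul_one] using summable_norm_fcoef hφ)
    (fun x => (hasSum_iff_of_eq fun k => by ring).1 (hasSum_fcoef hφ x θ)) ξ
  have hinj : Function.Injective fun η : Fin d → ℤ => (ξ, η) := fun _ _ h => (Prod.mk.inj h).2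
  rw [← hinj.hasSum_iff] at h
  · simp only [Function.comp_def, if_true] at h
    exact h
  · rintro ⟨ξ', η⟩ hk
    rw [if_neg]
    rintro rfl
    exact hk ⟨η, rfl⟩

theorem norm_pcoef_le (hφ : φ ∈ smoothST d) (ξ : Fin d → ℤ) (θ : Sph d) :
    ‖pcoef φ ξ θ‖ ≤ fibreNorm φ ξ := by
  rw [← (hasSum_pcoef hφ ξ θ).tsum_eq]
  have h : ∀ η, ‖fcoef φ (ξ, η) * wave η (θ : E d)‖ = ‖fcoef φ (ξ, η)‖ := fun η => by
    rw [norm_mul, norm_wave, mul_one]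
  refine (norm_tsum_le_tsum_norm ?_).trans_eq ?_ <;> simp only [h]
  · exact summable_norm_fcoef_fibre hφ ξ
  · rfl

theorem summable_fibreNorm_mul (hφ : φ ∈ smoothST d) (M : ℕ) :
    Summable fun ξ => fibreNorm φ ξ * (1 + ‖freq ξ‖) ^ M := by
  have h : Summable fun k : (Fin d → ℤ) × (Fin d → ℤ) => ‖fcoef φ k‖ * (1 + ‖freq k.1‖) ^ M := by
    refine Summable.of_nonneg_of_le (fun k => by positivity) (fun k => ?_)
      (summable_fcoef_mul_wt hφ M)
    gcongr
    exact le_mul_of_one_le_right (by positivity) (by linarith [norm_nonneg (freq k.2)])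
  have h2 := h.prod
  simp only [tsum_mul_right] at h2
  exact h2

theorem summable_fibreNorm (hφ : φ ∈ smoothST d) : Summable fun ξ => fibreNorm φ ξ := by
  simpa using summable_fibreNorm_mul hφ 0

theorem tsum_fibreNorm (hφ : φ ∈ smoothST d) : ∑' ξ, fibreNorm φ ξ = wnorm 0 φ := by
  simp only [wnorm, pow_zero, mul_one]
  exact (summable_norm_fcoef hφ).tsum_prod.symm

theorem norm_pcoef_le_wnorm (hφ : φ ∈ smoothST d) (ξ : Fin d → ℤ) (θ : Sph d) :
    ‖pcoef φ ξ θ‖ ≤ wnorm 0 φ := by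
  refine (norm_pcoef_le hφ ξ θ).trans ?_
  rw [← tsum_fibreNorm hφ]
  exact (summable_fibreNorm hφ).le_tsum ξ fun _ _ => fibreNorm_nonneg _ _

theorem rapidDecay_pcoef {κ : Type*} {ξ : κ → Fin d → ℤ} (hξ : Function.Injective ξ)
    (hφ : φ ∈ smoothST d) (θ : κ → Sph d) : RapidDecay ξ fun k => pcoef φ (ξ k) (θ k) := fun M =>
  Summable.of_nonneg_of_le (fun k => by positivity)
    (fun k => mul_le_mul_of_nonneg_right (norm_pcoef_le hφ _ _) (by positivity))
    ((summable_fibreNorm_mul hφ M).comp_injective hξ)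

theorem hasSum_pcoef_mul_chr (hφ : φ ∈ smoothST d) (x : Torus d) (θ : Sph d) :
    HasSum (fun ξ => pcoef φ ξ θ * chr ξ x) (φ (x, θ)) := by
  refine (hasSum_fcoef hφ x θ).prod_fiberwise fun ξ => ?_
  exact (hasSum_iff_of_eq fun η => by ring).1 ((hasSum_pcoef hφ ξ θ).mul_right (chr ξ x))

/-- A function on the torus is a function on `S𝕋^d` constant in `θ`, so it inherits the decay and
convergence of Fourier coefficients proved there. -/
theorem fst_mem_smoothST {f : Torus d → ℂ} (hf : f ∈ smoothT d) :
    (fun p : ST d => f p.1) ∈ smoothST d := by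
  rw [mem_smoothST]
  exact (mem_smoothT.1 hf).contMDiff.comp contMDiff_fst

theorem exists_sph (d : ℕ) [NeZero d] : Nonempty (Sph d) :=
  ⟨⟨EuclideanSpace.single 0 1, by simp⟩⟩

theorem rapidDecay_coef {f : Torus d → ℂ} (hf : f ∈ smoothT d) :
    RapidDecay (fun ξ => ξ) (coef f) := by
  obtain ⟨θ⟩ := exists_sph d
  exact rapidDecay_pcoef Function.injective_id (fst_mem_smoothST hf) fun _ => θ

theorem hasSum_coef_mul_chr {f : Torus d → ℂ} (hf : f ∈ smoothT d) (x : Torus d) :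
    HasSum (fun ξ => coef f ξ * chr ξ x) (f x) := by
  obtain ⟨θ⟩ := exists_sph d
  exact hasSum_pcoef_mul_chr (fst_mem_smoothST hf) x θ

/-! ### The operators of the expansion -/

theorem Pi0_mem_smoothT (hφ : φ ∈ smoothST d) (ε : ℤˣ) : Pi0 ε φ ∈ smoothT d :=
  (rapidDecay_pcoef (ξ := fun ξ : Freq d => ξ.1) Subtype.val_injective hφ (dir ε)).mem_smoothT

theorem Pop_mem_smoothT (hφ : φ ∈ smoothST d) (ε : ℤˣ) : Pop ε φ ∈ smoothT d := by
  rw [Pop_eq]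
  exact (rapidDecay_pcoef neg_val_injective hφ (dir ε)).mem_smoothT

/-- Nonzero integer frequencies have norm at least `1`, so the multiplier is evaluated only where it
is bounded. -/
theorem rapidDecay_mul_coef {m : ℝ → ℂ} (hm : ∀ r, 1 ≤ r → ‖m r‖ ≤ 1) {f : Torus d → ℂ}
    (hf : f ∈ smoothT d) :
    RapidDecay (fun ξ : Freq d => ξ.1) fun ξ => m ‖freq ξ.1‖ * coef f ξ.1 := fun M => by
  refine Summable.of_nonneg_of_le (fun k => by positivity) (fun ξ => ?_)
    ((rapidDecay_coef hf M).comp_injective Subtype.val_injective)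
  simp only [Function.comp, norm_mul]
  gcongr
  exact mul_le_of_le_one_left (norm_nonneg _) (hm _ (one_le_norm_freq ξ.2))

theorem sqrtLapFun_mem_smoothT {m : ℝ → ℂ} (hm : ∀ r, 1 ≤ r → ‖m r‖ ≤ 1) {f : Torus d → ℂ}
    (hf : f ∈ smoothT d) : sqrtLapFun m f ∈ smoothT d :=
  (rapidDecay_mul_coef hm hf).mem_smoothT

theorem half_sub_one_nonneg (d : ℕ) [NeZero d] : 0 ≤ ((d : ℝ) - 1) / 2 := by
  have : (1 : ℝ) ≤ d := by exact_mod_cast NeZero.one_le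
  linarith

theorem norm_halfWave_le_one (d : ℕ) [NeZero d] (ε : ℤˣ) (t : ℝ) {r : ℝ} (hr : 1 ≤ r) :
    ‖halfWave d ε t r‖ ≤ 1 := by
  have h := norm_exp_units_mul_I ε (t * r)
  rw [halfWave, norm_div, Complex.norm_real, Real.norm_of_nonneg (by positivity),
    mul_assoc _ (t : ℂ), ← Complex.ofReal_mul, h]
  exact div_le_one_of_le₀ (Real.one_le_rpow hr (half_sub_one_nonneg d)) (by positivity)

theorem shiftedHalfWave_eq (d : ℕ) (ε : ℤˣ) (t : ℝ) {r : ℝ} (hr : 0 ≤ r) :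
    shiftedHalfWave d ε t r = polePhase d ε * halfWave d ε t r := by
  have h1 : (r ^ 2) ^ (((d : ℝ) - 1) / 4) = r ^ (((d : ℝ) - 1) / 2) := by
    rw [← Real.rpow_natCast_mul hr]
    congr 1
    push_cast
    ring
  rw [shiftedHalfWave, halfWave, polePhase, h1, ← mul_div_assoc, ← Complex.exp_add]
  congr 2
  ring

theorem norm_shiftedHalfWave_le_one (d : ℕ) [NeZero d] (ε : ℤˣ) (t : ℝ) {r : ℝ} (hr : 1 ≤ r) :
    ‖shiftedHalfWave d ε t r‖ ≤ 1 := by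
  rw [shiftedHalfWave_eq d ε t (by linarith), norm_mul, norm_polePhase, one_mul]
  exact norm_halfWave_le_one d ε t hr

theorem summable_norm_PdagTerm_and_tsum_le {f : Torus d → ℂ} (hf : f ∈ smoothT d)
    (hφ : φ ∈ smoothST d) (ε : ℤˣ) :
    (Summable fun ξ => ‖PdagTerm ε f φ ξ‖) ∧ ∑' ξ, ‖PdagTerm ε f φ ξ‖ ≤
      (2 * π) ^ d * (∑' ξ : Freq d, ‖coef f (-ξ.1)‖) * wnorm 0 φ := by
  have hs : Summable fun ξ : Freq d => ‖coef f (-ξ.1)‖ :=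
    (rapidDecay_coef hf).summable.comp_injective neg_val_injective
  have hle : ∀ ξ : Freq d, ‖PdagTerm ε f φ ξ‖ ≤ (2 * π) ^ d * ‖coef f (-ξ.1)‖ * wnorm 0 φ :=
    fun ξ => by
      rw [PdagTerm_eq, norm_mul, norm_mul, Complex.norm_real, Real.norm_of_nonneg (by positivity)]
      gcongr
      exact norm_pcoef_le_wnorm hφ _ _
  have hs2 := (hs.mul_left ((2 * π) ^ d)).mul_right (wnorm 0 φ)
  have hs3 := Summable.of_nonneg_of_le (fun ξ => norm_nonneg _) hle hs2
  refine ⟨hs3, (hs3.tsum_le_tsum hle hs2).trans_eq ?_⟩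
  rw [tsum_mul_right, tsum_mul_left]

theorem pcoef_add {φ₁ φ₂ : ST d → ℂ} (h₁ : φ₁ ∈ smoothST d) (h₂ : φ₂ ∈ smoothST d)
    (ξ : Fin d → ℤ) (θ : Sph d) : pcoef (φ₁ + φ₂) ξ θ = pcoef φ₁ ξ θ + pcoef φ₂ ξ θ := by
  have hc : ∀ {φ : ST d → ℂ}, φ ∈ smoothST d →
      Integrable fun x : Torus d => φ (x, θ) * conj (chr ξ x) := fun h =>
    integrable_of_continuous_torus (((continuous_of_mem_smoothST h).comp
      (by fun_prop)).mul (Complex.continuous_conj.comp (continuous_chr ξ)))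
  simp only [pcoef, coef, Pi.add_apply, add_mul]
  rw [integral_add (hc h₁) (hc h₂), mul_add]

theorem isDistribution_Pdag {f : Torus d → ℂ} (hf : f ∈ smoothT d) (ε : ℤˣ) :
    IsDistribution (Pdag ε f) := by
  have hs : ∀ φ : smoothST d, Summable (PdagTerm ε f φ.1) := fun φ =>
    .of_norm (summable_norm_PdagTerm_and_tsum_le hf φ.2 ε).1
  refine ⟨⟨fun φ₁ φ₂ => ?_, fun c φ => ?_⟩, ?_⟩
  · simp only [Pdag]
    rw [← (hs φ₁).tsum_add (hs φ₂)]
    refine tsum_congr fun ξ => ?_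
    simp only [PdagTerm_eq, Submodule.coe_add, pcoef_add φ₁.2 φ₂.2]
    ring
  · simp only [Pdag, smul_eq_mul]
    rw [← tsum_mul_left]
    refine tsum_congr fun ξ => ?_
    simp only [PdagTerm_eq, Submodule.coe_smul, pcoef_smul]
    ring
  · obtain ⟨N, C, -, hC⟩ := exists_wnorm_le d 0
    set A := (2 * π) ^ d * (∑' ξ : Freq d, ‖coef f (-ξ.1)‖)
    have hA : 0 ≤ A := mul_nonneg (by positivity) (tsum_nonneg fun _ => norm_nonneg _)
    refine ⟨N, A * C, fun φ => ?_⟩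
    have h := summable_norm_PdagTerm_and_tsum_le hf φ.2 ε
    exact (norm_tsum_le_tsum_norm h.1).trans (h.2.trans
      ((mul_le_mul_of_nonneg_left (hC φ.1 φ.2) hA).trans_eq (mul_assoc _ _ _).symm))

end Smooth

/-! ### The bilinear correlation form -/

theorem integral_chr_mul (g : Torus d → ℂ) (ξ : Fin d → ℤ) :
    ∫ x, chr ξ x * g x = (((2 * π) ^ d : ℝ) : ℂ) * coef g (-ξ) := by
  have hp : (((2 * π : ℝ) ^ d : ℝ) : ℂ) ≠ 0 := by
    exact_mod_cast (pow_pos Real.two_pi_pos d).ne'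
  simp only [coef, ← chr_neg, neg_neg]
  push_cast at hp ⊢
  rw [mul_inv_cancel_left₀ hp]
  simp only [mul_comm]

theorem hasSum_integral_mul {κ : Type*} [Countable κ] {ξ : κ → Fin d → ℤ} {a : κ → ℂ}
    {f g : Torus d → ℂ} (ha : Summable fun k => ‖a k‖)
    (hf : ∀ x, HasSum (fun k => a k * chr (ξ k) x) (f x)) (hg : Continuous g) :
    HasSum (fun k => (((2 * π) ^ d : ℝ) : ℂ) * (a k * coef g (-ξ k))) (∫ x, f x * g x) := by
  have h := hasSum_integral_of_summable_integral_norm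
    (μ := (volume : Measure (Torus d))) (F := fun k x => a k * chr (ξ k) x * g x)
    (fun k => integrable_of_continuous_torus ((continuous_const.mul (continuous_chr _)).mul hg))
    (by
      simp only [norm_mul, norm_chr, mul_one, integral_const_mul]
      exact ha.mul_right _)
  have h2 : (fun x => f x * g x) = fun x => ∑' k, a k * chr (ξ k) x * g x :=
    funext fun x => ((hf x).mul_right (g x)).tsum_eq.symm
  rw [h2]
  refine (hasSum_iff_of_eq fun k => ?_).2 h
  simp only [mul_assoc, integral_const_mul, integral_chr_mul]
  ring

/-- The bilinear form `∫ φ(x + tθ, θ) ψ(x, θ) dL`. -/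
def corr (φ ψ : ST d → ℂ) (t : ℝ) : ℂ := ∫ p, φ (flow t p) * ψ p ∂(liouville d)

/-- The contribution of the frequencies `ξ` and `-ξ` to the correlation form. -/
def corrMode (φ ψ : ST d → ℂ) (ξ : Fin d → ℤ) (t : ℝ) : ℂ :=
  ∫ θ : Sph d, pcoef φ ξ θ * pcoef ψ (-ξ) θ *
    Complex.exp (Complex.I * (inner ℝ (t • freq ξ) (θ : E d) : ℝ)) ∂(sphVol d)

/-- The weighted `ℓ¹` norm, in the fibre frequency, of the Fourier coefficients of base
frequency `ξ`. -/
def fibreWt (M : ℕ) (φ : ST d → ℂ) (ξ : Fin d → ℤ) : ℝ :=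
  ∑' η, ‖fcoef φ (ξ, η)‖ * (1 + ‖freq η‖) ^ M

theorem fibreWt_nonneg (M : ℕ) (φ : ST d → ℂ) (ξ : Fin d → ℤ) : 0 ≤ fibreWt M φ ξ :=
  tsum_nonneg fun _ => by positivity

instance liouvilleFinite (d : ℕ) : IsFiniteMeasure (liouville d) := by
  unfold liouville; infer_instance

theorem integrable_of_continuous_sph {f : Sph d → ℂ} (hf : Continuous f) :
    Integrable f (sphVol d) :=
  hf.integrable_of_hasCompactSupport (HasCompactSupport.of_compactSpace f)

theorem integrable_of_continuous_ST {f : ST d → ℂ} (hf : Continuous f) :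
    Integrable f (liouville d) :=
  hf.integrable_of_hasCompactSupport (HasCompactSupport.of_compactSpace f)

theorem continuous_proj : Continuous (proj : E d → Torus d) :=
  continuous_pi fun i => (AddCircle.continuous_mk' _).comp (by fun_prop)

theorem continuous_flow (t : ℝ) : Continuous (flow t : ST d → ST d) :=
  (continuous_fst.add (continuous_proj.comp
    ((continuous_subtype_val.comp continuous_snd).const_smul t))).prodMk continuous_snd

section Smooth

variable [NeZero d] {φ ψ : ST d → ℂ}

theorem summable_weighted (hφ : φ ∈ smoothST d) (M : ℕ) :
    Summable fun k : (Fin d → ℤ) × (Fin d → ℤ) => ‖fcoef φ k‖ * (1 + ‖freq k.2‖) ^ M := by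
  refine Summable.of_nonneg_of_le (fun k => by positivity) (fun k => ?_)
    (summable_fcoef_mul_wt hφ M)
  gcongr
  exact le_mul_of_one_le_left (by positivity) (by linarith [norm_nonneg (freq k.1)])

theorem summable_fibreWt (hφ : φ ∈ smoothST d) (M : ℕ) : Summable fun ξ => fibreWt M φ ξ :=
  (summable_weighted hφ M).prod

theorem summable_weighted_fibre (hφ : φ ∈ smoothST d) (M : ℕ) (ξ : Fin d → ℤ) :
    Summable fun η => ‖fcoef φ (ξ, η)‖ * (1 + ‖freq η‖) ^ M :=
  (summable_weighted hφ M).prod_factor ξ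

theorem tsum_fibreWt_le (hφ : φ ∈ smoothST d) (M : ℕ) : ∑' ξ, fibreWt M φ ξ ≤ wnorm M φ := by
  have h : ∑' ξ, fibreWt M φ ξ =
      ∑' k : (Fin d → ℤ) × (Fin d → ℤ), ‖fcoef φ k‖ * (1 + ‖freq k.2‖) ^ M :=
    (summable_weighted hφ M).tsum_prod.symm
  rw [h]
  refine (summable_weighted hφ M).tsum_le_tsum (fun k => ?_) (summable_fcoef_mul_wt hφ M)
  gcongr
  exact le_mul_of_one_le_left (by positivity) (by linarith [norm_nonneg (freq k.1)])

theorem fibreWt_le (hφ : φ ∈ smoothST d) (M : ℕ) (ξ : Fin d → ℤ) : fibreWt M φ ξ ≤ wnorm M φ :=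
  ((summable_fibreWt hφ M).le_tsum ξ fun _ _ => fibreWt_nonneg _ _ _).trans (tsum_fibreWt_le hφ M)

theorem continuous_pcoef (hφ : φ ∈ smoothST d) (ξ : Fin d → ℤ) : Continuous (pcoef φ ξ) := by
  have : pcoef φ ξ = fun θ : Sph d => ∑' η, fcoef φ (ξ, η) * wave η (θ : E d) :=
    funext fun θ => (hasSum_pcoef hφ ξ θ).tsum_eq.symm
  rw [this]
  exact continuous_tsum (fun η => continuous_const.mul
    ((continuous_wave _).comp continuous_subtype_val)) (summable_norm_fcoef_fibre hφ ξ)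
    fun η θ => by rw [norm_mul, norm_wave, mul_one]

/-- For fixed `θ` the flow is the translation by `tθ`, which multiplies the mode `ξ` by `e^{itξ·θ}`;
then apply Parseval in bilinear form. -/
theorem hasSum_integral_flow (hφ : φ ∈ smoothST d) (hψ : ψ ∈ smoothST d) (t : ℝ) (θ : Sph d) :
    HasSum (fun ξ => (((2 * π) ^ d : ℝ) : ℂ) * (pcoef φ ξ θ * pcoef ψ (-ξ) θ *
      Complex.exp (Complex.I * (inner ℝ (t • freq ξ) (θ : E d) : ℝ))))
      (∫ x, φ (flow t (x, θ)) * ψ (x, θ)) := by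
  have hr := rapidDecay_pcoef (ξ := fun ξ => ξ) Function.injective_id hφ fun _ => θ
  have h := hasSum_integral_mul (ξ := fun ξ => ξ)
    (a := fun ξ => pcoef φ ξ θ * chr ξ (proj (t • (θ : E d))))
    (f := fun x => φ (flow t (x, θ))) (g := fun x => ψ (x, θ))
    (by simpa only [norm_mul_chr] using hr.summable)
    (fun x => (hasSum_iff_of_eq fun ξ => by rw [chr_apply_add]; ring).1
      (hasSum_pcoef_mul_chr hφ (x + proj (t • (θ : E d))) θ))
    ((continuous_of_mem_smoothST hψ).comp (by fun_prop))
  refine (hasSum_iff_of_eq fun ξ => ?_).1 h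
  rw [chr_proj, inner_smul_right, inner_smul_left]
  simp only [pcoef, conj_trivial]
  ring

theorem corr_eq (hφ : φ ∈ smoothST d) (hψ : ψ ∈ smoothST d) (t : ℝ) :
    corr φ ψ t = ∫ θ : Sph d, (∫ x, φ (flow t (x, θ)) * ψ (x, θ)) ∂(sphVol d) :=
  integral_prod_symm _ (integrable_of_continuous_ST
    (((continuous_of_mem_smoothST hφ).comp (continuous_flow t)).mul
      (continuous_of_mem_smoothST hψ)))

theorem hasSum_corr (hφ : φ ∈ smoothST d) (hψ : ψ ∈ smoothST d) (t : ℝ) :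
    HasSum (fun ξ => (((2 * π) ^ d : ℝ) : ℂ) * corrMode φ ψ ξ t) (corr φ ψ t) := by
  have hn : ∀ ξ (θ : Sph d), ‖(((2 * π) ^ d : ℝ) : ℂ) * (pcoef φ ξ θ * pcoef ψ (-ξ) θ *
      Complex.exp (Complex.I * (inner ℝ (t • freq ξ) (θ : E d) : ℝ)))‖ ≤
      (2 * π) ^ d * (fibreNorm φ ξ * wnorm 0 ψ) := fun ξ θ => by
    rw [norm_mul, norm_mul, norm_mul, mul_comm Complex.I, Complex.norm_exp_ofReal_mul_I, mul_one,
      Complex.norm_real, Real.norm_of_nonneg (by positivity)]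
    have := fibreNorm_nonneg φ ξ
    gcongr
    · exact norm_pcoef_le hφ _ _
    · exact norm_pcoef_le_wnorm hψ _ _
  have hc : ∀ ξ, Continuous fun θ : Sph d => (((2 * π) ^ d : ℝ) : ℂ) *
      (pcoef φ ξ θ * pcoef ψ (-ξ) θ *
        Complex.exp (Complex.I * (inner ℝ (t • freq ξ) (θ : E d) : ℝ))) := fun ξ => by
    have h1 := continuous_pcoef hφ ξ
    have h2 := continuous_pcoef hψ (-ξ)
    fun_prop
  have h := hasSum_integral_of_summable_integral_norm (μ := sphVol d)
    (F := fun ξ (θ : Sph d) => (((2 * π) ^ d : ℝ) : ℂ) * (pcoef φ ξ θ * pcoef ψ (-ξ) θ *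
      Complex.exp (Complex.I * (inner ℝ (t • freq ξ) (θ : E d) : ℝ))))
    (fun ξ => integrable_of_continuous_sph (hc ξ)) (by
      refine Summable.of_nonneg_of_le (fun ξ => integral_nonneg fun _ => norm_nonneg _)
        (fun ξ => ?_) ((((summable_fibreNorm hφ).mul_right (wnorm 0 ψ)).mul_left
          ((2 * π) ^ d)).mul_left ((sphVol d).real univ))
      refine (integral_mono (integrable_of_continuous_sph (hc ξ)).norm
        (integrable_const _) (hn ξ)).trans_eq ?_
      rw [integral_const, smul_eq_mul])
  rw [corr_eq hφ hψ]
  have h2 : (fun θ : Sph d => ∫ x, φ (flow t (x, θ)) * ψ (x, θ)) = fun θ => ∑' ξ,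
      (((2 * π) ^ d : ℝ) : ℂ) * (pcoef φ ξ θ * pcoef ψ (-ξ) θ *
      Complex.exp (Complex.I * (inner ℝ (t • freq ξ) (θ : E d) : ℝ))) :=
    funext fun θ => (hasSum_integral_flow hφ hψ t θ).tsum_eq.symm
  rw [h2]
  refine (hasSum_iff_of_eq fun ξ => ?_).2 h
  rw [integral_const_mul]
  rfl

theorem hasSum_pcoef_mul_pcoef (hφ : φ ∈ smoothST d) (hψ : ψ ∈ smoothST d) (ξ ζ : Fin d → ℤ)
    (θ : Sph d) :
    HasSum (fun k : (Fin d → ℤ) × (Fin d → ℤ) => fcoef φ (ξ, k.1) * fcoef ψ (ζ, k.2) *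
      Complex.exp (Complex.I * (inner ℝ (freq k.1 + freq k.2) (θ : E d) : ℝ)))
      (pcoef φ ξ θ * pcoef ψ ζ θ) := by
  have h1 := hasSum_pcoef hφ ξ θ
  have h2 := hasSum_pcoef hψ ζ θ
  have hs := summable_mul_of_summable_norm
    (f := fun η => fcoef φ (ξ, η) * wave η (θ : E d))
    (g := fun η => fcoef ψ (ζ, η) * wave η (θ : E d))
    (by simpa only [norm_mul, norm_wave, mul_one] using summable_norm_fcoef_fibre hφ ξ)
    (by simpa only [norm_mul, norm_wave, mul_one] using summable_norm_fcoef_fibre hψ ζ)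
  refine (hasSum_iff_of_eq fun k => ?_).1 (h1.mul h2 hs)
  rw [inner_add_left, Complex.ofReal_add, mul_add, Complex.exp_add, wave, wave]
  ring

/-- Once both coefficients are expanded in plane waves, the amplitudes are absorbed in the
frequency, and only the Fourier transform of the surface measure at shifted points remains. -/
theorem hasSum_corrMode (hφ : φ ∈ smoothST d) (hψ : ψ ∈ smoothST d) (ξ : Fin d → ℤ) (t : ℝ) :
    HasSum (fun k : (Fin d → ℤ) × (Fin d → ℤ) => fcoef φ (ξ, k.1) * fcoef ψ (-ξ, k.2) *
      sphFT (t • freq ξ + (freq k.1 + freq k.2))) (corrMode φ ψ ξ t) := by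
  set F : (Fin d → ℤ) × (Fin d → ℤ) → Sph d → ℂ := fun k θ => fcoef φ (ξ, k.1) * fcoef ψ (-ξ, k.2) *
      Complex.exp (Complex.I * (inner ℝ (t • freq ξ + (freq k.1 + freq k.2)) (θ : E d) : ℝ)) with hF
  have hn : ∀ k θ, ‖F k θ‖ = ‖fcoef φ (ξ, k.1)‖ * ‖fcoef ψ (-ξ, k.2)‖ := fun k θ => by
    rw [hF, norm_mul, norm_mul, mul_comm Complex.I, Complex.norm_exp_ofReal_mul_I, mul_one]
  have hs := (summable_norm_fcoef_fibre hφ ξ).mul_of_nonneg (summable_norm_fcoef_fibre hψ (-ξ))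
    (fun _ => norm_nonneg _) (fun _ => norm_nonneg _)
  have h := hasSum_integral_of_summable_integral_norm (μ := sphVol d) (F := F)
    (fun k => integrable_of_continuous_sph (by fun_prop)) (by
      simp only [hn, integral_const, smul_eq_mul]
      exact hs.mul_left _)
  have h2 : (fun θ : Sph d => pcoef φ ξ θ * pcoef ψ (-ξ) θ *
      Complex.exp (Complex.I * (inner ℝ (t • freq ξ) (θ : E d) : ℝ))) = fun θ => ∑' k, F k θ :=
    funext fun θ => by
      rw [← ((hasSum_pcoef_mul_pcoef hφ hψ ξ (-ξ) θ).mul_right _).tsum_eq]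
      refine tsum_congr fun k => ?_
      simp only [hF]
      rw [inner_add_left (t • freq ξ), Complex.ofReal_add, mul_add, Complex.exp_add]
      ring
  rw [corrMode, h2]
  refine (hasSum_iff_of_eq fun k => ?_).2 h
  rw [hF, integral_const_mul]
  rfl

end Smooth

/-! ### Asymptotics of the correlation form -/

theorem exp_units_inner_eq (ε : ℤˣ) (ξ : Freq d) (v : E d) :
    Complex.exp (((ε : ℤ) : ℂ) * Complex.I * (inner ℝ v (‖freq ξ.1‖⁻¹ • freq ξ.1) : ℝ)) =
      Complex.exp (Complex.I * (inner ℝ v (dir ε ξ : E d) : ℝ)) := by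
  rw [dir, inner_smul_right _ _ (((ε : ℤ) : ℝ))]
  push_cast
  ring_nf

/-- The leading contribution of the frequency `ξ` and of the direction `ε ξ/|ξ|`. -/
def leadingMode (φ ψ : ST d → ℂ) (ε : ℤˣ) (t : ℝ) (ξ : Freq d) : ℂ :=
  halfWave d ε t ‖freq ξ.1‖ * (pcoef φ ξ.1 (dir ε ξ) * pcoef ψ (-ξ.1) (dir ε ξ))

theorem leading_amplitude_eq (ε : ℤˣ) {t r : ℝ} (ht : 0 ≤ t) (hr : 0 ≤ r) :
    (((2 * π / (t * r)) ^ (((d : ℝ) - 1) / 2) : ℝ) : ℂ) *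
        Complex.exp (((ε : ℤ) : ℂ) * Complex.I * (t * r : ℝ)) =
      (((2 * π / t) ^ (((d : ℝ) - 1) / 2) : ℝ) : ℂ) * halfWave d ε t r := by
  rw [halfWave, ← div_div, Real.div_rpow (by positivity) hr]
  push_cast
  rw [mul_assoc _ (t : ℂ)]
  ring

/-- Apply `sphFT_shift` termwise with `r = t|ξ|` and shift `η + η'`. The leading plane waves resum
to the product of the two coefficients at the poles, and the errors are summed with the weights. -/
theorem corrMode_asymptotics (d : ℕ) [NeZero d] :
    ∃ C, 0 ≤ C ∧ ∀ φ ∈ smoothST d, ∀ ψ ∈ smoothST d, ∀ (ξ : Freq d) (t : ℝ), 1 ≤ t →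
      ‖corrMode φ ψ ξ.1 t - (((2 * π / t) ^ (((d : ℝ) - 1) / 2) : ℝ) : ℂ) *
        ∑ ε : ℤˣ, polePhase d ε * leadingMode φ ψ ε t ξ‖ ≤
      C * t ^ (-(((d : ℝ) - 1) / 2 + 1)) * (fibreWt (d + 2) φ ξ.1 * fibreWt (d + 2) ψ (-ξ.1)) := by
  obtain ⟨C, hC, hS⟩ := sphFT_shift d
  refine ⟨C, hC, fun φ hφ ψ hψ ξ t ht => ?_⟩
  set m : ℝ := ((d : ℝ) - 1) / 2 with hm
  have hm0 : 0 ≤ m := half_sub_one_nonneg d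
  set r := ‖freq ξ.1‖ with hr
  have hr1 : 1 ≤ r := one_le_norm_freq ξ.2
  set u : E d := r⁻¹ • freq ξ.1 with hu
  have hu1 : ‖u‖ = 1 := by
    rw [hu, norm_smul, norm_inv, norm_norm, ← hr, inv_mul_cancel₀ (by positivity)]
  have htr : 1 ≤ t * r := one_le_mul_of_one_le_of_one_le ht hr1
  have hv : (t * r) • u = t • freq ξ.1 := by
    rw [hu, smul_smul, mul_assoc, mul_inv_cancel₀ (by positivity), mul_one]
  set c : (Fin d → ℤ) × (Fin d → ℤ) → ℂ :=
    fun k => fcoef φ (ξ.1, k.1) * fcoef ψ (-ξ.1, k.2) with hc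
  set amp : ℂ := (((2 * π / (t * r)) ^ m : ℝ) : ℂ) with hamp
  have hlead : HasSum (fun k : (Fin d → ℤ) × (Fin d → ℤ) => c k * (amp *
      ∑ ε : ℤˣ, polePhase d ε * Complex.exp (((ε : ℤ) : ℂ) * Complex.I * (t * r : ℝ)) *
        Complex.exp (((ε : ℤ) : ℂ) * Complex.I * (inner ℝ (freq k.1 + freq k.2) u : ℝ))))
      ((((2 * π / t) ^ m : ℝ) : ℂ) * ∑ ε : ℤˣ, polePhase d ε * leadingMode φ ψ ε t ξ) := by
    have h1 := hasSum_sum (s := Finset.univ) fun (ε : ℤˣ) _ =>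
      (hasSum_pcoef_mul_pcoef hφ hψ ξ.1 (-ξ.1) (dir ε ξ)).mul_left
        ((((2 * π / t) ^ m : ℝ) : ℂ) * (polePhase d ε * halfWave d ε t r))
    have h2 : ∑ ε : ℤˣ, (((2 * π / t) ^ m : ℝ) : ℂ) * (polePhase d ε * halfWave d ε t r) *
        (pcoef φ ξ.1 (dir ε ξ) * pcoef ψ (-ξ.1) (dir ε ξ)) =
        (((2 * π / t) ^ m : ℝ) : ℂ) * ∑ ε : ℤˣ, polePhase d ε * leadingMode φ ψ ε t ξ := by
      rw [Finset.mul_sum]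
      refine Finset.sum_congr rfl fun ε _ => ?_
      rw [leadingMode]
      ring
    rw [h2] at h1
    refine (hasSum_iff_of_eq fun k => ?_).1 h1
    rw [Finset.mul_sum, Finset.mul_sum]
    refine Finset.sum_congr rfl fun ε _ => ?_
    rw [exp_units_inner_eq]
    have h3 := leading_amplitude_eq (d := d) ε (t := t) (r := r) (by linarith) (by linarith)
    rw [← hm] at h3
    linear_combination (-(polePhase d ε * c k *
      Complex.exp (Complex.I * (inner ℝ (freq k.1 + freq k.2) (dir ε ξ : E d) : ℝ)))) * h3
  have hdiff := (hasSum_corrMode hφ hψ ξ.1 t).sub hlead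
  rw [← hdiff.tsum_eq]
  have hsum := ((summable_weighted_fibre hφ (d + 2) ξ.1).mul_of_nonneg
    (summable_weighted_fibre hψ (d + 2) (-ξ.1)) (fun _ => by positivity) (fun _ => by positivity))
  have hprod := ((summable_weighted_fibre hφ (d + 2) ξ.1).hasSum.mul
    (summable_weighted_fibre hψ (d + 2) (-ξ.1)).hasSum hsum).mul_left (C * t ^ (-(m + 1)))
  refine tsum_of_norm_bounded hprod fun k => ?_
  rw [← mul_sub, norm_mul, norm_mul]
  have h4 := hS u (freq k.1 + freq k.2) (t * r) hu1 htr
  rw [hv] at h4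
  have h5 : (t * r) ^ (-(m + 1)) ≤ t ^ (-(m + 1)) :=
    Real.rpow_le_rpow_of_nonpos (by linarith) (le_mul_of_one_le_right (by linarith) hr1)
      (by linarith)
  -- The weight splits, so the double series of errors factors into one `fibreWt` for each function.
  have h6 : 1 + ‖freq k.1 + freq k.2‖ ≤ (1 + ‖freq k.1‖) * (1 + ‖freq k.2‖) := by
    have := norm_add_le (freq k.1) (freq k.2)
    nlinarith [norm_nonneg (freq k.1), norm_nonneg (freq k.2)]
  calc _ ≤ ‖fcoef φ (ξ.1, k.1)‖ * ‖fcoef ψ (-ξ.1, k.2)‖ * (C * (t * r) ^ (-(m + 1)) *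
        (1 + ‖freq k.1 + freq k.2‖) ^ (d + 2)) := by gcongr
    _ ≤ ‖fcoef φ (ξ.1, k.1)‖ * ‖fcoef ψ (-ξ.1, k.2)‖ * (C * t ^ (-(m + 1)) *
        ((1 + ‖freq k.1‖) * (1 + ‖freq k.2‖)) ^ (d + 2)) := by gcongr
    _ = _ := by rw [mul_pow]; ring

theorem summable_leadingMode [NeZero d] {φ ψ : ST d → ℂ} (hφ : φ ∈ smoothST d)
    (hψ : ψ ∈ smoothST d) (ε : ℤˣ) (t : ℝ) : Summable (leadingMode φ ψ ε t) := by
  refine .of_norm (Summable.of_nonneg_of_le (fun _ => norm_nonneg _) (fun ξ => ?_)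
    (((summable_fibreNorm hφ).comp_injective
      (Subtype.val_injective : Function.Injective fun ξ : Freq d => ξ.1)).mul_right (wnorm 0 ψ)))
  rw [leadingMode, norm_mul, norm_mul, ← one_mul (_ * wnorm 0 ψ)]
  have := fibreNorm_nonneg φ ξ.1
  gcongr
  · exact norm_halfWave_le_one d ε t (one_le_norm_freq ξ.2)
  · exact norm_pcoef_le hφ _ _
  · exact norm_pcoef_le_wnorm hψ _ _

theorem P0_eq_pcoef (φ : ST d → ℂ) (θ : Sph d) : P0 φ θ = pcoef φ 0 θ := by
  simp [P0, pcoef, coef, chr_zero]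

theorem corrMode_zero (φ ψ : ST d → ℂ) (t : ℝ) :
    corrMode φ ψ 0 t = ∫ θ, P0 φ θ * P0 ψ θ ∂(sphVol d) := by
  have h : freq (0 : Fin d → ℤ) = 0 := by ext i; simp [freq]
  simp [corrMode, h, P0_eq_pcoef]

theorem hasSum_freq {F : (Fin d → ℤ) → ℂ} {s : ℂ} (h : HasSum F s) :
    HasSum (fun ξ : Freq d => F ξ.1) (s - F 0) := by
  have h1 := hasSum_ite_sub_hasSum h 0
  rw [← (Subtype.val_injective : Function.Injective fun ξ : Freq d => ξ.1).hasSum_iff] at h1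
  · refine (hasSum_iff_of_eq fun ξ => ?_).1 h1
    simp only [Function.comp, if_neg ξ.2]
  · intro ξ hξ
    rw [if_pos]
    by_contra h0
    exact hξ ⟨⟨ξ, h0⟩, rfl⟩

theorem hasSum_corr_freq [NeZero d] {φ ψ : ST d → ℂ} (hφ : φ ∈ smoothST d)
    (hψ : ψ ∈ smoothST d) (t : ℝ) :
    HasSum (fun ξ : Freq d => (((2 * π) ^ d : ℝ) : ℂ) * corrMode φ ψ ξ.1 t)
      (corr φ ψ t - (((2 * π) ^ d : ℝ) : ℂ) * ∫ θ, P0 φ θ * P0 ψ θ ∂(sphVol d)) := by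
  rw [← corrMode_zero φ ψ t]
  exact hasSum_freq (hasSum_corr hφ hψ t)

/-- Decay of correlations to second order, with an explicit dependence on the functions. -/
theorem corr_asymptotics (d : ℕ) [NeZero d] :
    ∃ C, 0 ≤ C ∧ ∀ φ ∈ smoothST d, ∀ ψ ∈ smoothST d, ∀ t : ℝ, 1 ≤ t →
      ‖corr φ ψ t - ((((2 * π) ^ d : ℝ) : ℂ) * ∫ θ, P0 φ θ * P0 ψ θ ∂(sphVol d) +
        (((2 * π) ^ d : ℝ) : ℂ) * ((((2 * π / t) ^ (((d : ℝ) - 1) / 2) : ℝ) : ℂ) *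
        ∑ ε : ℤˣ, polePhase d ε * ∑' ξ, leadingMode φ ψ ε t ξ))‖ ≤
      C * (wnorm (d + 2) φ * wnorm (d + 2) ψ) * t ^ (-(((d : ℝ) - 1) / 2 + 1)) := by
  obtain ⟨C, hC, hm⟩ := corrMode_asymptotics d
  refine ⟨(2 * π) ^ d * C, by positivity, fun φ hφ ψ hψ t ht => ?_⟩
  set m : ℝ := ((d : ℝ) - 1) / 2
  have hlead : HasSum (fun ξ : Freq d => (((2 * π) ^ d : ℝ) : ℂ) *
      ((((2 * π / t) ^ m : ℝ) : ℂ) * ∑ ε : ℤˣ, polePhase d ε * leadingMode φ ψ ε t ξ))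
      ((((2 * π) ^ d : ℝ) : ℂ) * ((((2 * π / t) ^ m : ℝ) : ℂ) *
        ∑ ε : ℤˣ, polePhase d ε * ∑' ξ, leadingMode φ ψ ε t ξ)) :=
    ((hasSum_sum fun ε _ => (summable_leadingMode hφ hψ ε t).hasSum.mul_left _).mul_left
      _).mul_left _
  have hdiff := (hasSum_corr_freq hφ hψ t).sub hlead
  rw [← sub_sub, ← hdiff.tsum_eq]
  have hsF : Summable fun ξ : Freq d => fibreWt (d + 2) φ ξ.1 :=
    (summable_fibreWt hφ (d + 2)).comp_injective Subtype.val_injective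
  -- In the sum over `ξ` the factor of `φ` is summed, while that of `ψ` is bounded uniformly by its
  -- full norm.
  refine (tsum_of_norm_bounded (((hsF.mul_right (wnorm (d + 2) ψ)).mul_left
    ((2 * π) ^ d * (C * t ^ (-(m + 1))))).hasSum) fun ξ => ?_).trans ?_
  · rw [← mul_sub, norm_mul, Complex.norm_real, Real.norm_of_nonneg (by positivity), mul_assoc]
    gcongr
    refine (hm φ hφ ψ hψ ξ t ht).trans ?_
    have := fibreWt_nonneg (d + 2) φ ξ.1
    gcongr
    exact fibreWt_le hψ _ _
  · rw [tsum_mul_left, tsum_mul_right]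
    have h1 : ∑' ξ : Freq d, fibreWt (d + 2) φ ξ.1 ≤ wnorm (d + 2) φ := by
      refine le_trans ?_ (tsum_fibreWt_le hφ (d + 2))
      exact (summable_fibreWt hφ (d + 2)).tsum_subtype_le (fun ξ => fibreWt (d + 2) φ ξ) _
        fun _ => fibreWt_nonneg _ _ _
    have h2 := wnorm_nonneg (d + 2) ψ
    calc _ ≤ (2 * π) ^ d * (C * t ^ (-(m + 1))) * (wnorm (d + 2) φ * wnorm (d + 2) ψ) := by
          gcongr
      _ = _ := by ring

/-! ### Identification of the terms of the expansions -/

theorem coef_conj (f : Torus d → ℂ) (ξ : Fin d → ℤ) :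
    coef (fun x => conj (f x)) (-ξ) = conj (coef f ξ) := by
  simp only [coef, chr_neg, map_mul, map_inv₀, Complex.conj_ofReal, ← integral_conj,
    Complex.ofReal_inv]

theorem pcoef_conj (φ : ST d → ℂ) (ξ : Fin d → ℤ) (θ : Sph d) :
    pcoef (fun p => conj (φ p)) (-ξ) θ = conj (pcoef φ ξ θ) :=
  coef_conj (fun x => φ (x, θ)) ξ

theorem cor_eq_corr (φ ψ : ST d → ℂ) (t : ℝ) :
    cor φ ψ t = corr φ (fun p => conj (ψ p)) t := rfl

theorem innerS_P0 (φ ψ : ST d → ℂ) :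
    innerS (P0 φ) (P0 ψ) = ∫ θ, P0 φ θ * P0 (fun p => conj (ψ p)) θ ∂(sphVol d) := by
  have h : ∀ θ, P0 (fun p => conj (ψ p)) θ = conj (P0 ψ θ) := fun θ => by
    simpa only [neg_zero, ← P0_eq_pcoef] using pcoef_conj ψ 0 θ
  simp only [innerS, h]

section Smooth

variable [NeZero d] {φ ψ : ST d → ℂ}

theorem conj_mem_smoothST (hφ : φ ∈ smoothST d) : (fun p => conj (φ p)) ∈ smoothST d := by
  rw [mem_smoothST]
  exact (Complex.conjCLE.contDiff (n := ∞)).contMDiff.comp (mem_smoothST.1 hφ)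

theorem continuous_of_mem_smoothT {f : Torus d → ℂ} (hf : f ∈ smoothT d) : Continuous f :=
  continuous_of_hasSum_chr (rapidDecay_coef hf).summable (hasSum_coef_mul_chr hf)

theorem coef_Pi0 (hφ : φ ∈ smoothST d) (ε : ℤˣ) (ξ : Freq d) :
    coef (Pi0 ε φ) ξ.1 = pcoef φ ξ.1 (dir ε ξ) :=
  have h := rapidDecay_pcoef (ξ := fun ξ : Freq d => ξ.1) Subtype.val_injective hφ (dir ε)
  coef_eq_of_injective Subtype.val_injective h.summable h.hasSum ξ

theorem coef_Pop (hφ : φ ∈ smoothST d) (ε : ℤˣ) (ξ : Freq d) :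
    coef (Pop ε φ) (-ξ.1) = pcoef φ (-ξ.1) (dir ε ξ) := by
  have h := rapidDecay_pcoef neg_val_injective hφ (dir ε)
  rw [Pop_eq]
  exact coef_eq_of_injective neg_val_injective h.summable h.hasSum ξ

theorem coef_sqrtLapFun {m : ℝ → ℂ} (hm : ∀ r, 1 ≤ r → ‖m r‖ ≤ 1) {f : Torus d → ℂ}
    (hf : f ∈ smoothT d) (ξ : Freq d) :
    coef (sqrtLapFun m f) ξ.1 = m ‖freq ξ.1‖ * coef f ξ.1 :=
  have h := rapidDecay_mul_coef hm hf
  coef_eq_of_injective Subtype.val_injective h.summable h.hasSum ξ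

theorem innerT_sqrtLapFun_Pi0 (hφ : φ ∈ smoothST d) (hψ : ψ ∈ smoothST d) (ε : ℤˣ) (t : ℝ) :
    innerT (sqrtLapFun (halfWave d ε t) (Pi0 ε φ)) (Pi0 ε ψ) =
      (((2 * π) ^ d : ℝ) : ℂ) * ∑' ξ, leadingMode φ (fun p => conj (ψ p)) ε t ξ := by
  have hr := rapidDecay_mul_coef (fun r hr => norm_halfWave_le_one d ε t hr)
    (Pi0_mem_smoothT hφ ε)
  have h := hasSum_integral_mul hr.summable hr.hasSum (g := fun x => conj (Pi0 ε ψ x))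
    (Complex.continuous_conj.comp (continuous_of_mem_smoothT (Pi0_mem_smoothT hψ ε)))
  rw [← tsum_mul_left]
  refine h.tsum_eq.symm.trans (tsum_congr fun ξ => ?_)
  rw [coef_conj, coef_Pi0 hφ, coef_Pi0 hψ, leadingMode, pcoef_conj]
  ring

/-- The sign reversals of `Pop` and `Pdag` agree, and the multiplier depends only on `|ξ|`. The
pairing thus reproduces the leading modes of the bilinear form. -/
theorem Pdag_sqrtLapFun_Pop (hψ : ψ ∈ smoothST d) (φ : smoothST d) (ε : ℤˣ) (t : ℝ) :
    Pdag ε (sqrtLapFun (shiftedHalfWave d ε t) (Pop ε ψ)) φ =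
      (((2 * π) ^ d : ℝ) : ℂ) * (polePhase d ε * ∑' ξ, leadingMode φ.1 ψ ε t ξ) := by
  rw [Pdag, ← tsum_mul_left, ← tsum_mul_left]
  refine tsum_congr fun ξ => ?_
  have h := coef_sqrtLapFun (fun r hr => norm_shiftedHalfWave_le_one d ε t hr)
    (Pop_mem_smoothT hψ ε) ⟨-ξ.1, neg_ne_zero.2 ξ.2⟩
  rw [PdagTerm_eq, h, coef_Pop hψ, leadingMode, freq_neg, norm_neg,
    shiftedHalfWave_eq d ε t (norm_nonneg _)]
  ring

/-- This expresses the invariance of the Liouville measure under the flow; on the Fourier side it is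
the change `ξ ↦ -ξ`. -/
theorem corr_neg (hφ : φ ∈ smoothST d) (hψ : ψ ∈ smoothST d) (t : ℝ) :
    corr ψ φ (-t) = corr φ ψ t := by
  have h1 := hasSum_corr hψ hφ (-t)
  have h2 := (Equiv.neg (Fin d → ℤ)).hasSum_iff.2 (hasSum_corr hφ hψ t)
  refine h1.unique ((hasSum_iff_of_eq fun ξ => ?_).1 h2)
  simp only [Function.comp, Equiv.neg_apply, corrMode, neg_neg, freq_neg, smul_neg, neg_smul,
    mul_comm (pcoef ψ ξ _)]

theorem continuous_P0 (hψ : ψ ∈ smoothST d) : Continuous (P0 ψ) := by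
  rw [funext (P0_eq_pcoef ψ)]
  exact continuous_pcoef hψ 0

theorem integral_P0_mul (hφ : φ ∈ smoothST d) (hψ : ψ ∈ smoothST d) :
    ∫ p, P0 ψ p.2 * φ p ∂(liouville d) =
      (((2 * π) ^ d : ℝ) : ℂ) * ∫ θ, P0 φ θ * P0 ψ θ ∂(sphVol d) := by
  have hp : (((2 * π : ℝ) ^ d : ℝ) : ℂ) ≠ 0 := by
    exact_mod_cast (pow_pos Real.two_pi_pos d).ne'
  have h : ∫ p, P0 ψ p.2 * φ p ∂(liouville d) =
      ∫ θ, (∫ x, P0 ψ θ * φ (x, θ)) ∂(sphVol d) :=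
    integral_prod_symm _ (integrable_of_continuous_ST
      (((continuous_P0 hψ).comp continuous_snd).mul (continuous_of_mem_smoothST hφ)))
  rw [h, ← integral_const_mul]
  refine integral_congr_ae (Eventually.of_forall fun θ => ?_)
  simp only [integral_const_mul, P0]
  push_cast at hp ⊢
  field_simp

/-! ### The remainder as a distribution -/

/-- The remainder of the expansion of `ψ ∘ e^{-tV}`. -/
def remainder (ψ : ST d → ℂ) (t : ℝ) (φ : smoothST d) : ℂ :=
  ofFun (fun p => ((t ^ (((d : ℝ) - 1) / 2) : ℝ) : ℂ) * (ψ (flow (-t) p) - P0 ψ p.2)) φ -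
    (((2 * π) ^ (((d : ℝ) - 1) / 2) : ℝ) : ℂ) *
      ∑ ε : ℤˣ, Pdag ε (sqrtLapFun (shiftedHalfWave d ε t) (Pop ε ψ)) φ

theorem ofFun_flow_sub_P0 (φ : smoothST d) (hψ : ψ ∈ smoothST d) (c : ℂ) (t : ℝ) :
    ofFun (fun p => c * (ψ (flow (-t) p) - P0 ψ p.2)) φ =
      c * (corr φ.1 ψ t - (((2 * π) ^ d : ℝ) : ℂ) * ∫ θ, P0 φ.1 θ * P0 ψ θ ∂(sphVol d)) := by
  have h1 : Integrable (fun p => ψ (flow (-t) p) * φ.1 p) (liouville d) :=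
    integrable_of_continuous_ST (((continuous_of_mem_smoothST hψ).comp
      (continuous_flow (-t))).mul (continuous_of_mem_smoothST φ.2))
  have h2 : Integrable (fun p => P0 ψ p.2 * φ.1 p) (liouville d) := integrable_of_continuous_ST
    (((continuous_P0 hψ).comp continuous_snd).mul (continuous_of_mem_smoothST φ.2))
  rw [← corr_neg φ.2 hψ, ← integral_P0_mul φ.2 hψ, corr, ← integral_sub h1 h2,
    ← integral_const_mul, ofFun]
  refine integral_congr_ae (Eventually.of_forall fun p => ?_)
  ring

theorem isLinearMap_ofFun {u : ST d → ℂ} (hu : Continuous u) : IsLinearMap ℂ (ofFun u) := by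
  have hi : ∀ φ : smoothST d, Integrable (fun p => u p * φ.1 p) (liouville d) := fun φ =>
    integrable_of_continuous_ST (hu.mul (continuous_of_mem_smoothST φ.2))
  refine ⟨fun φ₁ φ₂ => ?_, fun c φ => ?_⟩
  · simp only [ofFun, Submodule.coe_add, Pi.add_apply, mul_add]
    exact integral_add (hi φ₁) (hi φ₂)
  · simp only [ofFun, Submodule.coe_smul, Pi.smul_apply, smul_eq_mul, ← integral_const_mul]
    refine integral_congr_ae (Eventually.of_forall fun p => ?_)
    simp only
    ring

theorem isLinearMap_remainder (hψ : ψ ∈ smoothST d) (t : ℝ) :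
    IsLinearMap ℂ (remainder ψ t) := by
  have h1 : IsLinearMap ℂ (ofFun (fun p : ST d =>
      ((t ^ (((d : ℝ) - 1) / 2) : ℝ) : ℂ) * (ψ (flow (-t) p) - P0 ψ p.2))) :=
    isLinearMap_ofFun (continuous_const.mul (((continuous_of_mem_smoothST hψ).comp
      (continuous_flow (-t))).sub ((continuous_P0 hψ).comp continuous_snd)))
  have h2 : ∀ ε : ℤˣ,
      IsLinearMap ℂ (Pdag ε (sqrtLapFun (shiftedHalfWave d ε t) (Pop ε ψ))) := fun ε =>
    (isDistribution_Pdag (sqrtLapFun_mem_smoothT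
      (fun r hr => norm_shiftedHalfWave_le_one d ε t hr) (Pop_mem_smoothT hψ ε)) ε).1
  refine ⟨fun φ₁ φ₂ => ?_, fun c φ => ?_⟩
  · simp only [remainder, h1.map_add, (h2 _).map_add, Finset.sum_add_distrib]
    ring
  · simp only [remainder, h1.map_smul, (h2 _).map_smul, smul_eq_mul, ← Finset.mul_sum]
    ring

/-- The remainder is `t^((d-1)/2)` times the error of `corr_asymptotics`, because `t^m (2π/t)^m =
(2π)^m`. The norm of `ψ` goes into the constant, and that of `φ` is bounded by a `C^N` norm. -/
theorem exists_norm_remainder_le (hψ : ψ ∈ smoothST d) :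
    ∃ (N : ℕ) (C : ℝ), ∀ t : ℝ, 1 ≤ t → ∀ φ : smoothST d,
      ‖remainder ψ t φ‖ ≤ C * cNorm N φ.1 * |t⁻¹| := by
  obtain ⟨C, hC, hc⟩ := corr_asymptotics d
  obtain ⟨N, A, hA, hN⟩ := exists_wnorm_le d (d + 2)
  refine ⟨N, C * A * wnorm (d + 2) ψ, fun t ht φ => ?_⟩
  have ht0 : 0 < t := by linarith
  set m : ℝ := ((d : ℝ) - 1) / 2 with hm
  have hpow : ((t ^ m : ℝ) : ℂ) * (((2 * π / t) ^ m : ℝ) : ℂ) = (((2 * π) ^ m : ℝ) : ℂ) := by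
    rw [← Complex.ofReal_mul, ← Real.mul_rpow ht0.le (by positivity), mul_div_cancel₀ _ ht0.ne']
  have heq : remainder ψ t φ = ((t ^ m : ℝ) : ℂ) *
      (corr φ.1 ψ t - ((((2 * π) ^ d : ℝ) : ℂ) * ∫ θ, P0 φ.1 θ * P0 ψ θ ∂(sphVol d) +
        (((2 * π) ^ d : ℝ) : ℂ) * ((((2 * π / t) ^ m : ℝ) : ℂ) *
        ∑ ε : ℤˣ, polePhase d ε * ∑' ξ, leadingMode φ.1 ψ ε t ξ))) := by
    rw [remainder, ofFun_flow_sub_P0 φ hψ, ← hm, ← hpow]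
    simp only [Pdag_sqrtLapFun_Pop hψ, ← Finset.mul_sum]
    ring
  rw [heq, norm_mul, Complex.norm_real, Real.norm_of_nonneg (by positivity)]
  have hW := wnorm_nonneg (d + 2) ψ
  have hexp : t ^ m * t ^ (-(m + 1)) = |t⁻¹| := by
    rw [← Real.rpow_add ht0, abs_of_pos (by positivity), ← Real.rpow_neg_one]
    congr 1
    ring
  calc _ ≤ t ^ m * (C * (wnorm (d + 2) φ.1 * wnorm (d + 2) ψ) * t ^ (-(m + 1))) := by
        gcongr
        exact hc φ.1 φ.2 ψ hψ t ht
    _ = C * (wnorm (d + 2) φ.1 * wnorm (d + 2) ψ) * |t⁻¹| := by rw [← hexp]; ring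
    _ ≤ C * (A * cNorm N φ.1 * wnorm (d + 2) ψ) * |t⁻¹| := by
        gcongr
        exact hN φ.1 φ.2
    _ = _ := by ring

theorem isBigODistribution_remainder (hψ : ψ ∈ smoothST d) :
    IsBigODistribution (remainder ψ) fun t => t⁻¹ := by
  obtain ⟨N, C, h⟩ := exists_norm_remainder_le hψ
  refine ⟨?_, N, C, ?_⟩
  · filter_upwards [eventually_ge_atTop 1] with t ht
    refine ⟨isLinearMap_remainder hψ t, N, C * |t⁻¹|, fun φ => ?_⟩
    exact (h t ht φ).trans_eq (mul_right_comm _ _ _)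
  · filter_upwards [eventually_ge_atTop 1] with t ht
    exact h t ht

/-- The bilinear estimate is applied to `φ` and the conjugate of `ψ`, whose coefficient at `-ξ` is
the conjugate of that of `ψ` at `ξ`. -/
theorem cor_asymptotics (hφ : φ ∈ smoothST d) (hψ : ψ ∈ smoothST d) :
    (fun t : ℝ => cor φ ψ t - (((2 * π) ^ d : ℝ) * innerS (P0 φ) (P0 ψ) +
      (((2 * π / t) ^ (((d : ℝ) - 1) / 2) : ℝ) : ℂ) * ∑ ε : ℤˣ, polePhase d ε *
        innerT (sqrtLapFun (halfWave d ε t) (Pi0 ε φ)) (Pi0 ε ψ)))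
      =O[atTop] fun t : ℝ => 1 / t ^ (((d : ℝ) - 1) / 2 + 1) := by
  obtain ⟨C, -, hc⟩ := corr_asymptotics d
  refine IsBigO.of_bound (C * (wnorm (d + 2) φ * wnorm (d + 2) fun p => conj (ψ p))) ?_
  filter_upwards [eventually_ge_atTop 1] with t ht
  have h := hc φ hφ _ (conj_mem_smoothST hψ) t ht
  rw [Real.norm_of_nonneg (by positivity), one_div, ← Real.rpow_neg (by linarith), cor_eq_corr,
    innerS_P0]
  refine le_of_eq_of_le ?_ h
  congr 3
  simp only [innerT_sqrtLapFun_Pi0 hφ hψ, Finset.mul_sum]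
  refine Finset.sum_congr rfl fun ε _ => ?_
  ring

end Smooth

end TorusFlow

end

open TorusFlow in
theorem theorem2p6 (d : ℕ) [NeZero d] :
    -- the operators are well defined, with absolutely convergent series
    (∀ f ∈ smoothST d, ∀ ε : ℤˣ,
      (Summable fun ξ : Freq d => pcoef f ξ.1 (dir ε ξ)) ∧
      Pi0 ε f ∈ smoothT d ∧ Pop ε f ∈ smoothT d) ∧
    (∀ f ∈ smoothT d, ∀ ε : ℤˣ,
      Summable (coef f) ∧
      (∀ t : ℝ, sqrtLapFun (halfWave d ε t) f ∈ smoothT d ∧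
        sqrtLapFun (shiftedHalfWave d ε t) f ∈ smoothT d) ∧
      (∀ φ : smoothST d, Summable (PdagTerm ε f φ)) ∧
      IsDistribution (Pdag ε f)) ∧
    -- asymptotics of the correlation function
    (∀ φ ∈ smoothST d, ∀ ψ ∈ smoothST d,
      (fun t : ℝ => cor φ ψ t -
        (((2 * π) ^ d : ℝ) * innerS (P0 φ) (P0 ψ) +
          (((2 * π / t) ^ (((d : ℝ) - 1) / 2) : ℝ) : ℂ) *
            ∑ ε : ℤˣ, Complex.exp (-((ε : ℤ) : ℂ) * Complex.I * (π / 4) * ((d : ℂ) - 1)) *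
              innerT (sqrtLapFun (halfWave d ε t) (Pi0 ε φ)) (Pi0 ε ψ)))
        =O[atTop] fun t : ℝ => 1 / t ^ (((d : ℝ) - 1) / 2 + 1)) ∧
    -- asymptotics in the sense of distributions
    (∀ ψ ∈ smoothST d,
      IsBigODistribution
        (fun t φ =>
          ofFun (fun p => ((t ^ (((d : ℝ) - 1) / 2) : ℝ) : ℂ) * (ψ (flow (-t) p) - P0 ψ p.2)) φ -
            (((2 * π) ^ (((d : ℝ) - 1) / 2) : ℝ) : ℂ) *
              ∑ ε : ℤˣ, Pdag ε (sqrtLapFun (shiftedHalfWave d ε t) (Pop ε ψ)) φ)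
        fun t => t⁻¹) := by
  refine ⟨fun f hf ε => ⟨?_, Pi0_mem_smoothT hf ε, Pop_mem_smoothT hf ε⟩,
    fun f hf ε => ⟨.of_norm (rapidDecay_coef hf).summable, fun t => ⟨?_, ?_⟩, fun φ => ?_,
      isDistribution_Pdag hf ε⟩,
    fun φ hφ ψ hψ => cor_asymptotics hφ hψ, fun ψ hψ => isBigODistribution_remainder hψ⟩
  · exact .of_norm (rapidDecay_pcoef (ξ := fun ξ : Freq d => ξ.1) Subtype.val_injective hf
      (dir ε)).summable
  · exact sqrtLapFun_mem_smoothT (fun r hr => norm_halfWave_le_one d ε t hr) hf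
  · exact sqrtLapFun_mem_smoothT (fun r hr => norm_shiftedHalfWave_le_one d ε t hr) hf
  · exact .of_norm (summable_norm_PdagTerm_and_tsum_le hf φ.2 ε).1
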